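/- Let $\overline X=X\cup M$ be a compact complex manifold of dimension $n+1$ with smooth boundary $M$ and interior $X$, contained in a complex manifold $Z$ without boundary of the same dimension, and let $\rho$ be a smooth real function on $Z$ with $X=\{\rho<0\}$, $\overline X=\{\rho\le 0\}$, $M=\{\rho=0\}$ and $d\rho\ne 0$ on $M$. Assume that $M$ is strictly pseudoconvex: $\rho_{i\bar j}v^i\overline{v^j}>0$ at each point of $M$ for every nonzero $(1,0)$-vector $v$ with $\partial\rho(v)=0$. Let $g$ be a smooth hermitian metric on $X$ with $g=\partial\bar\partial\log(-1/\rho)$ (that is, $g_{i\bar j}=\partial_i\partial_{\bar j}\log(-1/\rho)$) near $M$. Near $M$ let $\xi$ be the $(1,0)$-vector field with $\rho_i\xi^i=1$, $\rho_{i\bar j}\xi^{\bar j}=r\rho_i$ for a real function $r$, and let $\mathcal H=\operatorname{Ker}\partial\rho\subset T^{1,0}$. Suppose that $\xi$ is extended to a smooth $(1,0)$-vector field on $\overline X\setminus\{p_1,\dots,p_m\}$, $p_j\in X$, such that $\xi=V/|V|_g$ near each $p_j$, where $V$ is a smooth $(1,0)$-vector field on $\overline X$ whose zeros are exactly $p_1,\dots,p_m$,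 all of them nondegenerate, and $V=\xi$ near $M$; and that $\mathcal H$ is extended to a smooth complex subbundle of rank $n$ of $T^{1,0}$ over $\overline X\setminus\{p_1,\dots,p_m\}$ with $T^{1,0}=\operatorname{span}\xi\oplus\mathcal H$. For a local smooth $(1,0)$-frame $W_0,\dots,W_n$ on an open subset of $\overline X\setminus\{p_1,\dots,p_m\}$, with dual coframe $\theta^0,\dots,\theta^n$, let $\psi_i{}^j$ be the connection forms of the Chern connection of $g$ ($\nabla W_i=\psi_i{}^j\otimes W_j$) and put, over $X$, $$\theta_i{}^j=\psi_i{}^j-\frac1{-\rho}\bigl(\delta_i{}^j\rho_k+\delta_k{}^j\rho_i\bigr)\theta^k,\qquad \rho_k=\partial\rho(W_k).$$ Then the forms $\theta_i{}^j$ extend smoothly up to $M$; denote the extensions by $\theta_i{}^j$ too, and put $$\Theta_i{}^j=d\theta_i{}^j-\sum_k\theta_i{}^k\wedge\theta_k{}^j,\qquad c_{n+1}(\Theta)=\det\Bigl(\frac{\sqrt{-1}}{2\pi}\Theta_i{}^j\Bigr).$$ There exists a smooth differential form $\Pi$ of degree $2n+1$ on $\overline X\setminus\{p_1,\dots,p_m\}$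 such that, in every local frame as above, $$c_{n+1}(\Theta)=d\Pi\quad\text{on }\overline X\setminus\{p_1,\dots,p_m\}.$$ Moreover, in every local frame with $W_0=\xi$ and $W_1,\dots,W_n$ in $\mathcal H$, $\Pi$ is given by $$\Pi=\frac1{n!}\Bigl(\frac{\sqrt{-1}}{2\pi}\Bigr)^{n+1}\sum_{k=0}^n\binom nk\bigl(\Phi_k^{(0)}-\Phi_k^{(1)}\bigr),$$ where, omitting wedge signs and letting $S_n$ act on $\{1,\dots,n\}$, $$\Phi_k^{(0)}=\sum_{\sigma,\tau\in S_n}\operatorname{sgn}(\sigma\tau)\,\theta_0{}^0\,\Theta_{\sigma(1)}{}^{\tau(1)}\cdots\Theta_{\sigma(k)}{}^{\tau(k)}\,\theta_{\sigma(k+1)}{}^0\theta_0{}^{\tau(k+1)}\cdots\theta_{\sigma(n)}{}^0\theta_0{}^{\tau(n)}\qquad(0\le k\le n),$$ $$\Phi_k^{(1)}=\sum_{\sigma,\tau\in S_n}\operatorname{sgn}(\sigma\tau)\,\Theta_{\sigma(1)}{}^0\theta_0{}^{\tau(1)}\,\Theta_{\sigma(2)}{}^{\tau(2)}\cdots\Theta_{\sigma(k+1)}{}^{\tau(k+1)}\,\theta_{\sigma(k+2)}{}^0\theta_0{}^{\tau(k+2)}\cdots\theta_{\sigma(n)}{}^0\theta_0{}^{\tau(n)}\qquad(0\le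 k\le n-1),$$ and $\Phi_n^{(1)}=0$. -/

import Mathlib

open Set Filter Topology
open scoped Manifold ContDiff ComplexConjugate

noncomputable section

namespace RenormChern

/-! ### Complex-valued exterior forms on one tangent space -/

/-- Complex-valued real-multilinear alternating `k`-forms on `E`, that is `⋀ᵏ E* ⊗ ℂ`. -/
abbrev CForm (E : Type*) [NormedAddCommGroup E] [NormedSpace ℂ E] (k : ℕ) : Type _ :=
  E [⋀^Fin k]→L[ℝ] ℂ

section Pointwise

variable {E : Type*} [NormedAddCommGroup E] [NormedSpace ℂ E]

/-- A real-linear functional with complex values, as a 1-form. -/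
def oneForm (φ : E →L[ℝ] ℂ) : CForm E 1 :=
  ContinuousAlternatingMap.ofSubsingleton ℝ E ℂ (0 : Fin 1) φ

/-- The multilinear map `(v₁, …, v_{k+l}) ↦ φ (v₁, …, v_k) * η (v_{k+1}, …, v_{k+l})`. -/
def tensorMul {k l : ℕ} (φ : CForm E k) (η : CForm E l) :
    ContinuousMultilinearMap ℝ (fun _ : Fin (k + l) => E) ℂ where
  toFun v := φ (fun i => v (Fin.castAdd l i)) * η (fun j => v (Fin.natAdd k j))
  map_update_add' := by
    intro inst v i x y
    obtain rfl : inst = instDecidableEqFin (k + l) := Subsingleton.elim _ _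
    refine Fin.addCases (fun a => ?_) (fun b => ?_) i
    · have h1 : ∀ z : E, (fun i => Function.update v (Fin.castAdd l a) z (Fin.castAdd l i))
          = Function.update (fun i => v (Fin.castAdd l i)) a z := by
        intro z; ext j; simp [Function.update_apply]
      have h2 : ∀ z : E, (fun j => Function.update v (Fin.castAdd l a) z (Fin.natAdd k j))
          = (fun j => v (Fin.natAdd k j)) := by
        intro z; ext j
        rw [Function.update_of_ne]
        simp [Fin.ext_iff]; omega
      simp only [h1, h2, ContinuousAlternatingMap.map_update_add, add_mul]
    · have h1 : ∀ z : E, (fun i => Function.update v (Fin.natAdd k b) z (Fin.natAdd k i))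
          = Function.update (fun i => v (Fin.natAdd k i)) b z := by
        intro z; ext j; simp [Function.update_apply]
      have h2 : ∀ z : E, (fun j => Function.update v (Fin.natAdd k b) z (Fin.castAdd l j))
          = (fun j => v (Fin.castAdd l j)) := by
        intro z; ext j
        rw [Function.update_of_ne]
        simp [Fin.ext_iff]; omega
      simp only [h1, h2, ContinuousAlternatingMap.map_update_add, mul_add]
  map_update_smul' := by
    intro inst v i c x
    obtain rfl : inst = instDecidableEqFin (k + l) := Subsingleton.elim _ _
    refine Fin.addCases (fun a => ?_) (fun b => ?_) i
    · have h1 : ∀ z : E, (fun i => Function.update v (Fin.castAdd l a) z (Fin.castAdd l i))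
          = Function.update (fun i => v (Fin.castAdd l i)) a z := by
        intro z; ext j; simp [Function.update_apply]
      have h2 : ∀ z : E, (fun j => Function.update v (Fin.castAdd l a) z (Fin.natAdd k j))
          = (fun j => v (Fin.natAdd k j)) := by
        intro z; ext j
        rw [Function.update_of_ne]
        simp [Fin.ext_iff]; omega
      simp only [h1, h2, ContinuousAlternatingMap.map_update_smul, smul_mul_assoc]
    · have h1 : ∀ z : E, (fun i => Function.update v (Fin.natAdd k b) z (Fin.natAdd k i))
          = Function.update (fun i => v (Fin.natAdd k i)) b z := by
        intro z; ext j; simp [Function.update_apply]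
      have h2 : ∀ z : E, (fun j => Function.update v (Fin.natAdd k b) z (Fin.castAdd l j))
          = (fun j => v (Fin.castAdd l j)) := by
        intro z; ext j
        rw [Function.update_of_ne]
        simp [Fin.ext_iff]; omega
      simp only [h1, h2, ContinuousAlternatingMap.map_update_smul, mul_smul_comm]
  cont := by
    refine (φ.cont.comp ?_).mul (η.cont.comp ?_) <;> fun_prop

/-- The wedge product
`(φ ∧ η)(v₁, …, v_{k+l}) = 1/(k! l!) ∑_s sgn(s) φ(v_{s 1}, …, v_{s k}) η(v_{s (k+1)}, …)`.
The degree `m = k + l` of the result is named separately, to avoid casts between degrees. -/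
def wedge {k l m : ℕ} (φ : CForm E k) (η : CForm E l) (h : k + l = m := by omega) : CForm E m :=
  ((k.factorial * l.factorial : ℕ) : ℝ)⁻¹ •
    ContinuousMultilinearMap.alternatization ((tensorMul φ η).domDomCongr (finCongr h))

/-- The ordered product `F 0 ∧ F 1 ∧ ⋯ ∧ F (m - 1)` of `m` two-forms (the constant `1` if `m = 0`). -/
def wedgeProd : (m : ℕ) → (Fin m → CForm E 2) → CForm E (2 * m)
  | 0, _ => ContinuousAlternatingMap.constOfIsEmpty ℝ E (Fin 0) (1 : ℂ)
  | m + 1, F => wedge (wedgeProd m fun i => F i.castSucc) (F (Fin.last m))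

/-- `det ((√-1 / 2π) B)` for a square matrix `B` of two-forms (the entries commute). -/
def topChern {N : ℕ} (B : Fin N → Fin N → CForm E 2) : CForm E (2 * N) :=
  (Complex.I / (2 * Real.pi)) ^ N •
    ∑ σ : Equiv.Perm (Fin N), ((Equiv.Perm.sign σ : ℤ) : ℂ) • wedgeProd N fun i => B i (σ i)

/-- `Φ_k^{(0)}`, from a matrix `A` of one-forms `θ_i^j = A i j` and a matrix `B` of two-forms
`Θ_i^j = B i j`, with indices `0, …, n`; the index `α ∈ {1, …, n}` is `Fin.succ` of an
element of `Fin n`. -/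
def Phi0 {n : ℕ} (A : Fin (n + 1) → Fin (n + 1) → CForm E 1)
    (B : Fin (n + 1) → Fin (n + 1) → CForm E 2) (k : ℕ) : CForm E (2 * n + 1) :=
  ∑ σ : Equiv.Perm (Fin n), ∑ τ : Equiv.Perm (Fin n),
    ((Equiv.Perm.sign (σ * τ) : ℤ) : ℂ) •
      wedge (A 0 0) (wedgeProd n fun i =>
        if (i : ℕ) < k then B (σ i).succ (τ i).succ
        else wedge (A (σ i).succ 0) (A 0 (τ i).succ))

/-- `Φ_k^{(1)}`, in the same notation: for `0 ≤ k ≤ n - 1` the first factor is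
`Θ_{σ(1)}^0 ∧ θ_0^{τ(1)}`, it is followed by `k` factors `Θ_{σ(i)}^{τ(i)}` and by
`n - 1 - k` factors `θ_{σ(i)}^0 ∧ θ_0^{τ(i)}`; and `Φ_n^{(1)} = 0`. -/
def Phi1 : {n : ℕ} → (A : Fin (n + 1) → Fin (n + 1) → CForm E 1) →
    (B : Fin (n + 1) → Fin (n + 1) → CForm E 2) → (k : ℕ) → CForm E (2 * n + 1)
  | 0, _, _, _ => 0
  | m + 1, A, B, k =>
    if k ≤ m then
      ∑ σ : Equiv.Perm (Fin (m + 1)), ∑ τ : Equiv.Perm (Fin (m + 1)),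
        ((Equiv.Perm.sign (σ * τ) : ℤ) : ℂ) •
          wedge (wedge (m := 3) (B (σ 0).succ 0) (A 0 (τ 0).succ)) (wedgeProd m fun i =>
            if (i : ℕ) < k then B (σ i.succ).succ (τ i.succ).succ
            else wedge (A (σ i.succ).succ 0) (A 0 (τ i.succ).succ))
    else 0

/-- `(1 / n!) (√-1 / 2π)^{n+1} ∑_{k=0}^n binom(n, k) (Φ_k^{(0)} - Φ_k^{(1)})`. -/
def transgressionForm {n : ℕ} (A : Fin (n + 1) → Fin (n + 1) → CForm E 1)
    (B : Fin (n + 1) → Fin (n + 1) → CForm E 2) : CForm E (2 * n + 1) :=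
  ((1 / (n.factorial : ℂ)) * (Complex.I / (2 * Real.pi)) ^ (n + 1)) •
    ∑ k ∈ Finset.range (n + 1), (n.choose k : ℂ) • (Phi0 A B k - Phi1 A B k)

/-- `∂f` at `y`: the complex-linear part `v ↦ (df(v) - √-1 df(√-1 v)) / 2` of `df`. -/
def del (f : E → ℂ) (y : E) : E →L[ℂ] ℂ where
  toFun v := (1 / 2) * (fderiv ℝ f y v - Complex.I * fderiv ℝ f y (Complex.I • v))
  map_add' v w := by simp only [smul_add, map_add]; ring
  map_smul' c v := by
    have key : ∀ w : E, fderiv ℝ f y (c • w)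
        = c.re * fderiv ℝ f y w + c.im * fderiv ℝ f y (Complex.I • w) := by
      intro w
      have : c • w = c.re • w + c.im • (Complex.I • w) := by
        conv_lhs => rw [← Complex.re_add_im c]
        rw [add_smul, mul_smul]; rfl
      rw [this, map_add, map_smul, map_smul]; simp
    have h2 : Complex.I • (c • v) = c • (Complex.I • v) := smul_comm _ _ _
    have h3 : Complex.I • (Complex.I • v) = -v := by rw [smul_smul, Complex.I_mul_I]; simp
    rw [h2, key v, key (Complex.I • v), h3, map_neg]
    simp only [RingHom.id_apply, smul_eq_mul]
    conv_rhs => rw [← Complex.re_add_im c]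
    linear_combination ((1 / 2 : ℂ) * c.im * fderiv ℝ f y (Complex.I • v)) * Complex.I_mul_I
  cont := by fun_prop

/-- `∂̄f` at `y`, evaluated on `v`. -/
def delbar (f : E → ℂ) (y v : E) : ℂ :=
  (1 / 2) * (fderiv ℝ f y v + Complex.I * fderiv ℝ f y (Complex.I • v))

end Pointwise

/-! ### Fields on a complex manifold

`Z` is a manifold modelled on the complex vector space `E`. Mathlib's tangent space of `Z` at `x`
is a copy of `E`, identified by the differential at `x` of the preferred chart `chartAt E x`.
The holomorphic tangent space `T^{1,0}` is identified as usual with the real tangent space with its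
complex structure: `v` corresponds to `(v - √-1 J v) / 2`. So (1,0)-vector fields are maps
`Z → E`, (1,0)-forms are complex-linear in `v`, and `k`-forms are maps `Z → CForm E k`. -/

section Manifold

variable {E : Type*} [NormedAddCommGroup E] [NormedSpace ℂ E]
variable {Z : Type*} [TopologicalSpace Z] [ChartedSpace E Z]

/-- The part of the image of the preferred chart at `x₀` that corresponds to the set `S`. -/
def chartSet (S : Set Z) (x₀ : Z) : Set E :=
  (chartAt E x₀).target ∩ (chartAt E x₀).symm ⁻¹' S

/-- The differential at `y` of the inverse of the preferred chart at `x₀`, from `E` to the tangent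
space at the point with coordinates `y`. -/
def chartDiff (x₀ : Z) (y : E) : E →L[ℂ] E :=
  mfderiv 𝓘(ℂ, E) 𝓘(ℂ, E) (chartAt E x₀).symm y

/-- A vector field in the coordinates of the preferred chart at `x₀`. -/
def vecInChart (x₀ : Z) (V : Z → E) : E → E := fun y =>
  VectorField.mpullback 𝓘(ℂ, E) 𝓘(ℂ, E) (chartAt E x₀).symm V y

/-- A differential form in the coordinates of the preferred chart at `x₀`. -/
def formInChart {k : ℕ} (x₀ : Z) (φ : Z → CForm E k) : E → CForm E k := fun y =>
  (φ ((chartAt E x₀).symm y)).compContinuousLinearMap ((chartDiff x₀ y).restrictScalars ℝ)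

/-- Smoothness of a (1,0)-vector field on `S` (up to those boundary points that lie in `S`). -/
def SmoothVec (S : Set Z) (V : Z → E) : Prop :=
  ∀ x₀ : Z, ContDiffOn ℝ ∞ (vecInChart x₀ V) (chartSet S x₀)

/-- Smoothness of a differential form on `S` (up to those boundary points that lie in `S`). -/
def SmoothForm {k : ℕ} (S : Set Z) (φ : Z → CForm E k) : Prop :=
  ∀ x₀ : Z, ContDiffOn ℝ ∞ (formInChart x₀ φ) (chartSet S x₀)

/-- The exterior derivative on `S`, for a set `S` that is locally an open set or a domain
with smooth boundary. -/
def extD {k : ℕ} (S : Set Z) (φ : Z → CForm E k) : Z → CForm E (k + 1) := fun x =>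
  extDerivWithin (formInChart x φ) (chartSet S x) (chartAt E x x)

/-- The extension by continuity of a differential form from `S` to the closure of `S`: the limit,
in the chart at `x`, along points of `S`. -/
def extendForm {k : ℕ} (S : Set Z) (φ : Z → CForm E k) : Z → CForm E k := fun x =>
  extendFrom (chartSet S x) (formInChart x φ) (chartAt E x x)

/-- `∂f` on a manifold. -/
def delM (f : Z → ℝ) (x : Z) : E →L[ℂ] ℂ :=
  del (fun y => (f ((chartAt E x).symm y) : ℂ)) (chartAt E x x)

/-- The complex Hessian `f_{i j̄} vⁱ w̄ʲ`, that is, the coefficients of `∂∂̄f`. -/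
def complexHessian (f : Z → ℝ) (x : Z) (v w : E) : ℂ :=
  del (fun y => delbar (fun y' => (f ((chartAt E x).symm y') : ℂ)) y w) (chartAt E x x) v

/-- The global function `ρ` presents `X̄ = {ρ ≤ 0}` as a compact complex manifold with smooth
strictly pseudoconvex boundary `M = {ρ = 0}` and interior `X = {ρ < 0}`, with defining function
`ρ`; the complex manifold `Z` is a neighbourhood of `X̄`. -/
structure IsDefiningFunction (ρ : Z → ℝ) : Prop where
  smooth : ContMDiff 𝓘(ℝ, E) 𝓘(ℝ, ℝ) ∞ ρ
  compact : IsCompact {x | ρ x ≤ 0}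
  d_ne_zero : ∀ x, ρ x = 0 → mfderiv 𝓘(ℝ, E) 𝓘(ℝ, ℝ) ρ x ≠ 0
  pseudoconvex : ∀ x, ρ x = 0 → ∀ v : E, v ≠ 0 → delM ρ x v = 0 →
    0 < (complexHessian ρ x v v).re

/-- `g` is a smooth hermitian metric on the open set `S`: `g x v w = g_{i j̄} vⁱ w̄ʲ`. -/
structure IsHermitianMetric (S : Set Z) (g : Z → E →L[ℂ] E →L⋆[ℂ] ℂ) : Prop where
  symm : ∀ x ∈ S, ∀ v w : E, g x w v = conj (g x v w)
  pos : ∀ x ∈ S, ∀ v : E, v ≠ 0 → 0 < (g x v v).re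
  smooth : ∀ x₀ : Z, ∀ v w : E, ContDiffOn ℝ ∞
    (fun y => g ((chartAt E x₀).symm y) (chartDiff x₀ y v) (chartDiff x₀ y w)) (chartSet S x₀)

/-- `g = ∂∂̄ log (-1/ρ)` on `X = {ρ < 0}` near `M = {ρ = 0}`. -/
def IsLogMetricNearBoundary (ρ : Z → ℝ) (g : Z → E →L[ℂ] E →L⋆[ℂ] ℂ) : Prop :=
  ∀ᶠ x in 𝓝ˢ {x | ρ x = 0}, ρ x < 0 → ∀ v w : E,
    g x v w = complexHessian (fun x' => Real.log (-1 / ρ x')) x v w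

/-- `H` is a smooth complex subbundle of rank `n` of `T^{1,0}` over `S`. -/
def IsSmoothSubbundle (S : Set Z) (n : ℕ) (H : Z → Submodule ℂ E) : Prop :=
  ∀ x ∈ S, ∃ U : Set Z, IsOpen U ∧ x ∈ U ∧ ∃ s : Fin n → Z → E,
    (∀ α, SmoothVec (U ∩ S) (s α)) ∧
    ∀ y ∈ U ∩ S, LinearIndependent ℂ (fun α => s α y) ∧
      Submodule.span ℂ (range fun α => s α y) = H y

/-- The data `ξ` and `H` on `X̄ ∖ P`. Near `M`, `ξ` is the (1,0)-vector field with `ρ_i ξⁱ = 1`,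
`ρ_{i j̄} ξ^{j̄} = r ρ_i` for a real function `r`, and `H = Ker ∂ρ`. They are extended so that
`T^{1,0} = span ξ ⊕ H` on `X̄ ∖ P`, and so that `ξ = V / |V|_g` near the points of `P`, for
a (1,0)-vector field `V` on `X̄` with `V = ξ` near `M` whose zeros are the points of `P` and
are all nondegenerate (the real differential of `V` there is bijective). -/
structure IsAdaptedSplitting (n : ℕ) (ρ : Z → ℝ) (g : Z → E →L[ℂ] E →L⋆[ℂ] ℂ) (P : Finset Z)
    (V ξ : Z → E) (H : Z → Submodule ℂ E) : Prop where
  zeros_interior : ∀ p ∈ P, ρ p < 0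
  smooth_V : SmoothVec {x | ρ x ≤ 0} V
  zeros_V : ∀ x, ρ x ≤ 0 → (V x = 0 ↔ x ∈ P)
  nondegenerate_V : ∀ p ∈ P,
    Function.Bijective (fderiv ℝ (vecInChart p V) (chartAt E p p))
  smooth_xi : SmoothVec ({x | ρ x ≤ 0} \ (P : Set Z)) ξ
  xi_near_zeros : ∀ᶠ x in 𝓝ˢ (P : Set Z), x ∉ P →
    ξ x = ((Real.sqrt (g x (V x) (V x)).re : ℂ))⁻¹ • V x
  xi_eq_V : ∀ᶠ x in 𝓝ˢ {x | ρ x = 0}, ρ x ≤ 0 → ξ x = V x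
  xi_normal : ∀ᶠ x in 𝓝ˢ {x | ρ x = 0}, ρ x ≤ 0 → delM ρ x (ξ x) = 1 ∧
    ∃ r : ℝ, ∀ v : E, complexHessian ρ x v (ξ x) = r * delM ρ x v
  subbundle_H : IsSmoothSubbundle ({x | ρ x ≤ 0} \ (P : Set Z)) n H
  H_near_boundary : ∀ᶠ x in 𝓝ˢ {x | ρ x = 0}, ρ x ≤ 0 → ∀ v : E, v ∈ H x ↔ delM ρ x v = 0
  splitting : ∀ x ∈ {x | ρ x ≤ 0} \ (P : Set Z), IsCompl (Submodule.span ℂ {ξ x}) (H x)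

/-- `W` (a basis `W_0, …, W_n` of `T^{1,0}` at each point) is a smooth frame on `S`;
its values outside `S` are irrelevant. -/
def IsSmoothFrame {n : ℕ} (S : Set Z) (W : Z → Module.Basis (Fin (n + 1)) ℂ E) : Prop :=
  ∀ i, SmoothVec S fun x => W x i

variable [FiniteDimensional ℂ E]

/-- The coefficients `g_{i j̄}` of `g` in the chart at `x₀`, in the coordinate frame given by a
fixed basis of `E`. -/
def metricMatrix (g : Z → E →L[ℂ] E →L⋆[ℂ] ℂ) (x₀ : Z) (y : E) :
    Matrix (Fin (Module.finrank ℂ E)) (Fin (Module.finrank ℂ E)) ℂ :=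
  Matrix.of fun i j => g ((chartAt E x₀).symm y)
    (chartDiff x₀ y (Module.finBasis ℂ E i)) (chartDiff x₀ y (Module.finBasis ℂ E j))

/-- The connection forms `(∂g_{i l̄}) g^{l̄ j}` at `x`, in the coordinate frame of the chart
at `x`, of the Chern connection of `g` (the connection on `T^{1,0}` that is compatible with `g` and
with the holomorphic structure). -/
def chernCoord (g : Z → E →L[ℂ] E →L⋆[ℂ] ℂ) (x : Z) (i j : Fin (Module.finrank ℂ E)) :
    E →L[ℂ] ℂ :=
  ∑ l, (metricMatrix g x (chartAt E x x))⁻¹ l j •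
    del (fun y => metricMatrix g x y i l) (chartAt E x x)

/-- The covariant derivative `v ↦ ∇_v V` at `x` for the Chern connection of `g`. -/
def chernCov (g : Z → E →L[ℂ] E →L⋆[ℂ] ℂ) (V : Z → E) (x : Z) : E →L[ℝ] E :=
  fderiv ℝ (vecInChart x V) (chartAt E x x) +
    ∑ i, ∑ j, (Module.finBasis ℂ E).coord i (V x) •
      ((chernCoord g x i j).restrictScalars ℝ).smulRight (Module.finBasis ℂ E j)

/-- The dual coframe `θ^j` of the frame `W`. -/
def coframe {n : ℕ} (W : Z → Module.Basis (Fin (n + 1)) ℂ E) (j : Fin (n + 1)) (x : Z) :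
    E →L[ℂ] ℂ :=
  LinearMap.toContinuousLinearMap ((W x).coord j)

/-- The connection forms `ψ_i^j` of `g` in the frame `W`: `∇ W_i = ψ_i^j ⊗ W_j`. -/
def psi {n : ℕ} (g : Z → E →L[ℂ] E →L⋆[ℂ] ℂ) (W : Z → Module.Basis (Fin (n + 1)) ℂ E)
    (i j : Fin (n + 1)) (x : Z) : CForm E 1 :=
  oneForm (((coframe W j x).restrictScalars ℝ).comp (chernCov g (fun x' => W x' i) x))

/-- `Y_i^j = (1 / -ρ) (δ_i^j ρ_k + δ_k^j ρ_i) θ^k`, where `ρ_k = ∂ρ(W_k)`. -/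
def Yform {n : ℕ} (ρ : Z → ℝ) (W : Z → Module.Basis (Fin (n + 1)) ℂ E)
    (i j : Fin (n + 1)) (x : Z) : CForm E 1 :=
  oneForm ((((1 / -ρ x : ℝ) : ℂ) • ∑ k, ((if i = j then delM ρ x (W x k) else 0) +
    (if k = j then delM ρ x (W x i) else 0)) • coframe W k x).restrictScalars ℝ)

/-- The renormalized connection forms `θ_i^j = ψ_i^j - Y_i^j` on `X`, extended by continuity to
the boundary of `X`. -/
def theta {n : ℕ} (ρ : Z → ℝ) (g : Z → E →L[ℂ] E →L⋆[ℂ] ℂ)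
    (W : Z → Module.Basis (Fin (n + 1)) ℂ E) (i j : Fin (n + 1)) : Z → CForm E 1 :=
  extendForm {x | ρ x < 0} fun x => psi g W i j x - Yform ρ W i j x

/-- The curvature forms `Θ_i^j = dθ_i^j - θ_i^k ∧ θ_k^j` on `X̄`. -/
def Theta {n : ℕ} (ρ : Z → ℝ) (g : Z → E →L[ℂ] E →L⋆[ℂ] ℂ)
    (W : Z → Module.Basis (Fin (n + 1)) ℂ E) (i j : Fin (n + 1)) (x : Z) : CForm E 2 :=
  extD {x | ρ x ≤ 0} (theta ρ g W i j) x - ∑ k, wedge (theta ρ g W i k x) (theta ρ g W k j x)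

end Manifold

end RenormChern

end

/-!
The local statement is a Chern–Weil transgression. Let `θ` be a connection matrix with curvature
`Θ = dθ - θ ∧ θ`. Multiply the entries `θ_0^β`, `β ≥ 1`, by `1 - s`. At `s = 1` the first row of the
curvature is `(dθ_0^0, 0, …, 0)`, and its determinant is `dθ_0^0 ∧ det (dθ_α^β - θ_α^γ ∧ θ_γ^β)`, the
exterior derivative of `θ_0^0 ∧ det (Θ_α^β + θ_α^0 ∧ θ_0^β)`, since the second determinant is closed.
The derivative with respect to `s` of the determinant of the curvature is exact by the Bianchi
identity, and its integral over `0 ≤ s ≤ 1` is a combination of integrated cofactors of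
`Θ_α^β + s θ_α^0 ∧ θ_0^β` (`det_curv_eq`). Expanding determinant and cofactors
binomially gives the forms `Φ_k^{(0)}` and `Φ_k^{(1)}`, the binomial coefficients coming from
Beta integrals (`incl_transgressionForm`), and so `extDerivWithin_transgressionForm`: the exterior
derivative of the transgression form of `θ` is the top Chern form of `Θ`. The algebra takes place in
the graded ring of exterior forms. Its even elements are central, and an even form with its exterior
derivative is an element of a square-zero extension (`Jet`), so that determinants over a commutative
ring obey the Leibniz rule; the Bianchi identity then says that the matrix of the curvature is
conjugate to a constant one (`jetCurv_eq`).

It remains to see that `θ` is smooth up to the boundary, and how it depends on the frame. In a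
coordinate frame and for `g = ∂∂̄ log(-1/ρ)`, the Chern connection minus the singular part
`(-ρ)⁻¹ (δ_i^k ∂ρ + ρ_i dz^k)` is the solution of a linear system whose matrix is the complex Hessian
of `ρ` bordered by `∂ρ`, `∂̄ρ` and `ρ` (`renormConn_eq_boundaryConn`). Strict pseudoconvexity and
`dρ ≠ 0` make this matrix invertible at the boundary (`det_borderedHessian_ne_zero`), which gives
the smooth extension (`exists_local_connection`). The singular part is a tensor, so in every frame
the forms `θ` are the connection forms of one local connection, and a change of frame with matrix
`p` transforms them by `θ' = dp p⁻¹ + p θ p⁻¹` and `Θ' = p Θ p⁻¹` (`localTheta_gauge`,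
`curvatureForm_frameChange`). Hence `c_{n+1}(Θ)` does not depend on the frame
(`topChern_Theta_eq`). Between two frames `ξ, W_1, …, W_n` with `W_α` in `H` the matrix is `1 ⊕ a`, and
the transgression form does not change either (`transgressionForm_theta_eq`). So the local
transgression forms glue to a global one, `globalForm`.
-/

noncomputable section

namespace RenormChern


/-! ### The wedge product of complex-valued forms on a vector space -/

section WedgeAlgebra

variable {E : Type*}

/-- The unnormalized antisymmetrization of a function of `m` vectors. -/
def altSum {m : ℕ} (F : (Fin m → E) → ℂ) (v : Fin m → E) : ℂ :=
  ∑ σ : Equiv.Perm (Fin m), ((Equiv.Perm.sign σ : ℤ) : ℂ) * F (v ∘ σ)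

theorem sign_mul_self {m : ℕ} (σ : Equiv.Perm (Fin m)) :
    ((Equiv.Perm.sign σ : ℤ) : ℂ) * ((Equiv.Perm.sign σ : ℤ) : ℂ) = 1 := by
  rcases Int.units_eq_one_or (Equiv.Perm.sign σ) with h | h <;> simp [h]

theorem altSum_comp_perm {m : ℕ} (F : (Fin m → E) → ℂ) (τ : Equiv.Perm (Fin m)) (v : Fin m → E) :
    altSum (fun w => F (w ∘ τ)) v = ((Equiv.Perm.sign τ : ℤ) : ℂ) * altSum F v := by
  unfold altSum
  rw [Finset.mul_sum, ← Equiv.sum_comp (Equiv.mulRight τ) (fun σ : Equiv.Perm (Fin m) =>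
    ((Equiv.Perm.sign τ : ℤ) : ℂ) * (((Equiv.Perm.sign σ : ℤ) : ℂ) * F (v ∘ σ)))]
  refine Finset.sum_congr rfl fun σ _ => ?_
  simp only [Equiv.coe_mulRight, Equiv.Perm.sign_mul, Units.val_mul, Int.cast_mul]
  rw [show v ∘ ⇑(σ * τ) = (v ∘ σ) ∘ τ from rfl]
  linear_combination -((Equiv.Perm.sign σ : ℤ) : ℂ) * F ((v ∘ σ) ∘ τ) * sign_mul_self τ

theorem altSum_sum {m : ℕ} {ι : Type*} (s : Finset ι) (F : ι → (Fin m → E) → ℂ) (v : Fin m → E) :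
    altSum (fun w => ∑ i ∈ s, F i w) v = ∑ i ∈ s, altSum (F i) v := by
  unfold altSum
  simp only [Finset.mul_sum]
  exact Finset.sum_comm

theorem altSum_const_mul {m : ℕ} (c : ℂ) (F : (Fin m → E) → ℂ) (v : Fin m → E) :
    altSum (fun w => c * F w) v = c * altSum F v := by
  unfold altSum
  rw [Finset.mul_sum]
  exact Finset.sum_congr rfl fun σ _ => by ring

/-- The permutation of `Fin m` that permutes the first `k` elements by `τ`. -/
def permFirst {k l m : ℕ} (h : k + l = m) (τ : Equiv.Perm (Fin k)) : Equiv.Perm (Fin m) :=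
  (finSumFinEquiv.trans (finCongr h)).permCongr (Equiv.Perm.sumCongr τ 1)

/-- The permutation of `Fin m` that permutes the last `l` elements by `τ`. -/
def permLast {k l m : ℕ} (h : k + l = m) (τ : Equiv.Perm (Fin l)) : Equiv.Perm (Fin m) :=
  (finSumFinEquiv.trans (finCongr h)).permCongr (Equiv.Perm.sumCongr 1 τ)

theorem sign_permFirst {k l m : ℕ} (h : k + l = m) (τ : Equiv.Perm (Fin k)) :
    Equiv.Perm.sign (permFirst h τ) = Equiv.Perm.sign τ := by
  simp [permFirst]

theorem sign_permLast {k l m : ℕ} (h : k + l = m) (τ : Equiv.Perm (Fin l)) :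
    Equiv.Perm.sign (permLast h τ) = Equiv.Perm.sign τ := by
  simp [permLast]

theorem permFirst_castAdd {k l m : ℕ} (h : k + l = m) (τ : Equiv.Perm (Fin k)) (i : Fin k) :
    permFirst h τ (Fin.cast h (Fin.castAdd l i)) = Fin.cast h (Fin.castAdd l (τ i)) := by
  subst h; simp [permFirst, Equiv.permCongr_apply]

theorem permFirst_natAdd {k l m : ℕ} (h : k + l = m) (τ : Equiv.Perm (Fin k)) (i : Fin l) :
    permFirst h τ (Fin.cast h (Fin.natAdd k i)) = Fin.cast h (Fin.natAdd k i) := by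
  subst h; simp [permFirst, Equiv.permCongr_apply]

theorem permLast_castAdd {k l m : ℕ} (h : k + l = m) (τ : Equiv.Perm (Fin l)) (i : Fin k) :
    permLast h τ (Fin.cast h (Fin.castAdd l i)) = Fin.cast h (Fin.castAdd l i) := by
  subst h; simp [permLast, Equiv.permCongr_apply]

theorem permLast_natAdd {k l m : ℕ} (h : k + l = m) (τ : Equiv.Perm (Fin l)) (i : Fin l) :
    permLast h τ (Fin.cast h (Fin.natAdd k i)) = Fin.cast h (Fin.natAdd k (τ i)) := by
  subst h; simp [permLast, Equiv.permCongr_apply]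

/-- Antisymmetrizing the first factor beforehand multiplies the antisymmetrization of a product
by `k!`. -/
theorem altSum_altSum_left {k l m : ℕ} (h : k + l = m) (F : (Fin k → E) → ℂ)
    (G : (Fin l → E) → ℂ) (v : Fin m → E) :
    altSum (fun w => altSum F (fun i => w (Fin.cast h (Fin.castAdd l i))) *
        G (fun j => w (Fin.cast h (Fin.natAdd k j)))) v =
      (k.factorial : ℂ) * altSum (fun w => F (fun i => w (Fin.cast h (Fin.castAdd l i))) *
        G (fun j => w (Fin.cast h (Fin.natAdd k j)))) v := by
  set P : (Fin m → E) → ℂ := fun w => F (fun i => w (Fin.cast h (Fin.castAdd l i))) *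
        G (fun j => w (Fin.cast h (Fin.natAdd k j))) with hP
  have key : (fun w : Fin m → E => altSum F (fun i => w (Fin.cast h (Fin.castAdd l i))) *
        G (fun j => w (Fin.cast h (Fin.natAdd k j)))) =
      fun w => ∑ τ : Equiv.Perm (Fin k), ((Equiv.Perm.sign τ : ℤ) : ℂ) *
        P (w ∘ permFirst h τ) := by
    funext w
    rw [altSum, Finset.sum_mul]
    refine Finset.sum_congr rfl fun τ _ => ?_
    simp only [hP, Function.comp_def, permFirst_castAdd, permFirst_natAdd, mul_assoc]
  rw [key, altSum_sum]
  simp_rw [altSum_const_mul, altSum_comp_perm, sign_permFirst, ← mul_assoc, sign_mul_self]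
  simp [Fintype.card_perm]

theorem altSum_altSum_right {k l m : ℕ} (h : k + l = m) (F : (Fin k → E) → ℂ)
    (G : (Fin l → E) → ℂ) (v : Fin m → E) :
    altSum (fun w => F (fun i => w (Fin.cast h (Fin.castAdd l i))) *
        altSum G (fun j => w (Fin.cast h (Fin.natAdd k j)))) v =
      (l.factorial : ℂ) * altSum (fun w => F (fun i => w (Fin.cast h (Fin.castAdd l i))) *
        G (fun j => w (Fin.cast h (Fin.natAdd k j)))) v := by
  set P : (Fin m → E) → ℂ := fun w => F (fun i => w (Fin.cast h (Fin.castAdd l i))) *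
        G (fun j => w (Fin.cast h (Fin.natAdd k j))) with hP
  have key : (fun w : Fin m → E => F (fun i => w (Fin.cast h (Fin.castAdd l i))) *
        altSum G (fun j => w (Fin.cast h (Fin.natAdd k j)))) =
      fun w => ∑ τ : Equiv.Perm (Fin l), ((Equiv.Perm.sign τ : ℤ) : ℂ) *
        P (w ∘ permLast h τ) := by
    funext w
    rw [altSum, Finset.mul_sum]
    refine Finset.sum_congr rfl fun τ _ => ?_
    simp only [hP, Function.comp_def, permLast_castAdd, permLast_natAdd]
    ring
  rw [key, altSum_sum]
  simp_rw [altSum_const_mul, altSum_comp_perm, sign_permLast, ← mul_assoc, sign_mul_self]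
  simp [Fintype.card_perm]

variable [NormedAddCommGroup E] [NormedSpace ℂ E]

theorem altSum_alternating {m : ℕ} (φ : CForm E m) (v : Fin m → E) :
    altSum (fun w => φ w) v = (m.factorial : ℂ) * φ v := by
  unfold altSum
  have : ∀ σ : Equiv.Perm (Fin m), ((Equiv.Perm.sign σ : ℤ) : ℂ) * φ (v ∘ σ) = φ v := by
    intro σ
    have h := φ.toAlternatingMap.map_perm v σ
    have h' : φ (v ∘ σ) = Equiv.Perm.sign σ • φ v := h
    rw [h', Units.smul_def, zsmul_eq_mul, ← mul_assoc, sign_mul_self, one_mul]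
  simp [this, Fintype.card_perm]

theorem wedge_apply {k l m : ℕ} (φ : CForm E k) (η : CForm E l) (h : k + l = m) (v : Fin m → E) :
    wedge φ η h v = ((k.factorial : ℂ) * (l.factorial : ℂ))⁻¹ *
      altSum (fun w => φ (fun i => w (Fin.cast h (Fin.castAdd l i))) *
        η (fun j => w (Fin.cast h (Fin.natAdd k j)))) v := by
  unfold wedge altSum
  rw [ContinuousAlternatingMap.smul_apply, ContinuousMultilinearMap.alternatization_apply_apply]
  rw [Complex.real_smul]
  push_cast
  congr 1
  refine Finset.sum_congr rfl fun σ _ => ?_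
  rw [Units.smul_def, zsmul_eq_mul]
  rfl

theorem wedge_add_left {k l m : ℕ} (φ φ' : CForm E k) (η : CForm E l) (h : k + l = m) :
    wedge (φ + φ') η h = wedge φ η h + wedge φ' η h := by
  ext v
  simp only [wedge_apply, ContinuousAlternatingMap.add_apply, add_mul, altSum, mul_add,
    Finset.sum_add_distrib]

theorem wedge_add_right {k l m : ℕ} (φ : CForm E k) (η η' : CForm E l) (h : k + l = m) :
    wedge φ (η + η') h = wedge φ η h + wedge φ η' h := by
  ext v
  simp only [wedge_apply, ContinuousAlternatingMap.add_apply, altSum, mul_add,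
    Finset.sum_add_distrib]

theorem wedge_smul_left {k l m : ℕ} (c : ℂ) (φ : CForm E k) (η : CForm E l) (h : k + l = m) :
    wedge (c • φ) η h = c • wedge φ η h := by
  ext v
  simp only [wedge_apply, ContinuousAlternatingMap.smul_apply, smul_eq_mul, mul_assoc,
    altSum_const_mul]
  ring

theorem wedge_smul_right {k l m : ℕ} (c : ℂ) (φ : CForm E k) (η : CForm E l) (h : k + l = m) :
    wedge φ (c • η) h = c • wedge φ η h := by
  ext v
  simp only [wedge_apply, ContinuousAlternatingMap.smul_apply, smul_eq_mul, mul_left_comm _ c,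
    altSum_const_mul]

theorem wedge_zero_left {k l m : ℕ} (η : CForm E l) (h : k + l = m) :
    wedge (0 : CForm E k) η h = 0 := by
  have := wedge_add_left 0 (0 : CForm E k) η h
  rwa [add_zero, left_eq_add] at this

theorem wedge_zero_right {k l m : ℕ} (φ : CForm E k) (h : k + l = m) :
    wedge φ (0 : CForm E l) h = 0 := by
  have := wedge_add_right φ 0 (0 : CForm E l) h
  rwa [add_zero, left_eq_add] at this

theorem factorial_ne_zero' (k : ℕ) : (k.factorial : ℂ) ≠ 0 :=
  Nat.cast_ne_zero.mpr k.factorial_ne_zero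

theorem wedge_assoc {k l p a b m : ℕ} (φ : CForm E k) (η : CForm E l) (ζ : CForm E p)
    (h₁ : k + l = a) (h₂ : a + p = m) (h₃ : l + p = b) (h₄ : k + b = m) :
    wedge (wedge φ η h₁) ζ h₂ = wedge φ (wedge η ζ h₃) h₄ := by
  ext v
  rw [wedge_apply, wedge_apply]
  have e1 : (fun w : Fin m → E => wedge φ η h₁ (fun i => w (Fin.cast h₂ (Fin.castAdd p i))) *
      ζ (fun j => w (Fin.cast h₂ (Fin.natAdd a j)))) = fun w =>
      ((k.factorial : ℂ) * (l.factorial : ℂ))⁻¹ *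
      (altSum (fun w => φ (fun i => w (Fin.cast h₁ (Fin.castAdd l i))) *
        η (fun j => w (Fin.cast h₁ (Fin.natAdd k j)))) (fun i => w (Fin.cast h₂ (Fin.castAdd p i))) *
      ζ (fun j => w (Fin.cast h₂ (Fin.natAdd a j)))) := by
    funext w; rw [wedge_apply, mul_assoc]
  have e2 : (fun w : Fin m → E => φ (fun i => w (Fin.cast h₄ (Fin.castAdd b i))) *
      wedge η ζ h₃ (fun j => w (Fin.cast h₄ (Fin.natAdd k j)))) = fun w =>
      ((l.factorial : ℂ) * (p.factorial : ℂ))⁻¹ *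
      (φ (fun i => w (Fin.cast h₄ (Fin.castAdd b i))) *
      altSum (fun w => η (fun i => w (Fin.cast h₃ (Fin.castAdd p i))) *
        ζ (fun j => w (Fin.cast h₃ (Fin.natAdd l j)))) (fun i => w (Fin.cast h₄ (Fin.natAdd k i)))) := by
    funext w; rw [wedge_apply, mul_left_comm]
  rw [e1, e2, altSum_const_mul, altSum_const_mul, 
    altSum_altSum_left h₂ (fun w => φ (fun i => w (Fin.cast h₁ (Fin.castAdd l i))) *
        η (fun j => w (Fin.cast h₁ (Fin.natAdd k j)))) (fun w => ζ w), 
    altSum_altSum_right h₄ (fun w => φ w) (fun w => η (fun i => w (Fin.cast h₃ (Fin.castAdd p i))) *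
        ζ (fun j => w (Fin.cast h₃ (Fin.natAdd l j))))]
  have e3 : (fun w : Fin m → E => φ (fun i => w (Fin.cast h₂ (Fin.castAdd p
        (Fin.cast h₁ (Fin.castAdd l i))))) *
        η (fun j => w (Fin.cast h₂ (Fin.castAdd p (Fin.cast h₁ (Fin.natAdd k j))))) *
        ζ (fun j => w (Fin.cast h₂ (Fin.natAdd a j)))) =
      fun w => φ (fun i => w (Fin.cast h₄ (Fin.castAdd b i))) *
        (η (fun i => w (Fin.cast h₄ (Fin.natAdd k (Fin.cast h₃ (Fin.castAdd p i))))) *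
        ζ (fun j => w (Fin.cast h₄ (Fin.natAdd k (Fin.cast h₃ (Fin.natAdd l j)))))) := by
    funext w
    rw [mul_assoc]
    congr 2
    congr 1
    funext j
    congr 1
    ext; simp; omega
  rw [e3]
  have := factorial_ne_zero' k
  have := factorial_ne_zero' l
  have := factorial_ne_zero' p
  have := factorial_ne_zero' a
  have := factorial_ne_zero' b
  field_simp

theorem finRotate_pow_val {m : ℕ} (j : ℕ) (i : Fin m) :
    (((finRotate m) ^ j) i : ℕ) = (i + j) % m := by
  rcases m with _ | m
  · exact i.elim0
  induction j with
  | zero => simp [Nat.mod_eq_of_lt i.isLt]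
  | succ j ih =>
    rw [pow_succ', Equiv.Perm.mul_apply, finRotate_apply, Fin.val_add, ih, Fin.val_one',
      ← Nat.add_mod, add_assoc]

/-- Graded commutativity. -/
theorem wedge_comm {k l m : ℕ} (φ : CForm E k) (η : CForm E l) (h : k + l = m) (h' : l + k = m) :
    wedge φ η h = ((-1 : ℂ) ^ ((m - 1) * l)) • wedge η φ h' := by
  ext v
  rw [ContinuousAlternatingMap.smul_apply, wedge_apply, wedge_apply]
  have e : (fun w : Fin m → E => φ (fun i => w (Fin.cast h (Fin.castAdd l i))) *
        η (fun j => w (Fin.cast h (Fin.natAdd k j)))) =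
      fun w => (fun w : Fin m → E => η (fun i => w (Fin.cast h' (Fin.castAdd k i))) *
        φ (fun j => w (Fin.cast h' (Fin.natAdd l j)))) (w ∘ ((finRotate m) ^ k)) := by
    funext w
    have e1 : ∀ i : Fin l, ((finRotate m) ^ k) (Fin.cast h' (Fin.castAdd k i)) =
        Fin.cast h (Fin.natAdd k i) := by
      intro i
      ext
      rw [finRotate_pow_val]
      simp only [Fin.val_cast, Fin.val_castAdd, Fin.val_natAdd]
      rw [Nat.mod_eq_of_lt (by omega), add_comm]
    have e2 : ∀ i : Fin k, ((finRotate m) ^ k) (Fin.cast h' (Fin.natAdd l i)) =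
        Fin.cast h (Fin.castAdd l i) := by
      intro i
      ext
      rw [finRotate_pow_val]
      simp only [Fin.val_cast, Fin.val_castAdd, Fin.val_natAdd]
      rw [show l + (i : ℕ) + k = i + m by omega, Nat.add_mod_right, Nat.mod_eq_of_lt (by omega)]
    simp only [Function.comp_def, e1, e2]
    ring
  rw [e, altSum_comp_perm (fun w : Fin m → E => η (fun i => w (Fin.cast h' (Fin.castAdd k i))) *
        φ (fun j => w (Fin.cast h' (Fin.natAdd l j))))]
  have hs : ((Equiv.Perm.sign ((finRotate m) ^ k) : ℤ) : ℂ) = (-1 : ℂ) ^ ((m - 1) * l) := by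
    rw [map_pow]
    rcases m with _ | m
    · obtain rfl : k = 0 := by omega
      simp
    rw [sign_finRotate]
    simp only [add_tsub_cancel_right, Units.val_pow_eq_pow_val, Units.val_neg, Units.val_one,
      Int.cast_pow, Int.cast_neg, Int.cast_one]
    rw [← pow_mul]
    -- `k + l = m + 1`, so `m * k` and `m * l` have the same parity
    have h2 : Even (m * k + m * l) := by
      rw [← mul_add, h]; exact Nat.even_mul_succ_self m
    rcases Nat.even_or_odd (m * k) with h3 | h3
    · rw [h3.neg_one_pow, ((Nat.even_add.mp h2).mp h3).neg_one_pow]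
    · have : Odd (m * l) := by
        rw [← Nat.not_even_iff_odd] at h3 ⊢
        exact fun h4 => h3 ((Nat.even_add.mp h2).mpr h4)
      rw [h3.neg_one_pow, this.neg_one_pow]
  rw [hs, smul_eq_mul]
  ring

theorem wedge_one_left {m : ℕ} (η : CForm E m) (h : 0 + m = m) :
    wedge (ContinuousAlternatingMap.constOfIsEmpty ℝ E (Fin 0) (1 : ℂ)) η h = η := by
  ext v
  rw [wedge_apply]
  have : (fun w : Fin m → E => (ContinuousAlternatingMap.constOfIsEmpty ℝ E (Fin 0) (1 : ℂ))
      (fun i => w (Fin.cast h (Fin.castAdd m i))) * η (fun j => w (Fin.cast h (Fin.natAdd 0 j)))) =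
      fun w => η w := by
    funext w
    simp only [ContinuousAlternatingMap.constOfIsEmpty_apply, one_mul]
    congr 1
    funext j
    congr 1
    ext; simp
  rw [this, altSum_alternating]
  have := factorial_ne_zero' m
  simp
  field_simp

theorem wedge_one_right {m : ℕ} (η : CForm E m) (h : m + 0 = m) :
    wedge η (ContinuousAlternatingMap.constOfIsEmpty ℝ E (Fin 0) (1 : ℂ)) h = η := by
  rw [wedge_comm _ _ h (by omega), wedge_one_left]
  simp

theorem wedge_comp {E' : Type*} [NormedAddCommGroup E'] [NormedSpace ℂ E'] {k l m : ℕ}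
    (φ : CForm E k) (η : CForm E l) (h : k + l = m) (A : E' →L[ℝ] E) :
    (wedge φ η h).compContinuousLinearMap A =
      wedge (φ.compContinuousLinearMap A) (η.compContinuousLinearMap A) h := by
  ext v
  rw [ContinuousAlternatingMap.compContinuousLinearMap_apply, wedge_apply, wedge_apply]
  rfl

/-- The wedge product with a one-form, as the antisymmetrization used for exterior derivatives. -/
theorem alternatizeUncurryFin_smulRight {k : ℕ} (e : E →L[ℝ] ℂ) (φ : CForm E k) (h : 1 + k = k + 1)
    (B : E →L[ℝ] CForm E k) (hB : ∀ v, B v = e v • φ) :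
    ContinuousAlternatingMap.alternatizeUncurryFin B = wedge (oneForm e) φ h := by
  ext v
  have key : ((k + 1).factorial : ℂ) * ContinuousAlternatingMap.alternatizeUncurryFin B v =
      (k + 1 : ℂ) * altSum (fun w : Fin (k + 1) → E => e (w 0) * φ (fun j => w j.succ)) v := by
    rw [← altSum_alternating]
    have : (fun w => ContinuousAlternatingMap.alternatizeUncurryFin B w) = fun w =>
        ∑ i : Fin (k + 1), (-1 : ℂ) ^ (i : ℕ) * (fun w : Fin (k + 1) → E =>
          e (w 0) * φ (fun j => w j.succ)) (w ∘ i.cycleRange.symm) := by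
      funext w
      rw [ContinuousAlternatingMap.alternatizeUncurryFin_apply]
      refine Finset.sum_congr rfl fun i _ => ?_
      rw [hB]
      simp only [Function.comp_def, Fin.cycleRange_symm_zero, Fin.cycleRange_symm_succ]
      rw [ContinuousAlternatingMap.smul_apply, smul_eq_mul, zsmul_eq_mul]
      push_cast
      rfl
    rw [this, altSum_sum]
    simp_rw [altSum_const_mul]
    have h0 : ∀ i : Fin (k + 1), altSum (fun w => (fun w : Fin (k + 1) → E =>
          e (w 0) * φ (fun j => w j.succ)) (w ∘ i.cycleRange.symm)) v = _ := fun i =>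
      altSum_comp_perm (fun w : Fin (k + 1) → E =>
          e (w 0) * φ (fun j => w j.succ)) i.cycleRange.symm v
    simp_rw [h0]
    have h1 : ∀ i : Fin (k + 1), (-1 : ℂ) ^ (i : ℕ) *
        (((Equiv.Perm.sign i.cycleRange.symm : ℤ) : ℂ)) = 1 := by
      intro i
      rw [Equiv.Perm.sign_symm, Fin.sign_cycleRange]
      push_cast
      rw [← mul_pow]; norm_num
    simp_rw [← mul_assoc, h1]
    simp
  rw [wedge_apply]
  have e2 : (fun w : Fin (k + 1) → E => (oneForm e) (fun i => w (Fin.cast h (Fin.castAdd k i))) *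
        φ (fun j => w (Fin.cast h (Fin.natAdd 1 j)))) =
      fun w => e (w 0) * φ (fun j => w j.succ) := by
    funext w
    have h5 : ∀ j : Fin k, Fin.cast h (Fin.natAdd 1 j) = j.succ := by
      intro j; ext; simp
    simp only [h5]
    rfl
  rw [e2]
  have := factorial_ne_zero' k
  have h3 : (k + 1 : ℂ) ≠ 0 := by exact_mod_cast Nat.succ_ne_zero k
  rw [Nat.factorial_succ] at key
  push_cast at key
  rw [mul_assoc] at key
  have h4 := mul_left_cancel₀ h3 key
  rw [← h4]
  simp
  field_simp

end WedgeAlgebra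


/-! ### The graded ring of forms -/

section FormsRing

variable {E : Type*} [NormedAddCommGroup E] [NormedSpace ℂ E]

/-- The constant function `c`, as a form of degree zero. -/
def constForm (c : ℂ) : CForm E 0 := ContinuousAlternatingMap.constOfIsEmpty ℝ E (Fin 0) c

theorem gradedMk_wedge {k l m : ℕ} (φ : CForm E k) (η : CForm E l) (h : k + l = m) :
    GradedMonoid.mk (A := fun k => CForm E k) (k + l) (wedge φ η rfl) =
      GradedMonoid.mk m (wedge φ η h) := by
  subst h; rfl

theorem constForm_wedge {m : ℕ} (c : ℂ) (η : CForm E m) (h : 0 + m = m) :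
    wedge (constForm c) η h = c • η := by
  have : (constForm c : CForm E 0) = c • constForm 1 := by
    ext v; simp [constForm]
  rw [this, wedge_smul_left, constForm, wedge_one_left]

theorem wedge_constForm {m : ℕ} (c : ℂ) (η : CForm E m) (h : m + 0 = m) :
    wedge η (constForm c) h = c • η := by
  have : (constForm c : CForm E 0) = c • constForm 1 := by
    ext v; simp [constForm]
  rw [this, wedge_smul_right, constForm, wedge_one_right]

instance formsGOne : GradedMonoid.GOne (fun k => CForm E k) := ⟨constForm 1⟩

instance formsGMul : GradedMonoid.GMul (fun k => CForm E k) := ⟨fun φ η => wedge φ η rfl⟩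

instance formsGMonoid : GradedMonoid.GMonoid (fun k => CForm E k) where
  one_mul a := by
    rcases a with ⟨m, η⟩
    exact (gradedMk_wedge (constForm 1) η (zero_add m)).trans (congrArg _ (wedge_one_left _ _))
  mul_one a := by
    rcases a with ⟨m, η⟩
    exact (gradedMk_wedge η (constForm 1) (add_zero m)).trans (congrArg _ (wedge_one_right _ _))
  mul_assoc a b c := by
    rcases a with ⟨k, φ⟩
    rcases b with ⟨l, η⟩
    rcases c with ⟨p, ζ⟩
    refine (gradedMk_wedge (wedge φ η rfl) ζ (add_assoc k l p)).trans ?_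
    exact congrArg _ (wedge_assoc φ η ζ rfl _ rfl rfl)

instance formsGSemiring : DirectSum.GSemiring (fun k => CForm E k) where
  mul_zero φ := wedge_zero_right φ rfl
  zero_mul η := wedge_zero_left η rfl
  mul_add φ η η' := wedge_add_right φ η η' rfl
  add_mul φ φ' η := wedge_add_left φ φ' η rfl
  natCast n := constForm n
  natCast_zero := by ext v; simp [constForm]
  natCast_succ n := by
    ext v
    change ((n + 1 : ℕ) : ℂ) = n + 1
    push_cast; rfl

instance formsGRing : DirectSum.GRing (fun k => CForm E k) where
  intCast n := constForm n
  intCast_ofNat n := by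
    ext v; change ((n : ℤ) : ℂ) = ((n : ℕ) : ℂ); simp
  intCast_negSucc_ofNat n := by
    ext v
    change ((Int.negSucc n : ℤ) : ℂ) = -((n + 1 : ℕ) : ℂ)
    simp

instance formsGAlgebra : DirectSum.GAlgebra ℂ (fun k => CForm E k) where
  toFun := 
    { toFun := constForm
      map_zero' := by ext v; simp [constForm]
      map_add' := fun a b => by ext v; simp [constForm] }
  map_one := rfl
  map_mul a b := by
    refine Eq.trans ?_ (gradedMk_wedge (E := E) (constForm a) (constForm b) (zero_add 0)).symm
    rw [constForm_wedge]
    congr 1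
  commutes a x := by
    rcases x with ⟨m, η⟩
    refine (gradedMk_wedge (constForm a) η (zero_add m)).trans ?_
    refine Eq.trans ?_ (gradedMk_wedge η (constForm a) (add_zero m)).symm
    rw [constForm_wedge, wedge_constForm]
  smul_def a x := by
    rcases x with ⟨m, η⟩
    refine Eq.trans ?_ (gradedMk_wedge (constForm a) η (zero_add m)).symm
    rw [constForm_wedge]
    rfl

/-- The graded ring of all complex-valued exterior forms on `E`. -/
def Forms (E : Type*) [NormedAddCommGroup E] [NormedSpace ℂ E] : Type _ :=
  DirectSum ℕ (fun k => CForm E k)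

instance : Ring (Forms E) := inferInstanceAs (Ring (DirectSum ℕ (fun k => CForm E k)))

instance : Algebra ℂ (Forms E) :=
  inferInstanceAs (Algebra ℂ (DirectSum ℕ (fun k => CForm E k)))

/-- The inclusion of the forms of degree `k` in the ring of all forms. -/
def incl (k : ℕ) : CForm E k →ₗ[ℂ] Forms E :=
  DirectSum.lof ℂ ℕ (fun k => CForm E k) k

theorem incl_injective (k : ℕ) : Function.Injective (incl (E := E) k) :=
  DirectSum.of_injective k

theorem incl_wedge {k l m : ℕ} (φ : CForm E k) (η : CForm E l) (h : k + l = m) :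
    incl m (wedge φ η h) = incl k φ * incl l η := by
  subst h
  exact (DirectSum.of_mul_of (A := fun k => CForm E k) φ η).symm

theorem incl_one : incl 0 (ContinuousAlternatingMap.constOfIsEmpty ℝ E (Fin 0) (1 : ℂ)) = 1 := rfl

theorem forms_induction {p : Forms E → Prop} (x : Forms E) (h0 : p 0)
    (h1 : ∀ k (φ : CForm E k), p (incl k φ)) (h2 : ∀ x y, p x → p y → p (x + y)) : p x :=
  DirectSum.induction_on x h0 h1 h2

theorem incl_mul_comm {k l : ℕ} (φ : CForm E k) (η : CForm E l) :
    incl k φ * incl l η = ((-1 : ℂ) ^ ((k + l - 1) * l)) • (incl l η * incl k φ) := by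
  rw [← incl_wedge φ η rfl, ← incl_wedge η φ (add_comm l k), ← map_smul,
    ← wedge_comm φ η rfl]

theorem incl_commute {k : ℕ} (hk : Even k) (φ : CForm E k) (x : Forms E) :
    incl k φ * x = x * incl k φ := by
  induction x using forms_induction with
  | h0 => simp
  | h2 x y hx hy => rw [mul_add, add_mul, hx, hy]
  | h1 l η =>
    rw [incl_mul_comm]
    have : Even ((k + l - 1) * l) := by
      rcases Nat.even_or_odd l with h | h
      · exact h.mul_left _
      · refine Even.mul_right ?_ _
        obtain ⟨a, rfl⟩ := hk
        obtain ⟨b, rfl⟩ := h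
        exact ⟨a + b, by omega⟩
    rw [this.neg_one_pow, one_smul]

theorem incl_anticommute {k l : ℕ} (hk : Odd k) (hl : Odd l) (φ : CForm E k) (η : CForm E l) :
    incl k φ * incl l η = -(incl l η * incl k φ) := by
  rw [incl_mul_comm]
  have : Odd ((k + l - 1) * l) := by
    refine Odd.mul ?_ hl
    obtain ⟨a, rfl⟩ := hk
    obtain ⟨b, rfl⟩ := hl
    exact ⟨a + b, by omega⟩
  rw [this.neg_one_pow, neg_smul, one_smul]

theorem incl_mem_center {k : ℕ} (hk : Even k) (φ : CForm E k) :
    incl k φ ∈ Subalgebra.center ℂ (Forms E) := by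
  rw [Subalgebra.mem_center_iff]
  exact fun x => (incl_commute hk φ x).symm

/-- The even forms are central in the ring of forms. -/
def inclCenter {k : ℕ} (hk : Even k) : CForm E k →ₗ[ℂ] Subalgebra.center ℂ (Forms E) :=
  (incl k).codRestrict (Subalgebra.toSubmodule (Subalgebra.center ℂ (Forms E)))
    (incl_mem_center hk)

theorem coe_inclCenter {k : ℕ} (hk : Even k) (φ : CForm E k) :
    ((inclCenter hk φ : Subalgebra.center ℂ (Forms E)) : Forms E) = incl k φ := rfl

theorem incl_wedgeProd (m : ℕ) (F : Fin m → CForm E 2) :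
    inclCenter (even_two_mul m) (wedgeProd m F) = ∏ i, inclCenter even_two (F i) := by
  induction m with
  | zero => exact Subtype.ext incl_one
  | succ m ih =>
    rw [Fin.prod_univ_castSucc, ← ih]
    exact Subtype.ext (incl_wedge _ _ _)

end FormsRing


/-! ### Polarized determinants and cofactors over a commutative ring -/

section Polarized

open Polynomial

variable {K : Type*} [CommRing K]

/-- Expansion of a cofactor of the top row along the first column. -/
theorem adjugate_succ_zero {n : ℕ} (M : Matrix (Fin (n + 1)) (Fin (n + 1)) K) (β : Fin n) :
    M.adjugate β.succ 0 =
      -∑ α : Fin n, M α.succ 0 * (M.submatrix Fin.succ Fin.succ).adjugate β α := by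
  rcases n with _ | n
  · exact β.elim0
  rw [Matrix.adjugate_fin_succ_eq_det_submatrix, Matrix.det_succ_column_zero, Finset.mul_sum,
    ← Finset.sum_neg_distrib]
  refine Finset.sum_congr rfl fun α _ => ?_
  rw [Matrix.adjugate_fin_succ_eq_det_submatrix, Matrix.submatrix_submatrix,
    Matrix.submatrix_submatrix]
  simp only [Matrix.submatrix_apply, Fin.succ_succAbove_zero, Fin.zero_succAbove]
  have : M.submatrix (Fin.succAbove 0 ∘ α.succAbove) (β.succ.succAbove ∘ Fin.succ) =
      M.submatrix (Fin.succ ∘ α.succAbove) (Fin.succ ∘ β.succAbove) := by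
    ext i j
    simp [Fin.succ_succAbove_succ]
  rw [this]
  simp only [Fin.val_zero, Fin.val_succ]
  ring

/-- Jacobi's formula. -/
theorem derivative_det {ι : Type*} [Fintype ι] [DecidableEq ι] (M : Matrix ι ι K[X]) :
    derivative M.det = ∑ i, ∑ j, M.adjugate j i * derivative (M i j) := by
  have h : ∀ i, ∑ σ : Equiv.Perm ι, Equiv.Perm.sign σ •
      ((∏ j ∈ Finset.univ.erase i, M (σ j) j) * derivative (M (σ i) i)) =
      ∑ j, M.adjugate i j * derivative (M j i) := by
    intro i
    have h2 := congrFun (Matrix.cramer_eq_adjugate_mulVec M (fun j => derivative (M j i))) i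
    rw [Matrix.cramer_apply, Matrix.mulVec, dotProduct] at h2
    rw [← h2, Matrix.det_apply]
    refine Finset.sum_congr rfl fun σ _ => ?_
    rw [← Finset.prod_erase_mul _ _ (Finset.mem_univ i), Matrix.updateCol_self]
    congr 2
    refine Finset.prod_congr rfl fun j hj => ?_
    rw [Matrix.updateCol_ne (Finset.ne_of_mem_erase hj)]
  rw [Finset.sum_comm]
  simp only [← h]
  rw [Finset.sum_comm, Matrix.det_apply, derivative_sum]
  refine Finset.sum_congr rfl fun σ _ => ?_
  rw [Units.smul_def, derivative_smul, derivative_prod_finset, Finset.smul_sum]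
  rfl

variable [Algebra ℂ K]

/-- The polarized determinant of `k` copies of `a` and `n - k` copies of `b`, times `n!`. -/
def polarDet {n : ℕ} (a b : Matrix (Fin n) (Fin n) K) (k : ℕ) : K :=
  ∑ σ : Equiv.Perm (Fin n), ∑ τ : Equiv.Perm (Fin n),
    ((Equiv.Perm.sign (σ * τ) : ℤ) : ℂ) •
      ∏ i : Fin n, if (i : ℕ) < k then a (σ i) (τ i) else b (σ i) (τ i)

/-- The polarized determinant with a prescribed set of arguments equal to `a`. -/
def polarDetSet {n : ℕ} (a b : Matrix (Fin n) (Fin n) K) (S : Finset (Fin n)) : K :=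
  ∑ σ : Equiv.Perm (Fin n), ∑ τ : Equiv.Perm (Fin n),
    ((Equiv.Perm.sign (σ * τ) : ℤ) : ℂ) • ∏ i : Fin n, if i ∈ S then a (σ i) (τ i) else b (σ i) (τ i)

theorem sum_sum_sign_prod {n : ℕ} (M : Matrix (Fin n) (Fin n) K) :
    ∑ σ : Equiv.Perm (Fin n), ∑ τ : Equiv.Perm (Fin n),
      ((Equiv.Perm.sign (σ * τ) : ℤ) : ℂ) • ∏ i, M (σ i) (τ i) = (n.factorial : ℂ) • M.det := by
  rw [Finset.sum_comm]
  have : ∀ τ : Equiv.Perm (Fin n), ∑ σ : Equiv.Perm (Fin n),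
      ((Equiv.Perm.sign (σ * τ) : ℤ) : ℂ) • ∏ i, M (σ i) (τ i) = M.det := by
    intro τ
    rw [Matrix.det_apply, ← Equiv.sum_comp (Equiv.mulRight τ)]
    refine Finset.sum_congr rfl fun σ _ => ?_
    have h : Equiv.Perm.sign (σ * τ * τ) = Equiv.Perm.sign σ := by
      simp [mul_assoc, Int.units_mul_self]
    rw [Equiv.coe_mulRight, h, ← Equiv.prod_comp τ (fun i => M (σ i) i), Units.smul_def,
      Int.cast_smul_eq_zsmul]
    rfl
  simp only [this, Finset.sum_const, Finset.card_univ, Fintype.card_perm, Fintype.card_fin]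
  rw [← Nat.cast_smul_eq_nsmul ℂ]

theorem polarDetSet_map {n : ℕ} (a b : Matrix (Fin n) (Fin n) K) (S S' : Finset (Fin n))
    (π : Equiv.Perm (Fin n)) (h : ∀ i, i ∈ S ↔ π i ∈ S') :
    polarDetSet a b S = polarDetSet a b S' := by
  unfold polarDetSet
  rw [← Equiv.sum_comp (Equiv.mulRight π)]
  refine Finset.sum_congr rfl fun σ _ => ?_
  rw [← Equiv.sum_comp (Equiv.mulRight π)]
  refine Finset.sum_congr rfl fun τ _ => ?_
  rw [← Equiv.prod_comp π (fun i => if i ∈ S' then a (σ i) (τ i) else b (σ i) (τ i))]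
  congr 1
  · have : Equiv.Perm.sign ((σ * π) * (τ * π)) = Equiv.Perm.sign (σ * τ) := by
      simp only [Equiv.Perm.sign_mul]
      rw [mul_mul_mul_comm, Int.units_mul_self, mul_one]
    simp only [Equiv.coe_mulRight, this]
  · refine Finset.prod_congr rfl fun i _ => ?_
    simp only [h i]
    rfl

theorem polarDetSet_eq {n : ℕ} (a b : Matrix (Fin n) (Fin n) K) (S : Finset (Fin n)) :
    polarDetSet a b S = polarDet a b S.card := by
  have hc : S.card = (Finset.univ.filter fun i : Fin n => (i : ℕ) < S.card).card := by
    have : S.card ≤ n := by simpa using S.card_le_univ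
    rw [Fin.card_filter_val_lt, min_eq_right this]
  let e := Finset.equivOfCardEq hc
  have hcard : ∀ i, i ∈ Finset.univ.filter (fun i : Fin n => (i : ℕ) < S.card) ↔ (i : ℕ) < S.card :=
    by simp
  rw [polarDetSet_map a b S (Finset.univ.filter fun i : Fin n => (i : ℕ) < S.card) e.extendSubtype]
  · simp only [polarDetSet, polarDet, hcard]
  · intro i
    constructor
    · intro hi
      exact e.extendSubtype_mem i hi
    · intro hi
      by_contra h
      exact e.extendSubtype_not_mem i h hi

/-- The binomial expansion of the determinant of a sum. -/
theorem sum_choose_polarDet {n : ℕ} (a b : Matrix (Fin n) (Fin n) K) :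
    ∑ k ∈ Finset.range (n + 1), (n.choose k : ℂ) • polarDet a b k =
      (n.factorial : ℂ) • (a + b).det := by
  have h1 : ∑ k ∈ Finset.range (n + 1), (n.choose k : ℂ) • polarDet a b k =
      ∑ S ∈ (Finset.univ : Finset (Fin n)).powerset, polarDetSet a b S := by
    simp only [polarDetSet_eq]
    rw [Finset.sum_powerset_apply_card]
    simp [Nat.cast_smul_eq_nsmul ℂ]
  rw [h1, ← sum_sum_sign_prod]
  unfold polarDetSet
  rw [Finset.sum_comm]
  refine Finset.sum_congr rfl fun σ _ => ?_
  rw [Finset.sum_comm]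
  refine Finset.sum_congr rfl fun τ _ => ?_
  rw [← Finset.smul_sum]
  congr 1
  simp only [Matrix.add_apply]
  rw [Finset.prod_add]
  refine Finset.sum_congr rfl fun S _ => ?_
  rw [Finset.prod_ite]
  congr 1
  · simp
  · refine Finset.prod_congr ?_ fun _ _ => rfl
    ext i; simp

/-- The permutation of `Fin (m + 1)` with `0 ↦ α` that acts on the others as `σ`, after the
order-preserving identification of the complements of `0` and of `α` with `Fin m`. -/
def insertPerm {m : ℕ} (α : Fin (m + 1)) (σ : Equiv.Perm (Fin m)) : Equiv.Perm (Fin (m + 1)) :=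
  α.cycleRange.symm * Equiv.Perm.decomposeFin.symm (0, σ)

theorem insertPerm_zero {m : ℕ} (α : Fin (m + 1)) (σ : Equiv.Perm (Fin m)) :
    insertPerm α σ 0 = α := by
  simp [insertPerm]

theorem insertPerm_succ {m : ℕ} (α : Fin (m + 1)) (σ : Equiv.Perm (Fin m)) (i : Fin m) :
    insertPerm α σ i.succ = α.succAbove (σ i) := by
  simp [insertPerm]

theorem sign_insertPerm {m : ℕ} (α : Fin (m + 1)) (σ : Equiv.Perm (Fin m)) :
    Equiv.Perm.sign (insertPerm α σ) = (-1) ^ (α : ℕ) * Equiv.Perm.sign σ := by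
  simp [insertPerm]

theorem insertPerm_bijective {m : ℕ} : Function.Bijective
    (fun p : Fin (m + 1) × Equiv.Perm (Fin m) => insertPerm p.1 p.2) := by
  rw [Fintype.bijective_iff_injective_and_card]
  constructor
  · rintro ⟨α, σ⟩ ⟨β, τ⟩ h
    have h' : insertPerm α σ = insertPerm β τ := h
    have h0 := congrArg (fun p => p 0) h'
    simp only [insertPerm_zero] at h0
    subst h0
    congr 1
    ext i
    have := congrArg (fun p => p i.succ) h'
    simp only [insertPerm_succ] at this
    rw [Fin.succAbove_right_injective this]
  · simp [Fintype.card_perm, Nat.factorial_succ]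

theorem sum_perm_succ {m : ℕ} {N : Type*} [AddCommMonoid N]
    (f : Equiv.Perm (Fin (m + 1)) → N) :
    ∑ σ, f σ = ∑ α, ∑ σ, f (insertPerm α σ) := by
  rw [← Fintype.sum_prod_type' (f := fun α σ => f (insertPerm α σ))]
  exact (Function.Bijective.sum_comp insertPerm_bijective f).symm

/-- Formal integration of a polynomial over `[0, 1]`. -/
def integ : K[X] →ₗ[ℂ] K :=
  Polynomial.lsum fun k => ((1 / (k + 1) : ℂ)) • (LinearMap.id : K →ₗ[ℂ] K)

theorem integ_monomial (k : ℕ) (c : K) : integ (monomial k c) = (1 / (k + 1) : ℂ) • c := by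
  rw [integ, Polynomial.lsum_apply, Polynomial.sum_monomial_index]
  · rfl
  · simp

/-- The pencil `a + X b` of matrices. -/
def pencil {ι : Type*} (a b : Matrix ι ι K) : Matrix ι ι K[X] :=
  a.map C + (X : K[X]) • b.map C

theorem polarDet_pencil {n : ℕ} (a b : Matrix (Fin n) (Fin n) K) (k : ℕ) :
    polarDet (a.map C) ((X : K[X]) • b.map C) k = monomial (n - k) (polarDet a b k) := by
  unfold polarDet
  simp only [map_sum]
  refine Finset.sum_congr rfl fun σ _ => Finset.sum_congr rfl fun τ _ => ?_
  have h1 : (∏ i : Fin n, if (i : ℕ) < k then (a.map C) (σ i) (τ i) else ((X : K[X]) • b.map C) (σ i) (τ i))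
      = X ^ (n - k) * C (∏ i : Fin n, if (i : ℕ) < k then a (σ i) (τ i) else b (σ i) (τ i)) := by
    have : ∀ i : Fin n, (if (i : ℕ) < k then (a.map C) (σ i) (τ i) else
        ((X : K[X]) • b.map C) (σ i) (τ i)) = (if (i : ℕ) < k then 1 else X) *
          C (if (i : ℕ) < k then a (σ i) (τ i) else b (σ i) (τ i)) := by
      intro i; split_ifs <;> simp
    simp only [this]
    rw [Finset.prod_mul_distrib, map_prod, Finset.prod_ite]
    simp only [Finset.prod_const, one_pow, one_mul]
    congr 2
    have h2 := Finset.card_filter_add_card_filter_not (s := (Finset.univ : Finset (Fin n)))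
      (fun i : Fin n => (i : ℕ) < k)
    rw [Fin.card_filter_val_lt] at h2
    simp only [Finset.card_univ, Fintype.card_fin] at h2
    omega
  rw [h1, ← Polynomial.smul_monomial, mul_comm, Polynomial.C_mul_X_pow_eq_monomial]

theorem sum_choose_polarDet_integ {m : ℕ} (a b : Matrix (Fin m) (Fin m) K) :
    ∑ k ∈ Finset.range (m + 1), ((m + 1).choose k : ℂ) • polarDet a b k =
      ((m + 1).factorial : ℂ) • integ (pencil a b).det := by
  have h := congrArg (fun p => (m + 1 : ℂ) • integ p)
    (sum_choose_polarDet (a.map C) ((X : K[X]) • b.map C))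
  simp only [map_sum, map_smul, polarDet_pencil, integ_monomial] at h
  rw [smul_smul] at h
  rw [Nat.factorial_succ, Nat.cast_mul, Nat.cast_succ, pencil, ← h, Finset.smul_sum]
  refine Finset.sum_congr rfl fun k hk => ?_
  rw [smul_smul, smul_smul]
  congr 1
  have hk' : k ≤ m := by simpa [Nat.lt_succ_iff] using hk
  have h2 : ((m + 1 - k : ℕ) : ℂ) * ((m + 1).choose k : ℂ) = (m + 1) * (m.choose k : ℂ) := by
    have := Nat.choose_mul_succ_eq m k
    have h3 : (m.choose k : ℂ) * (m + 1) = ((m + 1).choose k : ℂ) * ((m + 1 - k : ℕ) : ℂ) := by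
      exact_mod_cast this
    rw [mul_comm, ← h3, mul_comm]
  have h4 : ((m - k : ℕ) : ℂ) + 1 = ((m + 1 - k : ℕ) : ℂ) := by
    rw [show m + 1 - k = m - k + 1 by omega]; push_cast; ring
  have h5 : ((m + 1 - k : ℕ) : ℂ) ≠ 0 := by
    rw [Nat.cast_ne_zero]; omega
  rw [h4]
  field_simp
  linear_combination h2

/-- The polarized cofactor expansion: one argument is distinguished, and the others are copies of
`a` and of `b`. -/
theorem sum_choose_polar_cofactor {m : ℕ} {N : Type*} [AddCommGroup N] [Module ℂ N]
    (a b : Matrix (Fin (m + 1)) (Fin (m + 1)) K) (c : Fin (m + 1) → Fin (m + 1) → K →ₗ[ℂ] N) :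
    ∑ k ∈ Finset.range (m + 2), ((m + 1).choose k : ℂ) • (if k ≤ m then
      ∑ σ : Equiv.Perm (Fin (m + 1)), ∑ τ : Equiv.Perm (Fin (m + 1)),
        ((Equiv.Perm.sign (σ * τ) : ℤ) : ℂ) • c (σ 0) (τ 0) (∏ i : Fin m,
          if (i : ℕ) < k then a (σ i.succ) (τ i.succ) else b (σ i.succ) (τ i.succ)) else 0) =
      ((m + 1).factorial : ℂ) • ∑ α, ∑ β, c α β (integ ((pencil a b).adjugate β α)) := by
  have h1 : ∀ k, ∑ σ : Equiv.Perm (Fin (m + 1)), ∑ τ : Equiv.Perm (Fin (m + 1)),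
        ((Equiv.Perm.sign (σ * τ) : ℤ) : ℂ) • c (σ 0) (τ 0) (∏ i : Fin m,
          if (i : ℕ) < k then a (σ i.succ) (τ i.succ) else b (σ i.succ) (τ i.succ)) =
        ∑ α : Fin (m + 1), ∑ β : Fin (m + 1), (-1 : ℂ) ^ (α + β : ℕ) • c α β
        (polarDet (a.submatrix α.succAbove β.succAbove) (b.submatrix α.succAbove β.succAbove) k) := by
    intro k
    rw [sum_perm_succ]
    refine Finset.sum_congr rfl fun α _ => ?_
    rw [Finset.sum_comm, sum_perm_succ]
    refine Finset.sum_congr rfl fun β _ => ?_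
    rw [Finset.sum_comm]
    unfold polarDet
    simp only [map_sum, map_smul, Finset.smul_sum]
    refine Finset.sum_congr rfl fun σ _ => Finset.sum_congr rfl fun τ _ => ?_
    simp only [insertPerm_zero, insertPerm_succ, Equiv.Perm.sign_mul, sign_insertPerm,
      Matrix.submatrix_apply, smul_smul]
    congr 1
    push_cast
    ring
  rw [Finset.sum_range_succ, if_neg (by omega), smul_zero, add_zero]
  have h2 : ∀ k ∈ Finset.range (m + 1), ((m + 1).choose k : ℂ) • (if k ≤ m then
      ∑ σ : Equiv.Perm (Fin (m + 1)), ∑ τ : Equiv.Perm (Fin (m + 1)),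
        ((Equiv.Perm.sign (σ * τ) : ℤ) : ℂ) • c (σ 0) (τ 0) (∏ i : Fin m,
          if (i : ℕ) < k then a (σ i.succ) (τ i.succ) else b (σ i.succ) (τ i.succ)) else 0) =
        ∑ α : Fin (m + 1), ∑ β : Fin (m + 1), (-1 : ℂ) ^ (α + β : ℕ) • c α β
        (((m + 1).choose k : ℂ) •
        polarDet (a.submatrix α.succAbove β.succAbove) (b.submatrix α.succAbove β.succAbove) k) := by
    intro k hk
    rw [if_pos (by simpa [Nat.lt_succ_iff] using hk), h1, Finset.smul_sum]
    refine Finset.sum_congr rfl fun α _ => ?_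
    rw [Finset.smul_sum]
    refine Finset.sum_congr rfl fun β _ => ?_
    rw [map_smul, smul_comm]
  rw [Finset.sum_congr rfl h2, Finset.sum_comm, Finset.smul_sum]
  refine Finset.sum_congr rfl fun α _ => ?_
  rw [Finset.sum_comm, Finset.smul_sum]
  refine Finset.sum_congr rfl fun β _ => ?_
  rw [← Finset.smul_sum, ← map_sum, sum_choose_polarDet_integ, map_smul, smul_comm, ← map_smul]
  have : (-1 : K[X]) ^ (α + β : ℕ) = algebraMap ℂ K[X] ((-1 : ℂ) ^ (α + β : ℕ)) := by simp
  rw [Matrix.adjugate_fin_succ_eq_det_submatrix, this, ← Algebra.smul_def, map_smul integ _ (Matrix.det _)]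
  rfl

theorem integ_C_mul (c : K) (p : K[X]) : integ (C c * p) = c * integ p := by
  induction p using Polynomial.induction_on' with
  | add p q hp hq => rw [mul_add, map_add, map_add, mul_add, hp, hq]
  | monomial k a => rw [Polynomial.C_mul_monomial, integ_monomial, integ_monomial, mul_smul_comm]

theorem integ_derivative (p : K[X]) : integ (derivative p) = p.eval 1 - p.eval 0 := by
  induction p using Polynomial.induction_on' with
  | add p q hp hq => rw [derivative_add, map_add, hp, hq, eval_add, eval_add]; ring
  | monomial k a =>
    rw [derivative_monomial, integ_monomial]
    rcases k with _ | k
    · simp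
    · have h : (k + 1 : ℂ) ≠ 0 := by exact_mod_cast Nat.succ_ne_zero k
      have h2 : a * ((k + 1 : ℕ) : K) = (k + 1 : ℂ) • a := by
        rw [Algebra.smul_def, map_add, map_natCast, map_one]; push_cast; ring
      simp only [add_tsub_cancel_right, h2, smul_smul]
      rw [one_div_mul_cancel h]
      simp

/-- The polynomial obtained by applying a linear functional to the coefficients. -/
def mapCoeff (f : K →ₗ[ℂ] ℂ) : K[X] →ₗ[ℂ] ℂ[X] :=
  Polynomial.lsum fun k => (Polynomial.monomial k : ℂ →ₗ[ℂ] ℂ[X]) ∘ₗ f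

theorem mapCoeff_monomial (f : K →ₗ[ℂ] ℂ) (k : ℕ) (c : K) :
    mapCoeff f (monomial k c) = monomial k (f c) := by
  rw [mapCoeff, Polynomial.lsum_apply, Polynomial.sum_monomial_index]
  · rfl
  · simp

theorem eval_mapCoeff (f : K →ₗ[ℂ] ℂ) (p : K[X]) (s : ℂ) :
    (mapCoeff f p).eval s = f (p.eval (algebraMap ℂ K s)) := by
  induction p using Polynomial.induction_on' with
  | add p q hp hq => rw [map_add, eval_add, eval_add, map_add, hp, hq]
  | monomial k a =>
    rw [mapCoeff_monomial, eval_monomial, eval_monomial, ← map_pow, mul_comm a, ← Algebra.smul_def,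
      map_smul, smul_eq_mul, mul_comm]

theorem integ_mapCoeff (f : K →ₗ[ℂ] ℂ) (p : K[X]) : integ (mapCoeff f p) = f (integ p) := by
  induction p using Polynomial.induction_on' with
  | add p q hp hq => simp only [map_add, hp, hq]
  | monomial k a => rw [mapCoeff_monomial, integ_monomial, integ_monomial, map_smul]

/-- A linear identity between the values of polynomials can be integrated. -/
theorem sum_integ_eq {ι : Type*} [Fintype ι] {K' N : Type*} [CommRing K'] [Algebra ℂ K']
    [AddCommGroup N] [Module ℂ N] (Λ : ι → K →ₗ[ℂ] N) (Λ' : K' →ₗ[ℂ] N) (p : ι → K[X]) (q : K'[X])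
    (h : ∀ s : ℂ, ∑ i, Λ i ((p i).eval (algebraMap ℂ K s)) = Λ' (q.eval (algebraMap ℂ K' s))) :
    ∑ i, Λ i (integ (p i)) = Λ' (integ q) := by
  rw [← sub_eq_zero, ← Module.forall_dual_apply_eq_zero_iff ℂ]
  intro f
  have h1 : ∑ i, mapCoeff (f ∘ₗ Λ i) (p i) = mapCoeff (f ∘ₗ Λ') q := by
    refine Polynomial.funext fun s => ?_
    rw [eval_finsetSum, eval_mapCoeff]
    simp only [eval_mapCoeff, LinearMap.comp_apply, ← h, map_sum]
  have h2 := congrArg integ h1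
  simp only [map_sum, integ_mapCoeff, LinearMap.comp_apply] at h2
  rw [map_sub, map_sum, h2, sub_self]

end Polarized


/-! ### Chern–Weil transgression in a graded commutative ring -/

section Transgression

open Polynomial

variable {R : Type*} [Ring R] [Algebra ℂ R]

/-- The commutative ring of pairs `(x, x')` of a central element and an element of `R`, with
`(x, x') (y, y') = (x y, x y' + y x')`. If `x` is an even form and `x'` is its exterior
derivative, this is the Leibniz rule. -/
abbrev Jet (R : Type*) [Ring R] [Algebra ℂ R] : Type _ :=
  TrivSqZeroExt (Subalgebra.center ℂ R) R

instance centerOpModule : Module (Subalgebra.center ℂ R)ᵐᵒᵖ R :=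
  Module.compHom R ((RingHom.id (Subalgebra.center ℂ R)).fromOpposite fun _ _ => mul_comm _ _)

instance centerIsCentralScalar : IsCentralScalar (Subalgebra.center ℂ R) R := ⟨fun _ _ => rfl⟩

theorem center_smul_eq (c : Subalgebra.center ℂ R) (x : R) : c • x = (c : R) * x := rfl

theorem center_comm (c : Subalgebra.center ℂ R) (x : R) : x * (c : R) = (c : R) * x :=
  Subalgebra.mem_center_iff.mp c.2 x

/-- The pair of an even element and its derivative. -/
def mkJet (c : Subalgebra.center ℂ R) (d : R) : Jet R := TrivSqZeroExt.inl c + TrivSqZeroExt.inr d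

@[simp] theorem fst_mkJet (c : Subalgebra.center ℂ R) (d : R) : (mkJet c d).fst = c := by
  simp [mkJet]

@[simp] theorem snd_mkJet (c : Subalgebra.center ℂ R) (d : R) : (mkJet c d).snd = d := by
  simp [mkJet]

theorem snd_mul_jet (x y : Jet R) : (x * y).snd = (x.fst : R) * y.snd + (y.fst : R) * x.snd := by
  rw [TrivSqZeroExt.snd_mul, op_smul_eq_smul, center_smul_eq, center_smul_eq]

/-- An array of elements of odd degree: they anticommute, and their products are even. -/
structure IsOddMatrix {ι : Type*} (A : ι → ι → R) : Prop where
  anticomm : ∀ i j k l, A i j * A k l = -(A k l * A i j)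
  mem_center : ∀ i j k l, A i j * A k l ∈ Subalgebra.center ℂ R

variable {ι : Type*} [Fintype ι]

/-- The product of two odd entries, as an even element. -/
def IsOddMatrix.prod {A : ι → ι → R} (hA : IsOddMatrix A) (i j k l : ι) : Subalgebra.center ℂ R :=
  ⟨A i j * A k l, hA.mem_center i j k l⟩

/-- The curvature `dA - A A` of a matrix `A` of odd elements with exterior derivative `D`. -/
def curv {A : ι → ι → R} (hA : IsOddMatrix A) (D : ι → ι → Subalgebra.center ℂ R) :
    Matrix ι ι (Subalgebra.center ℂ R) :=
  Matrix.of fun i j => D i j - ∑ k, hA.prod i k k j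

/-- The exterior derivative of the curvature, computed from `d d A = 0` and the Leibniz rule. -/
def dCurv (A : ι → ι → R) (D : ι → ι → Subalgebra.center ℂ R) (i j : ι) : R :=
  -∑ k, ((D i k : R) * A k j - A i k * (D k j : R))

theorem coe_curv {A : ι → ι → R} (hA : IsOddMatrix A) (D : ι → ι → Subalgebra.center ℂ R)
    (i j : ι) : (curv hA D i j : R) = D i j - ∑ k, A i k * A k j := by
  simp [curv, IsOddMatrix.prod]

/-- The Bianchi identity `dF = A F - F A`. -/
theorem bianchi {A : ι → ι → R} (hA : IsOddMatrix A) (D : ι → ι → Subalgebra.center ℂ R)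
    (i j : ι) : dCurv A D i j =
      ∑ k, A i k * (curv hA D k j : R) - ∑ k, (curv hA D i k : R) * A k j := by
  simp only [coe_curv, dCurv, mul_sub, sub_mul, Finset.sum_sub_distrib, Finset.mul_sum,
    Finset.sum_mul]
  rw [Finset.sum_comm (f := fun k l => A i l * A l k * A k j)]
  simp only [mul_assoc]
  abel

/-- The matrix of curvature forms together with their exterior derivatives. -/
def jetCurv {A : ι → ι → R} (hA : IsOddMatrix A) (D : ι → ι → Subalgebra.center ℂ R) :
    Matrix ι ι (Jet R) :=
  Matrix.of fun i j => mkJet (curv hA D i j) (dCurv A D i j)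

variable [DecidableEq ι]

/-- The matrix `1 + ε A` over the square-zero extension. Conjugating a constant matrix `M` by it adds
the derivative `A M - M A`. -/
def gauge (A : ι → ι → R) : Matrix ι ι (Jet R) := 1 + Matrix.of fun i j => TrivSqZeroExt.inr (A i j)

/-- The constant extension of a matrix of even elements. -/
def inlMat (M : Matrix ι ι (Subalgebra.center ℂ R)) : Matrix ι ι (Jet R) :=
  M.map TrivSqZeroExt.inl

omit [DecidableEq ι] in
theorem inr_mul_inr (A B : ι → ι → R) :
    (Matrix.of fun i j => (TrivSqZeroExt.inr (A i j) : Jet R)) *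
      (Matrix.of fun i j => (TrivSqZeroExt.inr (B i j) : Jet R)) = 0 := by
  ext i j <;> simp [Matrix.mul_apply]

theorem one_add_mul_one_add_neg {K : Type*} [CommRing K] (N : Matrix ι ι K) (h : N * N = 0) :
    (1 + N) * (1 + -N) = 1 := by
  rw [add_mul, mul_add, mul_add, mul_neg, mul_neg, h]
  simp

theorem gauge_mul_gauge_neg (A : ι → ι → R) : gauge A * gauge (-A) = 1 := by
  have h : (Matrix.of fun i j => (TrivSqZeroExt.inr ((-A) i j) : Jet R)) =
      -(Matrix.of fun i j => (TrivSqZeroExt.inr (A i j) : Jet R)) := by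
    ext i j <;> simp
  rw [gauge, gauge, h]
  exact one_add_mul_one_add_neg _ (inr_mul_inr A A)

theorem gauge_conj_apply (A : ι → ι → R) (M : Matrix ι ι (Subalgebra.center ℂ R)) (i j : ι) :
    (gauge A * inlMat M * gauge (-A)) i j =
      mkJet (M i j) (∑ k, A i k * (M k j : R) - ∑ k, (M i k : R) * A k j) := by
  have h : gauge A * inlMat M * gauge (-A) = inlMat M +
      (Matrix.of fun i j => (TrivSqZeroExt.inr (A i j) : Jet R)) * inlMat M +
      inlMat M * (Matrix.of fun i j => (TrivSqZeroExt.inr ((-A) i j) : Jet R)) := by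
    have h3 : (Matrix.of fun i j => (TrivSqZeroExt.inr (A i j) : Jet R)) * inlMat M *
        (Matrix.of fun i j => (TrivSqZeroExt.inr ((-A) i j) : Jet R)) = 0 := by
      have : (Matrix.of fun i j => (TrivSqZeroExt.inr (A i j) : Jet R)) * inlMat M =
          Matrix.of fun i j => TrivSqZeroExt.inr (∑ k, A i k * (M k j : R)) := by
        ext i j <;> simp [Matrix.mul_apply, inlMat, center_comm, TrivSqZeroExt.fst_sum,
          TrivSqZeroExt.snd_sum, center_smul_eq]
      rw [this, inr_mul_inr]
    rw [gauge, gauge, add_mul, add_mul, mul_add, mul_add, h3]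
    simp
    abel
  rw [h]
  refine TrivSqZeroExt.ext ?_ ?_
  · simp [Matrix.mul_apply, inlMat, TrivSqZeroExt.fst_sum]
  · simp [Matrix.mul_apply, inlMat, center_comm, sub_eq_add_neg, TrivSqZeroExt.snd_sum,
      center_smul_eq]

theorem jetCurv_eq {A : ι → ι → R} (hA : IsOddMatrix A) (D : ι → ι → Subalgebra.center ℂ R) :
    jetCurv hA D = gauge A * inlMat (curv hA D) * gauge (-A) := by
  ext1 i j
  rw [gauge_conj_apply, ← bianchi]
  rfl

theorem det_inlMat (M : Matrix ι ι (Subalgebra.center ℂ R)) :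
    (inlMat M).det = TrivSqZeroExt.inl M.det := by
  exact ((TrivSqZeroExt.inlHom (Subalgebra.center ℂ R) R).map_det M).symm

theorem adjugate_inlMat (M : Matrix ι ι (Subalgebra.center ℂ R)) :
    (inlMat M).adjugate = inlMat M.adjugate := by
  exact ((TrivSqZeroExt.inlHom (Subalgebra.center ℂ R) R).map_adjugate M).symm

theorem adjugate_conj {K : Type*} [CommRing K] (M A B : Matrix ι ι K) (h : A * B = 1) :
    (A * M * B).adjugate = A * M.adjugate * B := by
  have hB : B.adjugate = B.det • A := by
    have h1 : B.adjugate * (B * A) = B.det • A := by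
      rw [← mul_assoc, Matrix.adjugate_mul, Matrix.smul_mul, one_mul]
    rwa [_root_.mul_eq_one_comm.mp h, mul_one] at h1
  have hA : A.adjugate = A.det • B := by
    have h1 : (B * A) * A.adjugate = A.det • B := by
      rw [mul_assoc, Matrix.mul_adjugate, Matrix.mul_smul, mul_one]
    rwa [_root_.mul_eq_one_comm.mp h, one_mul] at h1
  rw [Matrix.adjugate_mul_distrib, Matrix.adjugate_mul_distrib, hA, hB]
  have : A.det * B.det = 1 := by rw [← Matrix.det_mul, h, Matrix.det_one]
  rw [Matrix.smul_mul, Matrix.mul_smul, Matrix.mul_smul, smul_smul, mul_comm, this, one_smul,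
    mul_assoc]

theorem det_conj {K : Type*} [CommRing K] (M A B : Matrix ι ι K) (h : A * B = 1) :
    (A * M * B).det = M.det := by
  rw [Matrix.det_mul_right_comm, h, one_mul]

/-- The determinant of the curvature is closed. -/
theorem det_jetCurv {A : ι → ι → R} (hA : IsOddMatrix A) (D : ι → ι → Subalgebra.center ℂ R) :
    (jetCurv hA D).det = TrivSqZeroExt.inl (curv hA D).det := by
  rw [jetCurv_eq, det_conj _ _ _ (gauge_mul_gauge_neg A), det_inlMat]

/-- The cofactor matrix of the curvature satisfies the Bianchi identity. -/
theorem adjugate_jetCurv {A : ι → ι → R} (hA : IsOddMatrix A)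
    (D : ι → ι → Subalgebra.center ℂ R) (i j : ι) :
    (jetCurv hA D).adjugate i j = mkJet ((curv hA D).adjugate i j)
      (∑ k, A i k * ((curv hA D).adjugate k j : R) -
        ∑ k, ((curv hA D).adjugate i k : R) * A k j) := by
  rw [jetCurv_eq, adjugate_conj _ _ _ (gauge_mul_gauge_neg A), adjugate_inlMat, gauge_conj_apply]

/-- The infinitesimal transgression formula: `d tr (adj(F) B) = tr (adj(F) (dB - A B - B A))`,
where `B` has exterior derivative `D'`. -/
theorem sum_adjugate_jetCurv {A : ι → ι → R} (hA : IsOddMatrix A)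
    (D : ι → ι → Subalgebra.center ℂ R) (B : ι → ι → R) (D' : ι → ι → Subalgebra.center ℂ R)
    (hB : ∀ i j k l, A i j * B k l = -(B k l * A i j)) :
    ∑ i, ∑ j, ((D' i j : R) * ((jetCurv hA D).adjugate j i).fst -
        B i j * ((jetCurv hA D).adjugate j i).snd) =
      ∑ i, ∑ j, ((curv hA D).adjugate j i : R) *
        ((D' i j : R) - ∑ k, (A i k * B k j + B i k * A k j)) := by
  simp only [adjugate_jetCurv, fst_mkJet, snd_mkJet]
  set a := (curv hA D).adjugate with ha
  have h1 : ∑ i, ∑ j, B i j * ∑ k, A j k * (a k i : R) =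
      ∑ i, ∑ j, (a j i : R) * ∑ k, B i k * A k j := by
    refine Finset.sum_congr rfl fun i _ => ?_
    simp only [Finset.mul_sum]
    rw [Finset.sum_comm]
    refine Finset.sum_congr rfl fun k _ => Finset.sum_congr rfl fun j _ => ?_
    rw [← mul_assoc, center_comm]
  have h2 : ∑ i, ∑ j, B i j * ∑ k, (a j k : R) * A k i =
      -∑ i, ∑ j, (a j i : R) * ∑ k, A i k * B k j := by
    have h3 : ∀ i j k, B i j * ((a j k : R) * A k i) = -((a j k : R) * (A k i * B i j)) := by
      intro i j k
      rw [hB, mul_neg, neg_neg, ← mul_assoc, center_comm, mul_assoc]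
    simp only [Finset.mul_sum, h3, ← Finset.sum_neg_distrib]
    rw [Finset.sum_comm]
    rw [Finset.sum_congr rfl fun j _ => Finset.sum_comm]
    rw [Finset.sum_comm]
  simp only [mul_sub, Finset.sum_sub_distrib, Finset.sum_add_distrib, mul_add, h1, h2]
  have hc : ∀ i j, (D' i j : R) * (a j i : R) = (a j i : R) * (D' i j : R) := fun i j =>
    center_comm _ _
  simp only [hc]
  abel

end Transgression


/-! ### The path of connections that splits off the first row -/

section Rescaling

open Polynomial

variable {R : Type*} [Ring R] [Algebra ℂ R] {n : ℕ}

/-- The factors by which the entries of the connection matrix are rescaled along the path of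
connections: the entries `(0, β)` with `β ≠ 0` are multiplied by `1 - s`. -/
def scale {K : Type*} [CommRing K] (s : K) (i j : Fin (n + 1)) : K :=
  if i = 0 ∧ j ≠ 0 then 1 - s else 1

/-- The derivative of `scale` with respect to the parameter. -/
def dScale {K : Type*} [CommRing K] (i j : Fin (n + 1)) : K :=
  if i = 0 ∧ j ≠ 0 then -1 else 0

theorem scale_zero_succ {K : Type*} [CommRing K] (s : K) (β : Fin n) :
    scale s (0 : Fin (n + 1)) β.succ = 1 - s := by
  simp [scale, Fin.succ_ne_zero]

theorem scale_zero_right {K : Type*} [CommRing K] (s : K) (i : Fin (n + 1)) :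
    scale s i 0 = 1 := by
  simp [scale]

theorem scale_succ {K : Type*} [CommRing K] (s : K) (α : Fin n) (j : Fin (n + 1)) :
    scale s α.succ j = 1 := by
  simp [scale, Fin.succ_ne_zero]

theorem dScale_zero_succ {K : Type*} [CommRing K] (β : Fin n) :
    dScale (K := K) (0 : Fin (n + 1)) β.succ = -1 := by
  simp [dScale, Fin.succ_ne_zero]

theorem dScale_zero_right {K : Type*} [CommRing K] (i : Fin (n + 1)) :
    dScale (K := K) i 0 = 0 := by
  simp [dScale]

theorem dScale_succ {K : Type*} [CommRing K] (α : Fin n) (j : Fin (n + 1)) :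
    dScale (K := K) α.succ j = 0 := by
  simp [dScale, Fin.succ_ne_zero]

variable {θ : Fin (n + 1) → Fin (n + 1) → R}

theorem IsOddMatrix.scale (hθ : IsOddMatrix θ) (s : ℂ) :
    IsOddMatrix fun i j => scale s i j • θ i j where
  anticomm i j k l := by
    rw [smul_mul_smul_comm, smul_mul_smul_comm, hθ.anticomm, mul_comm, smul_neg]
  mem_center i j k l := by
    rw [smul_mul_smul_comm]
    exact Subalgebra.smul_mem _ (hθ.mem_center i j k l) _

/-- The even elements `θ_α^0 θ_0^β`. -/
def offDiag (hθ : IsOddMatrix θ) (α β : Fin n) : Subalgebra.center ℂ R :=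
  hθ.prod α.succ 0 0 β.succ

/-- `θ_α^0 θ_0^β` together with its exterior derivative. -/
def jetOffDiag (hθ : IsOddMatrix θ) (D : Fin (n + 1) → Fin (n + 1) → Subalgebra.center ℂ R) :
    Matrix (Fin n) (Fin n) (Jet R) :=
  Matrix.of fun α β => mkJet (offDiag hθ α β)
    ((D α.succ 0 : R) * θ 0 β.succ - θ α.succ 0 * (D 0 β.succ : R))

/-- The block of the curvature forms with indices `1, …, n`, with their exterior derivatives. -/
def jetBlock (hθ : IsOddMatrix θ) (D : Fin (n + 1) → Fin (n + 1) → Subalgebra.center ℂ R) :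
    Matrix (Fin n) (Fin n) (Jet R) :=
  (jetCurv hθ D).submatrix Fin.succ Fin.succ

theorem curv_scale (hθ : IsOddMatrix θ) (D : Fin (n + 1) → Fin (n + 1) → Subalgebra.center ℂ R)
    (s : ℂ) (i j : Fin (n + 1)) :
    curv (hθ.scale s) (fun i j => scale s i j • D i j) i j =
      scale s i j • D i j - ∑ k, (scale s i k * scale s k j) • hθ.prod i k k j := by
  simp only [curv, Matrix.of_apply]
  congr 1
  refine Finset.sum_congr rfl fun k _ => ?_
  rw [Subtype.ext_iff]
  exact smul_mul_smul_comm _ _ _ _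

theorem dCurv_scale (D : Fin (n + 1) → Fin (n + 1) → Subalgebra.center ℂ R)
    (s : ℂ) (i j : Fin (n + 1)) :
    dCurv (fun i j => scale s i j • θ i j) (fun i j => scale s i j • D i j) i j =
      -∑ k, (scale s i k * scale s k j) • ((D i k : R) * θ k j - θ i k * (D k j : R)) := by
  simp only [dCurv]
  congr 1
  refine Finset.sum_congr rfl fun k _ => ?_
  rw [smul_sub, ← smul_mul_smul_comm, ← smul_mul_smul_comm]
  rfl

theorem jetCurv_scale_succ_zero (hθ : IsOddMatrix θ)
    (D : Fin (n + 1) → Fin (n + 1) → Subalgebra.center ℂ R) (s : ℂ) (α : Fin n) :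
    jetCurv (hθ.scale s) (fun i j => scale s i j • D i j) α.succ 0 = jetCurv hθ D α.succ 0 := by
  refine TrivSqZeroExt.ext ?_ ?_
  · simp only [jetCurv, Matrix.of_apply, fst_mkJet]
    rw [curv_scale hθ]
    simp [scale_succ, scale_zero_right, curv]
  · simp only [jetCurv, Matrix.of_apply, snd_mkJet]
    rw [dCurv_scale]
    simp [scale_succ, scale_zero_right, dCurv]

theorem jetCurv_scale_succ_succ (hθ : IsOddMatrix θ)
    (D : Fin (n + 1) → Fin (n + 1) → Subalgebra.center ℂ R) (s : ℂ) (α β : Fin n) :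
    jetCurv (hθ.scale s) (fun i j => scale s i j • D i j) α.succ β.succ =
      jetBlock hθ D α β + s • jetOffDiag hθ D α β := by
  refine TrivSqZeroExt.ext ?_ ?_
  · simp only [jetCurv, Matrix.of_apply, fst_mkJet, jetBlock, Matrix.submatrix_apply,
      TrivSqZeroExt.fst_add, TrivSqZeroExt.fst_smul, jetOffDiag]
    rw [curv_scale hθ]
    simp only [curv, Matrix.of_apply, scale_succ, one_smul,
      one_mul, Fin.sum_univ_succ, scale_zero_succ, sub_smul, offDiag]
    abel
  · simp only [jetCurv, Matrix.of_apply, snd_mkJet, jetBlock, Matrix.submatrix_apply,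
      TrivSqZeroExt.snd_add, TrivSqZeroExt.snd_smul, jetOffDiag]
    rw [dCurv_scale]
    simp only [dCurv, scale_succ, one_smul,
      one_mul, Fin.sum_univ_succ, scale_zero_succ, sub_smul]
    abel

/-- The polynomials whose values are the cofactors `(β, 0)` of the rescaled curvature, up to
sign. -/
def cofactorPoly (hθ : IsOddMatrix θ) (D : Fin (n + 1) → Fin (n + 1) → Subalgebra.center ℂ R)
    (β : Fin n) : (Jet R)[X] :=
  ∑ α, C (jetCurv hθ D α.succ 0) * (pencil (jetBlock hθ D) (jetOffDiag hθ D)).adjugate β α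

theorem eval_adjugate_pencil {K : Type*} [CommRing K] [Algebra ℂ K] {ι : Type*} [Fintype ι]
    [DecidableEq ι] (a b : Matrix ι ι K) (s : K) (i j : ι) :
    ((pencil a b).adjugate i j).eval s = (a + s • b).adjugate i j := by
  have h := (Polynomial.evalRingHom s).map_adjugate (pencil a b)
  have h2 : (Polynomial.evalRingHom s).mapMatrix (pencil a b) = a + s • b := by
    ext i j
    simp only [pencil, RingHom.mapMatrix_apply, Matrix.map_apply, coe_evalRingHom,
      Matrix.add_apply, Matrix.smul_apply, smul_eq_mul, eval_add, eval_mul, eval_C, eval_X]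
  rw [h2] at h
  rw [← h]
  rfl

theorem neg_adjugate_succ_zero {K : Type*} [CommRing K]
    (M : Matrix (Fin (n + 1)) (Fin (n + 1)) K) (β : Fin n) : -M.adjugate β.succ 0 =
      ∑ α, M α.succ 0 * (M.submatrix Fin.succ Fin.succ).adjugate β α := by
  rw [adjugate_succ_zero, neg_neg]

theorem eval_cofactorPoly (hθ : IsOddMatrix θ)
    (D : Fin (n + 1) → Fin (n + 1) → Subalgebra.center ℂ R) (β : Fin n) (s : ℂ) :
    (cofactorPoly hθ D β).eval (algebraMap ℂ (Jet R) s) =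
      -(jetCurv (hθ.scale s) (fun i j => scale s i j • D i j)).adjugate β.succ 0 := by
  refine Eq.trans ?_ (neg_adjugate_succ_zero _ β).symm
  rw [cofactorPoly, eval_finsetSum]
  refine Finset.sum_congr rfl fun α _ => ?_
  rw [eval_mul, eval_C, eval_adjugate_pencil, jetCurv_scale_succ_zero]
  have hN : jetBlock hθ D + algebraMap ℂ (Jet R) s • jetOffDiag hθ D =
      (jetCurv (hθ.scale s) (fun i j => scale s i j • D i j)).submatrix Fin.succ Fin.succ := by
    refine Matrix.ext fun α β => ?_
    rw [Matrix.submatrix_apply, jetCurv_scale_succ_succ, Matrix.add_apply, Matrix.smul_apply,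
      smul_eq_mul, ← Algebra.smul_def]
  rw [hN]

/-- The rescaled curvature as a polynomial in the parameter. -/
def curvPoly (hθ : IsOddMatrix θ) (D : Fin (n + 1) → Fin (n + 1) → Subalgebra.center ℂ R) :
    Matrix (Fin (n + 1)) (Fin (n + 1)) (Subalgebra.center ℂ R)[X] :=
  Matrix.of fun i j => scale X i j * C (D i j) -
    ∑ k, scale X i k * scale X k j * C (hθ.prod i k k j)

theorem eval_scale {K : Type*} [CommRing K] [Algebra ℂ K] (s : ℂ) (i j : Fin (n + 1)) :
    (scale (X : K[X]) i j).eval (algebraMap ℂ K s) = algebraMap ℂ K (scale s i j) := by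
  unfold scale; split_ifs <;> simp

theorem eval_zero_scale {K : Type*} [CommRing K] (i j : Fin (n + 1)) :
    (scale (X : K[X]) i j).eval 0 = 1 := by
  unfold scale; split_ifs <;> simp

theorem derivative_scale {K : Type*} [CommRing K] (i j : Fin (n + 1)) :
    derivative (scale (X : K[X]) i j) = C (dScale i j) := by
  unfold scale dScale; split_ifs <;> simp

theorem algebraMap_dScale {K : Type*} [CommRing K] [Algebra ℂ K] (i j : Fin (n + 1)) :
    (dScale i j : K) = algebraMap ℂ K (dScale i j) := by
  unfold dScale; split_ifs <;> simp

theorem eval_curvPoly (hθ : IsOddMatrix θ)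
    (D : Fin (n + 1) → Fin (n + 1) → Subalgebra.center ℂ R) (s : ℂ) :
    (Polynomial.evalRingHom (algebraMap ℂ (Subalgebra.center ℂ R) s)).mapMatrix (curvPoly hθ D) =
      curv (hθ.scale s) (fun i j => scale s i j • D i j) := by
  ext1 i j
  rw [curv_scale hθ D s i j]
  simp only [curvPoly, RingHom.mapMatrix_apply, Matrix.map_apply, Matrix.of_apply,
    coe_evalRingHom, eval_sub, eval_mul, eval_scale, eval_C, eval_finsetSum, Algebra.smul_def,
    map_mul]

theorem eval_derivative_curvPoly (hθ : IsOddMatrix θ)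
    (D : Fin (n + 1) → Fin (n + 1) → Subalgebra.center ℂ R) (s : ℂ) (i j : Fin (n + 1)) :
    (((derivative (curvPoly hθ D i j)).eval (algebraMap ℂ (Subalgebra.center ℂ R) s) :
      Subalgebra.center ℂ R) : R) = dScale (K := ℂ) i j • (D i j : R) -
      ∑ k, ((scale s i k • θ i k) * (dScale (K := ℂ) k j • θ k j) +
        (dScale (K := ℂ) i k • θ i k) * (scale s k j • θ k j)) := by
  have h : (derivative (curvPoly hθ D i j)).eval (algebraMap ℂ (Subalgebra.center ℂ R) s) =
      dScale (K := ℂ) i j • D i j - ∑ k, (scale s i k * dScale (K := ℂ) k j +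
        dScale (K := ℂ) i k * scale s k j) • hθ.prod i k k j := by
    simp only [curvPoly, Matrix.of_apply, derivative_sub, derivative_sum, derivative_mul,
      derivative_scale, derivative_C, mul_zero, add_zero, eval_sub, eval_mul, eval_C,
      eval_finsetSum, eval_add, eval_scale, Algebra.smul_def, map_add, map_mul,
      ← algebraMap_dScale]
    congr 1
    exact Finset.sum_congr rfl fun k _ => by ring
  rw [h]
  simp only [AddSubgroupClass.coe_sub, AddSubmonoidClass.coe_finsetSum]
  congr 1
  refine Finset.sum_congr rfl fun k _ => ?_
  rw [smul_mul_smul_comm, smul_mul_smul_comm, ← add_smul]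
  rfl

theorem eval_zero_det_curvPoly (hθ : IsOddMatrix θ)
    (D : Fin (n + 1) → Fin (n + 1) → Subalgebra.center ℂ R) :
    (curvPoly hθ D).det.eval 0 = (curv hθ D).det := by
  have h := (Polynomial.evalRingHom (0 : Subalgebra.center ℂ R)).map_det (curvPoly hθ D)
  rw [coe_evalRingHom] at h
  rw [h]
  congr 1
  refine Matrix.ext fun i j => ?_
  simp [curvPoly, curv, eval_finsetSum, eval_zero_scale]

theorem eval_one_det_curvPoly (hθ : IsOddMatrix θ)
    (D : Fin (n + 1) → Fin (n + 1) → Subalgebra.center ℂ R) :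
    (curvPoly hθ D).det.eval 1 = D 0 0 * (jetBlock hθ D + jetOffDiag hθ D).det.fst := by
  have h := (Polynomial.evalRingHom (1 : Subalgebra.center ℂ R)).map_det (curvPoly hθ D)
  rw [coe_evalRingHom] at h
  rw [h]
  have hM : (Polynomial.evalRingHom (1 : Subalgebra.center ℂ R)).mapMatrix (curvPoly hθ D) =
      curv (hθ.scale 1) (fun i j => scale (1 : ℂ) i j • D i j) := by
    have := eval_curvPoly hθ D 1
    rwa [map_one] at this
  have hsq : hθ.prod 0 0 0 0 = 0 := by
    have h0 : θ 0 0 * θ 0 0 = 0 := by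
      have h1 := hθ.anticomm 0 0 0 0
      have h2 : (2 : ℂ) • (θ 0 0 * θ 0 0) = 0 := by
        rw [two_smul]
        exact eq_neg_iff_add_eq_zero.mp h1
      exact (smul_eq_zero.mp h2).resolve_left two_ne_zero
    exact Subtype.ext h0
  have h00 : curv (hθ.scale 1) (fun i j => scale (1 : ℂ) i j • D i j) 0 0 = D 0 0 := by
    rw [curv_scale hθ D 1 0 0]
    simp [Fin.sum_univ_succ, scale_zero_right, scale_zero_succ, hsq]
  have h0s : ∀ β : Fin n,
      curv (hθ.scale 1) (fun i j => scale (1 : ℂ) i j • D i j) 0 β.succ = 0 := by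
    intro β
    rw [curv_scale hθ D 1 0 β.succ]
    simp [Fin.sum_univ_succ, scale_zero_right, scale_zero_succ]
  have hsub : (curv (hθ.scale 1) (fun i j => scale (1 : ℂ) i j • D i j)).submatrix
      Fin.succ Fin.succ = (TrivSqZeroExt.fstHom (Subalgebra.center ℂ R) (Subalgebra.center ℂ R)
        R).mapMatrix (jetBlock hθ D + jetOffDiag hθ D) := by
    refine Matrix.ext fun α β => ?_
    have := congrArg TrivSqZeroExt.fst (jetCurv_scale_succ_succ hθ D 1 α β)
    rw [one_smul] at this
    simpa [jetCurv] using this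
  rw [hM, Matrix.det_succ_row_zero, Fin.sum_univ_succ]
  simp only [h0s, h00]
  have hd := (TrivSqZeroExt.fstHom (Subalgebra.center ℂ R) (Subalgebra.center ℂ R)
    R).map_det (jetBlock hθ D + jetOffDiag hθ D)
  rw [← hsub] at hd
  have hd' : (jetBlock hθ D + jetOffDiag hθ D).det.fst = _ := hd
  rw [hd']
  simp [Fin.succAbove_zero]

/-- The transgression formula. With `F = dθ - θ θ`, it expresses `det F` by the exterior
derivatives of `θ_0^0`, `θ_0^β` and of the cofactors of the rescaled curvature; it is obtained by
integrating the infinitesimal transgression formula along the path of connections for which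
`θ_0^β` is multiplied by `1 - s`. -/
theorem det_curv_eq (hθ : IsOddMatrix θ)
    (D : Fin (n + 1) → Fin (n + 1) → Subalgebra.center ℂ R) :
    ((curv hθ D).det : R) = (D 0 0 : R) * ((jetBlock hθ D + jetOffDiag hθ D).det.fst : R) -
      ∑ β : Fin n, ((D 0 β.succ : R) * ((integ (cofactorPoly hθ D β)).fst : R) -
        θ 0 β.succ * (integ (cofactorPoly hθ D β)).snd) := by
  let Λ : Fin n → Jet R →ₗ[ℂ] R := fun β =>
    { toFun := fun x => (D 0 β.succ : R) * (x.fst : R) - θ 0 β.succ * x.snd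
      map_add' := fun x y => by simp [mul_add]; abel
      map_smul' := fun c x => by simp [smul_sub] }
  have h1 := sum_integ_eq Λ (Subalgebra.center ℂ R).val.toLinearMap (cofactorPoly hθ D)
    (derivative (curvPoly hθ D).det) (by
      intro s
      have h := sum_adjugate_jetCurv (hθ.scale s) (fun i j => scale s i j • D i j)
        (fun i j => dScale (K := ℂ) i j • θ i j) (fun i j => dScale (K := ℂ) i j • D i j) (by
          intro i j k l
          simp only [smul_mul_smul_comm]
          rw [hθ.anticomm, mul_comm, smul_neg])
      rw [Fin.sum_univ_succ, Fin.sum_univ_succ] at h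
      simp only [dScale_zero_right, dScale_succ, zero_smul, ZeroMemClass.coe_zero, zero_mul,
        sub_zero, Finset.sum_const_zero, add_zero, zero_add, dScale_zero_succ, neg_smul, one_smul]
        at h
      have hl : ∀ β, Λ β ((cofactorPoly hθ D β).eval (algebraMap ℂ (Jet R) s)) =
          ((-D 0 β.succ : Subalgebra.center ℂ R) : R) * ((jetCurv (hθ.scale s)
            (fun i j => scale s i j • D i j)).adjugate β.succ 0).fst - -θ 0 β.succ *
            ((jetCurv (hθ.scale s) (fun i j => scale s i j • D i j)).adjugate β.succ 0).snd := by
        intro β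
        rw [eval_cofactorPoly]
        simp [Λ]
      rw [Finset.sum_congr rfl fun β _ => hl β, h, derivative_det, eval_finsetSum]
      simp only [eval_finsetSum, eval_mul, AlgHom.toLinearMap_apply, map_sum, map_mul,
        Subalgebra.coe_val]
      refine Finset.sum_congr rfl fun i _ => Finset.sum_congr rfl fun j _ => ?_
      rw [eval_derivative_curvPoly hθ D s i j, ← eval_curvPoly hθ D s, ← RingHom.map_adjugate]
      congr 2)
  simp only [Λ, LinearMap.coe_mk, AddHom.coe_mk] at h1
  rw [h1, integ_derivative, eval_one_det_curvPoly, eval_zero_det_curvPoly]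
  exact (sub_sub_cancel ((D 0 0 : R) * ((jetBlock hθ D + jetOffDiag hθ D).det.fst : R)) _).symm

/-- The determinant of the block matrix `dθ_α^β - θ_α^γ θ_γ^β` is closed. -/
theorem snd_det_jetBlock_add (hθ : IsOddMatrix θ)
    (D : Fin (n + 1) → Fin (n + 1) → Subalgebra.center ℂ R) :
    (jetBlock hθ D + jetOffDiag hθ D).det.snd = 0 := by
  have hω : IsOddMatrix fun α β : Fin n => θ α.succ β.succ :=
    ⟨fun i j k l => hθ.anticomm _ _ _ _, fun i j k l => hθ.mem_center _ _ _ _⟩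
  have h : jetBlock hθ D + jetOffDiag hθ D = jetCurv hω fun α β => D α.succ β.succ := by
    refine Matrix.ext fun α β => TrivSqZeroExt.ext ?_ ?_
    · rw [Matrix.add_apply, TrivSqZeroExt.fst_add]
      simp only [jetBlock, jetOffDiag, jetCurv, Matrix.submatrix_apply, Matrix.of_apply, fst_mkJet,
        curv, Fin.sum_univ_succ, offDiag, IsOddMatrix.prod]
      abel
    · rw [Matrix.add_apply, TrivSqZeroExt.snd_add]
      simp only [jetBlock, jetOffDiag, jetCurv, Matrix.submatrix_apply, Matrix.of_apply, snd_mkJet,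
        dCurv, Fin.sum_univ_succ]
      abel
  rw [h, det_jetCurv, TrivSqZeroExt.snd_inl]

end Rescaling


/-! ### The transgression form at a point -/

section PointwiseBridge

open Polynomial

variable {E : Type*} [NormedAddCommGroup E] [NormedSpace ℂ E] {n : ℕ}

/-- A matrix of two-forms, over the commutative ring of even forms. -/
def evenMatrix {ι : Type*} (B : ι → ι → CForm E 2) :
    Matrix ι ι (Subalgebra.center ℂ (Forms E)) :=
  Matrix.of fun i j => inclCenter even_two (B i j)

theorem isOddMatrix_incl {ι : Type*} (A : ι → ι → CForm E 1) :
    IsOddMatrix fun i j => incl 1 (A i j) where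
  anticomm i j k l := incl_anticommute odd_one odd_one _ _
  mem_center i j k l := by
    rw [← incl_wedge _ _ (one_add_one_eq_two)]
    exact incl_mem_center even_two _

theorem incl_topChern {N : ℕ} (B : Fin N → Fin N → CForm E 2) :
    inclCenter (even_two_mul N) (topChern B) =
      (Complex.I / (2 * Real.pi)) ^ N • (evenMatrix B).det := by
  rw [topChern, map_smul, map_sum, ← Matrix.det_transpose, Matrix.det_apply]
  congr 1
  refine Finset.sum_congr rfl fun σ _ => ?_
  rw [map_smul, incl_wedgeProd, Int.cast_smul_eq_zsmul]
  rfl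

/-- The block of the two-forms `Θ_α^β` with `α, β ≥ 1`. -/
def evenBlock (B : Fin (n + 1) → Fin (n + 1) → CForm E 2) :
    Matrix (Fin n) (Fin n) (Subalgebra.center ℂ (Forms E)) :=
  evenMatrix fun α β => B α.succ β.succ

/-- The matrix of the two-forms `θ_α^0 θ_0^β`. -/
def evenOffDiag (A : Fin (n + 1) → Fin (n + 1) → CForm E 1) :
    Matrix (Fin n) (Fin n) (Subalgebra.center ℂ (Forms E)) :=
  evenMatrix fun α β => wedge (A α.succ 0) (A 0 β.succ)

/-- Multiplication by a form on the left, on the ring of even forms. -/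
def mulEven (x : Forms E) : Subalgebra.center ℂ (Forms E) →ₗ[ℂ] Forms E :=
  (LinearMap.mulLeft ℂ x).comp (Subalgebra.center ℂ (Forms E)).val.toLinearMap

theorem mulEven_apply (x : Forms E) (c : Subalgebra.center ℂ (Forms E)) :
    mulEven x c = x * (c : Forms E) := rfl

theorem incl_Phi0 (A : Fin (n + 1) → Fin (n + 1) → CForm E 1)
    (B : Fin (n + 1) → Fin (n + 1) → CForm E 2) (k : ℕ) :
    incl (2 * n + 1) (Phi0 A B k) =
      mulEven (incl 1 (A 0 0)) (polarDet (evenBlock B) (evenOffDiag A) k) := by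
  simp only [Phi0, polarDet, map_sum, map_smul]
  refine Finset.sum_congr rfl fun σ _ => Finset.sum_congr rfl fun τ _ => ?_
  rw [incl_wedge, ← coe_inclCenter (even_two_mul n), incl_wedgeProd, mulEven_apply]
  congr 1
  refine congrArg (fun c : Subalgebra.center ℂ (Forms E) => incl 1 (A 0 0) * (c : Forms E))
    (Finset.prod_congr rfl fun i _ => ?_)
  split_ifs <;> rfl

theorem incl_sum_Phi1 (A : Fin (n + 1) → Fin (n + 1) → CForm E 1)
    (B : Fin (n + 1) → Fin (n + 1) → CForm E 2) :
    ∑ k ∈ Finset.range (n + 1), (n.choose k : ℂ) • incl (2 * n + 1) (Phi1 A B k) =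
      (n.factorial : ℂ) • ∑ α : Fin n, ∑ β : Fin n,
        mulEven (incl 2 (B α.succ 0) * incl 1 (A 0 β.succ))
          (integ ((pencil (evenBlock B) (evenOffDiag A)).adjugate β α)) := by
  cases n with
  | zero => simp [Phi1]
  | succ m =>
    rw [← sum_choose_polar_cofactor (evenBlock B) (evenOffDiag A)
      (fun α β => mulEven (incl 2 (B α.succ 0) * incl 1 (A 0 β.succ)))]
    refine Finset.sum_congr rfl fun k _ => ?_
    congr 1
    rw [Phi1]
    split_ifs with hk
    · simp only [map_sum, map_smul]
      refine Finset.sum_congr rfl fun σ _ => Finset.sum_congr rfl fun τ _ => ?_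
      rw [incl_wedge, incl_wedge, ← coe_inclCenter (even_two_mul m), incl_wedgeProd, mulEven_apply]
      congr 1
      refine congrArg (fun c : Subalgebra.center ℂ (Forms E) =>
        incl 2 (B (σ 0).succ 0) * incl 1 (A 0 (τ 0).succ) * (c : Forms E))
        (Finset.prod_congr rfl fun i _ => ?_)
      split_ifs <;> rfl
    · simp

/-- The transgression form in closed form: with `Θ` the block of the `Θ_α^β` and `β` the matrix of
the `θ_α^0 θ_0^β`, it is, up to a constant factor,
`θ_0^0 det (Θ + β) - ∑ Θ_α^0 θ_0^β ∫₀¹ adj(Θ + s β)_β^α ds`. -/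
theorem incl_transgressionForm (A : Fin (n + 1) → Fin (n + 1) → CForm E 1)
    (B : Fin (n + 1) → Fin (n + 1) → CForm E 2) :
    incl (2 * n + 1) (transgressionForm A B) = (Complex.I / (2 * Real.pi)) ^ (n + 1) •
      (mulEven (incl 1 (A 0 0)) (evenBlock B + evenOffDiag A).det -
        ∑ α : Fin n, ∑ β : Fin n, mulEven (incl 2 (B α.succ 0) * incl 1 (A 0 β.succ))
          (integ ((pencil (evenBlock B) (evenOffDiag A)).adjugate β α))) := by
  have h0 : ∑ k ∈ Finset.range (n + 1), (n.choose k : ℂ) • incl (2 * n + 1) (Phi0 A B k) =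
      (n.factorial : ℂ) • mulEven (incl 1 (A 0 0)) (evenBlock B + evenOffDiag A).det := by
    have := congrArg (mulEven (incl 1 (A 0 0))) (sum_choose_polarDet (evenBlock B) (evenOffDiag A))
    simp only [map_sum, map_smul] at this
    rw [← this]
    exact Finset.sum_congr rfl fun k _ => by rw [incl_Phi0]
  rw [transgressionForm, map_smul, map_sum]
  simp only [map_smul, map_sub, smul_sub, Finset.sum_sub_distrib]
  have hc : (1 / (n.factorial : ℂ) * (Complex.I / (2 * Real.pi)) ^ (n + 1)) * n.factorial =
      (Complex.I / (2 * Real.pi)) ^ (n + 1) := by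
    have := factorial_ne_zero' n
    field_simp
  rw [h0, incl_sum_Phi1, smul_smul, smul_smul, hc]

theorem sum_conj_mul_conj {R : Type*} [Ring R] [Algebra ℂ R] {ι : Type*} [Fintype ι]
    [DecidableEq ι] (p q : Matrix ι ι ℂ) (h : p * q = 1) (x y x' y' : Matrix ι ι R)
    (hx : ∀ i j, x' i j = ∑ k, ∑ l, (p i k * q l j) • x k l)
    (hy : ∀ i j, y' i j = ∑ k, ∑ l, (p i k * q l j) • y k l) :
    ∑ i, ∑ j, x' i j * y' j i = ∑ i, ∑ j, x i j * y j i := by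
  have h' : q * p = 1 := _root_.mul_eq_one_comm.mp h
  have hconj : ∀ z : Matrix ι ι R, ∀ i j, ∑ k, ∑ l, (p i k * q l j) • z k l =
      (p.map (algebraMap ℂ R) * z * q.map (algebraMap ℂ R)) i j := by
    intro z i j
    simp only [Matrix.mul_apply, Matrix.map_apply, Finset.sum_mul]
    rw [Finset.sum_comm]
    refine Finset.sum_congr rfl fun l _ => Finset.sum_congr rfl fun k _ => ?_
    rw [← Algebra.smul_def, ← Algebra.commutes, ← Algebra.smul_def, smul_smul, mul_comm]
  have hx' : x' = p.map (algebraMap ℂ R) * x * q.map (algebraMap ℂ R) := by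
    ext1 i j; rw [hx, hconj]
  have hy' : y' = p.map (algebraMap ℂ R) * y * q.map (algebraMap ℂ R) := by
    ext1 i j; rw [hy, hconj]
  have hqp : q.map (algebraMap ℂ R) * p.map (algebraMap ℂ R) = 1 := by
    rw [← Matrix.map_mul, h', Matrix.map_one _ (map_zero _) (map_one _)]
  have hxy : x' * y' = p.map (algebraMap ℂ R) * (x * y) * q.map (algebraMap ℂ R) := by
    rw [hx', hy']
    calc _ = p.map (algebraMap ℂ R) * x * (q.map (algebraMap ℂ R) * p.map (algebraMap ℂ R)) * y *
          q.map (algebraMap ℂ R) := by simp only [mul_assoc]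
      _ = _ := by rw [hqp, mul_one]; simp only [mul_assoc]
  have ht : ∑ i, (x' * y') i i = ∑ i, (x * y) i i := by
    rw [hxy]
    rw [Finset.sum_congr rfl fun i _ => (hconj (x * y) i i).symm]
    rw [Finset.sum_comm, Finset.sum_congr rfl fun j _ => Finset.sum_comm]
    refine Finset.sum_congr rfl fun j _ => ?_
    have : ∀ l, ∑ i, (p i j * q l i) • (x * y) j l = (if l = j then 1 else 0 : ℂ) • (x * y) j l := by
      intro l
      rw [← Finset.sum_smul, ← Matrix.one_apply, ← h']
      congr 1
      rw [Matrix.mul_apply]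
      exact Finset.sum_congr rfl fun i _ => mul_comm (p i j) (q l i)
    simp [this]
  simpa only [Matrix.mul_apply] using ht

theorem evenMatrix_conj {ι : Type*} [Fintype ι] (B B' : ι → ι → CForm E 2)
    (p q : Matrix ι ι ℂ) (hB : ∀ i j, B' i j = ∑ k, ∑ l, (p i k * q l j) • B k l) :
    evenMatrix B' = p.map (algebraMap ℂ _) * evenMatrix B * q.map (algebraMap ℂ _) := by
  ext1 i j
  simp only [evenMatrix, Matrix.of_apply, Matrix.mul_apply, hB, map_sum, map_smul, Matrix.map_apply,
    Finset.sum_mul]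
  rw [Finset.sum_comm]
  refine Finset.sum_congr rfl fun l _ => Finset.sum_congr rfl fun k _ => ?_
  rw [Algebra.smul_def, map_mul]
  ring

/-- The top Chern form is invariant under conjugation. -/
theorem topChern_conj {N : ℕ} (B : Fin N → Fin N → CForm E 2) (p q : Matrix (Fin N) (Fin N) ℂ)
    (h : p * q = 1) : topChern (fun i j => ∑ k, ∑ l, (p i k * q l j) • B k l) = topChern B := by
  refine incl_injective _ ?_
  have h1 := evenMatrix_conj B _ p q fun _ _ => rfl
  have h2 := incl_topChern (fun i j => ∑ k, ∑ l, (p i k * q l j) • B k l)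
  rw [h1, det_conj, ← incl_topChern] at h2
  · exact congrArg Subtype.val h2
  · rw [← Matrix.map_mul, h, Matrix.map_one _ (map_zero _) (map_one _)]

theorem pencil_conj {K : Type*} [CommRing K] {ι : Type*} [Fintype ι] [DecidableEq ι]
    (a b p q : Matrix ι ι K) :
    pencil (p * a * q) (p * b * q) = p.map C * pencil a b * q.map C := by
  simp only [pencil, Matrix.map_mul, mul_add, add_mul, Matrix.mul_smul, Matrix.smul_mul]

theorem adjugate_pencil_conj (a b : Matrix (Fin n) (Fin n) (Subalgebra.center ℂ (Forms E)))
    (p q : Matrix (Fin n) (Fin n) ℂ) (h : p * q = 1) (i j : Fin n) :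
    integ ((pencil (p.map (algebraMap ℂ _) * a * q.map (algebraMap ℂ _))
      (p.map (algebraMap ℂ _) * b * q.map (algebraMap ℂ _))).adjugate i j) =
      ∑ k, ∑ l, (p i k * q l j) • integ ((pencil a b).adjugate k l) := by
  have hPQ : (p.map (algebraMap ℂ (Subalgebra.center ℂ (Forms E)))) *
      q.map (algebraMap ℂ (Subalgebra.center ℂ (Forms E))) = 1 := by
    rw [← Matrix.map_mul, h, Matrix.map_one _ (map_zero _) (map_one _)]
  rw [pencil_conj, adjugate_conj]
  · simp only [Matrix.mul_apply, Matrix.map_apply, Finset.sum_mul, map_sum]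
    rw [Finset.sum_comm]
    refine Finset.sum_congr rfl fun k _ => Finset.sum_congr rfl fun l _ => ?_
    rw [mul_right_comm, ← C_mul, integ_C_mul, Algebra.smul_def, map_mul]
  · rw [← Matrix.map_mul, hPQ, Matrix.map_one _ (map_zero _) (map_one _)]

/-- The transgression form does not depend on the frame of the complement of `W_0`. -/
theorem transgressionForm_conj (A A' : Fin (n + 1) → Fin (n + 1) → CForm E 1)
    (B B' : Fin (n + 1) → Fin (n + 1) → CForm E 2) (p q : Matrix (Fin n) (Fin n) ℂ)
    (h : p * q = 1) (h00 : A' 0 0 = A 0 0)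
    (hu : ∀ α : Fin n, A' α.succ 0 = ∑ γ, p α γ • A γ.succ 0)
    (hv : ∀ β : Fin n, A' 0 β.succ = ∑ γ, q γ β • A 0 γ.succ)
    (hw : ∀ α : Fin n, B' α.succ 0 = ∑ γ, p α γ • B γ.succ 0)
    (hB : ∀ α β : Fin n, B' α.succ β.succ = ∑ γ, ∑ δ, (p α γ * q δ β) • B γ.succ δ.succ) :
    transgressionForm A' B' = transgressionForm A B := by
  refine incl_injective _ ?_
  have hPQ : (p.map (algebraMap ℂ (Subalgebra.center ℂ (Forms E)))) *
      q.map (algebraMap ℂ (Subalgebra.center ℂ (Forms E))) = 1 := by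
    rw [← Matrix.map_mul, h, Matrix.map_one _ (map_zero _) (map_one _)]
  have h1 : evenBlock B' = p.map (algebraMap ℂ _) * evenBlock B * q.map (algebraMap ℂ _) :=
    evenMatrix_conj _ _ p q hB
  have h2 : evenOffDiag A' = p.map (algebraMap ℂ _) * evenOffDiag A * q.map (algebraMap ℂ _) := by
    refine evenMatrix_conj _ _ p q fun i j => incl_injective _ ?_
    rw [incl_wedge, hu, hv, map_sum, map_sum, Finset.sum_mul_sum]
    simp only [map_sum, map_smul, smul_mul_smul_comm, incl_wedge]
  have h3 : ∑ α : Fin n, ∑ β : Fin n, mulEven (incl 2 (B' α.succ 0) * incl 1 (A' 0 β.succ))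
        (integ ((pencil (evenBlock B') (evenOffDiag A')).adjugate β α)) =
      ∑ α : Fin n, ∑ β : Fin n, mulEven (incl 2 (B α.succ 0) * incl 1 (A 0 β.succ))
        (integ ((pencil (evenBlock B) (evenOffDiag A)).adjugate β α)) := by
    simp only [mulEven_apply]
    refine sum_conj_mul_conj p q h
      (Matrix.of fun α β => incl 2 (B α.succ 0) * incl 1 (A 0 β.succ))
      (Matrix.of fun β α => ((integ ((pencil (evenBlock B) (evenOffDiag A)).adjugate β α) :
        Subalgebra.center ℂ (Forms E)) : Forms E))
      (Matrix.of fun α β => incl 2 (B' α.succ 0) * incl 1 (A' 0 β.succ))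
      (Matrix.of fun β α => ((integ ((pencil (evenBlock B') (evenOffDiag A')).adjugate β α) :
        Subalgebra.center ℂ (Forms E)) : Forms E)) ?_ ?_
    · intro i j
      simp only [Matrix.of_apply, hw, hv, map_sum, map_smul, Finset.sum_mul_sum,
        smul_mul_smul_comm]
    · intro i j
      simp only [Matrix.of_apply, h1, h2]
      rw [adjugate_pencil_conj _ _ p q h]
      simp only [AddSubmonoidClass.coe_finsetSum, SetLike.val_smul]
  rw [incl_transgressionForm, incl_transgressionForm, h3, h1, h2, h00, ← add_mul,
    ← mul_add, det_conj _ _ _ hPQ]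

end PointwiseBridge


/-! ### Exterior derivatives of wedge products -/

section Leibniz

variable {E : Type*} [NormedAddCommGroup E] [NormedSpace ℂ E]

theorem norm_wedge_le {k l m : ℕ} (φ : CForm E k) (η : CForm E l) (h : k + l = m) :
    ‖wedge φ η h‖ ≤ (m.factorial : ℝ) * ‖φ‖ * ‖η‖ := by
  refine ContinuousAlternatingMap.opNorm_le_bound _ (by positivity) fun v => ?_
  rw [wedge_apply, norm_mul]
  have h1 : ‖((k.factorial : ℂ) * (l.factorial : ℂ))⁻¹‖ ≤ 1 := by
    rw [norm_inv, norm_mul, Complex.norm_natCast, Complex.norm_natCast]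
    refine inv_le_one_of_one_le₀ ?_
    exact_mod_cast Nat.mul_pos k.factorial_pos l.factorial_pos
  have h2 : ‖altSum (fun w : Fin m → E => φ (fun i => w (Fin.cast h (Fin.castAdd l i))) *
      η (fun j => w (Fin.cast h (Fin.natAdd k j)))) v‖ ≤
      (m.factorial : ℝ) * ‖φ‖ * ‖η‖ * ∏ i, ‖v i‖ := by
    unfold altSum
    refine (norm_sum_le _ _).trans ?_
    have : ∀ σ : Equiv.Perm (Fin m), ‖((Equiv.Perm.sign σ : ℤ) : ℂ) *
        (φ (fun i => (v ∘ σ) (Fin.cast h (Fin.castAdd l i))) *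
          η (fun j => (v ∘ σ) (Fin.cast h (Fin.natAdd k j))))‖ ≤ ‖φ‖ * ‖η‖ * ∏ i, ‖v i‖ := by
      intro σ
      have hs : ‖((Equiv.Perm.sign σ : ℤ) : ℂ)‖ = 1 := by
        rcases Int.units_eq_one_or (Equiv.Perm.sign σ) with h | h <;> simp [h]
      rw [norm_mul, hs, one_mul, norm_mul]
      refine (mul_le_mul (φ.le_opNorm _) (η.le_opNorm _) (norm_nonneg _) (by positivity)).trans ?_
      refine le_of_eq ?_
      have h3 : ∏ i, ‖v i‖ = (∏ i : Fin k, ‖(v ∘ σ) (Fin.cast h (Fin.castAdd l i))‖) *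
          ∏ j : Fin l, ‖(v ∘ σ) (Fin.cast h (Fin.natAdd k j))‖ := by
        rw [← Equiv.prod_comp σ, ← Equiv.prod_comp (finCongr h), Fin.prod_univ_add]
        rfl
      rw [h3]; ring
    refine (Finset.sum_le_sum fun σ _ => this σ).trans (le_of_eq ?_)
    rw [Finset.sum_const, Finset.card_univ, Fintype.card_perm, Fintype.card_fin, nsmul_eq_mul]
    ring
  calc _ ≤ 1 * ((m.factorial : ℝ) * ‖φ‖ * ‖η‖ * ∏ i, ‖v i‖) :=
        mul_le_mul h1 h2 (norm_nonneg _) zero_le_one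
    _ = _ := one_mul _

/-- The wedge product as a continuous bilinear map. -/
def wedgeCLM {k l m : ℕ} (h : k + l = m) : CForm E k →L[ℝ] CForm E l →L[ℝ] CForm E m :=
  LinearMap.mkContinuous₂
    (LinearMap.mk₂ ℝ (fun φ η => wedge φ η h) (fun φ φ' η => wedge_add_left φ φ' η h)
      (fun c φ η => wedge_smul_left (c : ℂ) φ η h)
      (fun φ η η' => wedge_add_right φ η η' h)
      (fun c φ η => wedge_smul_right (c : ℂ) φ η h))
    (m.factorial : ℝ) fun φ η => norm_wedge_le φ η h

theorem wedgeCLM_apply {k l m : ℕ} (h : k + l = m) (φ : CForm E k) (η : CForm E l) :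
    wedgeCLM h φ η = wedge φ η h := rfl

variable {F : Type*} [NormedAddCommGroup F] [NormedSpace ℝ F] {s : Set F} {r : WithTop ℕ∞}

theorem contDiffOn_wedge {k l m : ℕ} {φ : F → CForm E k} {η : F → CForm E l} (h : k + l = m)
    (hφ : ContDiffOn ℝ r φ s) (hη : ContDiffOn ℝ r η s) :
    ContDiffOn ℝ r (fun y => wedge (φ y) (η y) h) s := by
  have h1 : ContDiff ℝ r (wedgeCLM (E := E) h) := by fun_prop
  exact (h1.comp_contDiffOn hφ).clm_apply hη

theorem contDiffOn_wedgeProd (m : ℕ) {φ : F → Fin m → CForm E 2}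
    (hφ : ∀ i, ContDiffOn ℝ r (fun y => φ y i) s) :
    ContDiffOn ℝ r (fun y => wedgeProd m (φ y)) s := by
  induction m with
  | zero => exact contDiffOn_const
  | succ m ih => exact contDiffOn_wedge _ (ih fun i => hφ i.castSucc) (hφ (Fin.last m))

section

variable {n : ℕ} {A : Fin (n + 1) → Fin (n + 1) → F → CForm E 1}
  {B : F → Fin (n + 1) → Fin (n + 1) → CForm E 2}

theorem contDiffOn_Phi0 (hA : ∀ i j, ContDiffOn ℝ r (A i j) s)
    (hB : ∀ i j, ContDiffOn ℝ r (fun y => B y i j) s) (k : ℕ) :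
    ContDiffOn ℝ r (fun y => Phi0 (fun i j => A i j y) (B y) k) s := by
  unfold Phi0
  refine ContDiffOn.sum fun σ _ => ContDiffOn.sum fun τ _ => ContDiffOn.const_smul _ ?_
  refine contDiffOn_wedge _ (hA 0 0) (contDiffOn_wedgeProd _ fun i => ?_)
  split_ifs
  · exact hB _ _
  · exact contDiffOn_wedge _ (hA _ _) (hA _ _)

theorem contDiffOn_Phi1 (hA : ∀ i j, ContDiffOn ℝ r (A i j) s)
    (hB : ∀ i j, ContDiffOn ℝ r (fun y => B y i j) s) (k : ℕ) :
    ContDiffOn ℝ r (fun y => Phi1 (fun i j => A i j y) (B y) k) s := by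
  cases n with
  | zero => exact contDiffOn_const
  | succ m =>
    simp only [Phi1]
    split_ifs
    · refine ContDiffOn.sum fun σ _ => ContDiffOn.sum fun τ _ => ContDiffOn.const_smul _ ?_
      refine contDiffOn_wedge _ (contDiffOn_wedge _ (hB _ _) (hA _ _))
        (contDiffOn_wedgeProd _ fun i => ?_)
      split_ifs
      · exact hB _ _
      · exact contDiffOn_wedge _ (hA _ _) (hA _ _)
    · exact contDiffOn_const

theorem contDiffOn_transgressionForm (hA : ∀ i j, ContDiffOn ℝ r (A i j) s)
    (hB : ∀ i j, ContDiffOn ℝ r (fun y => B y i j) s) :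
    ContDiffOn ℝ r (fun y => transgressionForm (fun i j => A i j y) (B y)) s := by
  unfold transgressionForm
  exact ContDiffOn.const_smul _ (ContDiffOn.sum fun k _ => ContDiffOn.const_smul _
    ((contDiffOn_Phi0 hA hB k).sub (contDiffOn_Phi1 hA hB k)))

end

variable [FiniteDimensional ℂ E] {T : Set E} {y : E}

/-- In coordinates, `dφ = ∑ dx^j ∧ ∂_j φ`. -/
theorem incl_extDerivWithin {k : ℕ} (φ : E → CForm E k) (T : Set E) (y : E) :
    letI := FiniteDimensional.complexToReal E
    incl (k + 1) (extDerivWithin φ T y) =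
      ∑ j, incl 1 (oneForm (Complex.ofRealCLM.comp (LinearMap.toContinuousLinearMap
        ((Module.finBasis ℝ E).coord j)))) *
          incl k (fderivWithin ℝ φ T y (Module.finBasis ℝ E j)) := by
  let := FiniteDimensional.complexToReal E
  have h1 : fderivWithin ℝ φ T y = ∑ j, (LinearMap.toContinuousLinearMap
      ((Module.finBasis ℝ E).coord j)).smulRight
        (fderivWithin ℝ φ T y (Module.finBasis ℝ E j)) := by
    ext1 v
    conv_lhs => rw [← (Module.finBasis ℝ E).sum_repr v]
    rw [map_sum]
    simp only [map_smul, sum_apply]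
    rfl
  rw [extDerivWithin, ← ContinuousAlternatingMap.alternatizeUncurryFinCLM_apply]
  conv_lhs => rw [h1]
  rw [map_sum, map_sum]
  refine Finset.sum_congr rfl fun j _ => ?_
  rw [ContinuousAlternatingMap.alternatizeUncurryFinCLM_apply,
    alternatizeUncurryFin_smulRight (Complex.ofRealCLM.comp (LinearMap.toContinuousLinearMap
        ((Module.finBasis ℝ E).coord j))) (fderivWithin ℝ φ T y (Module.finBasis ℝ E j))
        (add_comm 1 k), incl_wedge]
  intro v
  rfl

theorem incl_extDerivWithin_wedge {k l m : ℕ} {φ : E → CForm E k} {η : E → CForm E l}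
    (h : k + l = m) (hT : UniqueDiffWithinAt ℝ T y) (hφ : DifferentiableWithinAt ℝ φ T y)
    (hη : DifferentiableWithinAt ℝ η T y) :
    incl (m + 1) (extDerivWithin (fun y => wedge (φ y) (η y) h) T y) =
      incl (k + 1) (extDerivWithin φ T y) * incl l (η y) +
        (-1 : ℂ) ^ k • (incl k (φ y) * incl (l + 1) (extDerivWithin η T y)) := by
  let := FiniteDimensional.complexToReal E
  have hd : ∀ v, fderivWithin ℝ (fun y => wedge (φ y) (η y) h) T y v =
      wedge (fderivWithin ℝ φ T y v) (η y) h + wedge (φ y) (fderivWithin ℝ η T y v) h := by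
    intro v
    have := ((wedgeCLM h).hasFDerivWithinAt_of_bilinear hφ.hasFDerivWithinAt
      hη.hasFDerivWithinAt).fderivWithin hT
    have h2 := DFunLike.congr_fun this v
    simp only [wedgeCLM_apply] at h2
    rw [h2, add_comm]
    rfl
  rw [incl_extDerivWithin, incl_extDerivWithin, incl_extDerivWithin]
  simp only [hd, map_add, mul_add, incl_wedge, Finset.sum_add_distrib, Finset.sum_mul,
    Finset.mul_sum, Finset.smul_sum, mul_assoc]
  congr 1
  refine Finset.sum_congr rfl fun j _ => ?_
  rw [← mul_assoc, ← mul_assoc, incl_mul_comm, smul_mul_assoc]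
  congr 1
  rw [Nat.add_sub_cancel_left]
  rcases k.even_or_odd with hk | hk
  · rw [(hk.mul_left k).neg_one_pow, hk.neg_one_pow]
  · rw [(hk.mul hk).neg_one_pow, hk.neg_one_pow]

end Leibniz


/-! ### The exterior derivative of the transgression form -/

section DTransgression

open Polynomial

variable {E : Type*} [NormedAddCommGroup E] [NormedSpace ℂ E]
  {T : Set E} {y : E} {n : ℕ}

/-- An even form together with its exterior derivative at a point. -/
def formJet {k : ℕ} (hk : Even k) (T : Set E) (φ : E → CForm E k) (y : E) : Jet (Forms E) :=
  mkJet (inclCenter hk (φ y)) (incl (k + 1) (extDerivWithin φ T y))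

theorem differentiableWithinAt_wedge {k l m : ℕ} {φ : E → CForm E k} {η : E → CForm E l}
    (h : k + l = m) (hφ : DifferentiableWithinAt ℝ φ T y)
    (hη : DifferentiableWithinAt ℝ η T y) :
    DifferentiableWithinAt ℝ (fun y => wedge (φ y) (η y) h) T y :=
  ((wedgeCLM (E := E) h).hasFDerivWithinAt_of_bilinear hφ.hasFDerivWithinAt
    hη.hasFDerivWithinAt).differentiableWithinAt

theorem differentiableWithinAt_wedgeProd (m : ℕ) {φ : E → Fin m → CForm E 2}
    (hφ : ∀ i, DifferentiableWithinAt ℝ (fun y => φ y i) T y) :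
    DifferentiableWithinAt ℝ (fun y => wedgeProd m (φ y)) T y := by
  induction m with
  | zero => exact differentiableWithinAt_const _
  | succ m ih =>
    exact differentiableWithinAt_wedge _ (ih fun i => hφ i.castSucc) (hφ (Fin.last m))

theorem extDerivWithin_sum {k : ℕ} {ι : Type*} (S : Finset ι) {φ : ι → E → CForm E k}
    (hT : UniqueDiffWithinAt ℝ T y) (hφ : ∀ i ∈ S, DifferentiableWithinAt ℝ (φ i) T y) :
    extDerivWithin (fun y => ∑ i ∈ S, φ i y) T y = ∑ i ∈ S, extDerivWithin (φ i) T y := by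
  simp only [extDerivWithin]
  rw [fderivWithin_fun_sum hT hφ]
  exact map_sum (ContinuousAlternatingMap.alternatizeUncurryFinCLM ℝ E ℂ) _ _

theorem extDerivWithin_const_smul_complex {k : ℕ} (c : ℂ) (φ : E → CForm E k)
    (hT : UniqueDiffWithinAt ℝ T y) (hφ : DifferentiableWithinAt ℝ φ T y) :
    extDerivWithin (fun y => c • φ y) T y = c • extDerivWithin φ T y := by
  simp only [extDerivWithin]
  rw [fderivWithin_fun_const_smul hT hφ c]
  ext v
  simp [ContinuousAlternatingMap.alternatizeUncurryFin_apply, Finset.mul_sum]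

theorem extDerivWithin_sub {k : ℕ} {φ η : E → CForm E k}
    (hT : UniqueDiffWithinAt ℝ T y) (hφ : DifferentiableWithinAt ℝ φ T y)
    (hη : DifferentiableWithinAt ℝ η T y) :
    extDerivWithin (fun y => φ y - η y) T y = extDerivWithin φ T y - extDerivWithin η T y := by
  simp only [extDerivWithin]
  rw [fderivWithin_fun_sub hT hφ hη]
  exact map_sub (ContinuousAlternatingMap.alternatizeUncurryFinCLM ℝ E ℂ) _ _

/-- The curvature forms `dA_i^j - A_i^k ∧ A_k^j` of a matrix of one-forms. -/
def curvatureForm {ι : Type*} [Fintype ι] (T : Set E) (A : ι → ι → E → CForm E 1) (y : E)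
    (i j : ι) : CForm E 2 :=
  extDerivWithin (A i j) T y - ∑ k, wedge (A i k y) (A k j y)

theorem contDiffOn_curvatureForm {ι : Type*} [Fintype ι] {A : ι → ι → E → CForm E 1}
    (hA : ∀ i j, ContDiffOn ℝ ∞ (A i j) T) (hT : UniqueDiffOn ℝ T) (i j : ι) :
    ContDiffOn ℝ ∞ (fun y => curvatureForm T A y i j) T := by
  unfold curvatureForm
  refine ContDiffOn.sub ?_ (ContDiffOn.sum fun k _ => contDiffOn_wedge _ (hA _ _) (hA _ _))
  have h1 : ContDiffOn ℝ ∞ (fderivWithin ℝ (A i j) T) T := (hA i j).fderivWithin hT (by simp)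
  have h2 : ContDiff ℝ ∞ (ContinuousAlternatingMap.alternatizeUncurryFinCLM ℝ E ℂ (n := 1)) := by
    fun_prop
  exact h2.comp_contDiffOn h1

variable [FiniteDimensional ℂ E]

theorem incl_extDerivWithin_wedge_even {k l m : ℕ} (hk : Even k) {φ : E → CForm E k}
    {η : E → CForm E l} (h : k + l = m) (hT : UniqueDiffWithinAt ℝ T y)
    (hφ : DifferentiableWithinAt ℝ φ T y) (hη : DifferentiableWithinAt ℝ η T y) :
    incl (m + 1) (extDerivWithin (fun y => wedge (φ y) (η y) h) T y) =
      incl (k + 1) (extDerivWithin φ T y) * incl l (η y) +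
        incl k (φ y) * incl (l + 1) (extDerivWithin η T y) := by
  rw [incl_extDerivWithin_wedge h hT hφ hη, hk.neg_one_pow, one_smul]

theorem incl_extDerivWithin_wedge_odd {k l m : ℕ} (hk : Odd k) {φ : E → CForm E k}
    {η : E → CForm E l} (h : k + l = m) (hT : UniqueDiffWithinAt ℝ T y)
    (hφ : DifferentiableWithinAt ℝ φ T y) (hη : DifferentiableWithinAt ℝ η T y) :
    incl (m + 1) (extDerivWithin (fun y => wedge (φ y) (η y) h) T y) =
      incl (k + 1) (extDerivWithin φ T y) * incl l (η y) -
        incl k (φ y) * incl (l + 1) (extDerivWithin η T y) := by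
  rw [incl_extDerivWithin_wedge h hT hφ hη, hk.neg_one_pow, neg_smul, one_smul, sub_eq_add_neg]

theorem formJet_wedge {k l m : ℕ} (hk : Even k) (hl : Even l) (hm : Even m) {φ : E → CForm E k}
    {η : E → CForm E l} (h : k + l = m) (hT : UniqueDiffWithinAt ℝ T y)
    (hφ : DifferentiableWithinAt ℝ φ T y) (hη : DifferentiableWithinAt ℝ η T y) :
    formJet hm T (fun y => wedge (φ y) (η y) h) y = formJet hk T φ y * formJet hl T η y := by
  refine TrivSqZeroExt.ext ?_ ?_
  · rw [TrivSqZeroExt.fst_mul]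
    simp only [formJet, fst_mkJet]
    exact Subtype.ext (incl_wedge _ _ h)
  · rw [snd_mul_jet]
    simp only [formJet, fst_mkJet, snd_mkJet, coe_inclCenter]
    rw [incl_extDerivWithin_wedge_even hk h hT hφ hη, incl_commute hl, add_comm]

theorem formJet_wedgeProd (m : ℕ) {φ : E → Fin m → CForm E 2} (hT : UniqueDiffWithinAt ℝ T y)
    (hφ : ∀ i, DifferentiableWithinAt ℝ (fun y => φ y i) T y) :
    formJet (even_two_mul m) T (fun y => wedgeProd m (φ y)) y =
      ∏ i, formJet even_two T (fun y => φ y i) y := by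
  induction m with
  | zero =>
    refine TrivSqZeroExt.ext ?_ ?_
    · rw [Finset.univ_eq_empty, Finset.prod_empty, TrivSqZeroExt.fst_one, formJet, fst_mkJet]
      exact Subtype.ext incl_one
    · rw [Finset.univ_eq_empty, Finset.prod_empty, TrivSqZeroExt.snd_one, formJet, snd_mkJet]
      have : extDerivWithin (fun y => wedgeProd 0 (φ y)) T y = 0 := by
        simp only [wedgeProd, extDerivWithin]
        rw [fderivWithin_fun_const]
        exact map_zero (ContinuousAlternatingMap.alternatizeUncurryFinCLM ℝ E ℂ)
      rw [this, map_zero]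
  | succ m ih =>
    rw [Fin.prod_univ_castSucc, ← ih fun i => hφ i.castSucc]
    exact formJet_wedge _ _ _ _ hT (differentiableWithinAt_wedgeProd _ fun i => hφ i.castSucc)
      (hφ (Fin.last m))

/-- The functional `x ↦ d(c x)` on jets of even forms, for a form `c` of odd degree with exterior
derivative `dc`. -/
def oddLeibniz {R : Type*} [Ring R] [Algebra ℂ R] (c dc : R) : Jet R →ₗ[ℂ] R where
  toFun x := dc * (x.fst : R) - c * x.snd
  map_add' x y := by simp [mul_add]; abel
  map_smul' a x := by simp [smul_sub]

theorem oddLeibniz_apply {R : Type*} [Ring R] [Algebra ℂ R] (c dc : R) (x : Jet R) :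
    oddLeibniz c dc x = dc * (x.fst : R) - c * x.snd := rfl

theorem incl_extDerivWithin_wedge_oddLeibniz {k l m : ℕ} (hk : Odd k) (hl : Even l)
    {φ : E → CForm E k} {η : E → CForm E l} (h : k + l = m) (hT : UniqueDiffWithinAt ℝ T y)
    (hφ : DifferentiableWithinAt ℝ φ T y) (hη : DifferentiableWithinAt ℝ η T y) :
    incl (m + 1) (extDerivWithin (fun y => wedge (φ y) (η y) h) T y) =
      oddLeibniz (incl k (φ y)) (incl (k + 1) (extDerivWithin φ T y)) (formJet hl T η y) := by
  rw [incl_extDerivWithin_wedge_odd hk h hT hφ hη]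
  simp only [oddLeibniz_apply, formJet, fst_mkJet, snd_mkJet, coe_inclCenter]

variable {A : Fin (n + 1) → Fin (n + 1) → E → CForm E 1}

/-- The exterior derivatives of the connection forms at a point. -/
def dConn (T : Set E) (A : Fin (n + 1) → Fin (n + 1) → E → CForm E 1) (y : E)
    (i j : Fin (n + 1)) : Subalgebra.center ℂ (Forms E) :=
  inclCenter even_two (extDerivWithin (A i j) T y)

theorem formJet_curvatureForm (hA : ∀ i j, ContDiffOn ℝ ∞ (A i j) T) (hT : UniqueDiffOn ℝ T)
    (hy : y ∈ T) (hy' : y ∈ closure (interior T)) (i j : Fin (n + 1)) :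
    formJet even_two T (fun y => curvatureForm T A y i j) y =
      jetCurv (isOddMatrix_incl fun i j => A i j y) (dConn T A y) i j := by
  have hAd : ∀ i j, DifferentiableWithinAt ℝ (A i j) T y := fun i j =>
    ((hA i j).differentiableOn (by simp)) y hy
  refine TrivSqZeroExt.ext ?_ ?_
  · simp only [formJet, jetCurv, Matrix.of_apply, fst_mkJet]
    refine Subtype.ext ?_
    rw [coe_curv, coe_inclCenter, curvatureForm, map_sub, map_sum]
    simp only [incl_wedge]
    rfl
  · simp only [formJet, jetCurv, Matrix.of_apply, snd_mkJet]
    have h1 : ContDiffOn ℝ ∞ (extDerivWithin (A i j) T) T := by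
      have h1 : ContDiffOn ℝ ∞ (fderivWithin ℝ (A i j) T) T := (hA i j).fderivWithin hT (by simp)
      have h2 : ContDiff ℝ ∞ (ContinuousAlternatingMap.alternatizeUncurryFinCLM ℝ E ℂ (n := 1)) := by
        fun_prop
      exact h2.comp_contDiffOn h1
    have hw : ∀ k, DifferentiableWithinAt ℝ (fun y => wedge (m := 2) (A i k y) (A k j y)) T y :=
      fun k => differentiableWithinAt_wedge _ (hAd _ _) (hAd _ _)
    simp only [curvatureForm]
    rw [extDerivWithin_sub (hT y hy) (h1.differentiableOn (by simp) y hy)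
      (DifferentiableWithinAt.fun_sum fun k _ => hw k),
      extDerivWithin_sum _ (hT y hy) fun k _ => hw k,
      extDerivWithin_extDerivWithin_apply ((hA i j) y hy)
        (by rw [minSmoothness_of_isRCLikeNormedField]; exact WithTop.coe_le_coe.mpr le_top) hT hy' hy, zero_sub, map_neg,
      map_sum, dCurv]
    congr 1
    refine Finset.sum_congr rfl fun k _ => ?_
    rw [incl_extDerivWithin_wedge_odd odd_one _ (hT y hy) (hAd _ _) (hAd _ _)]
    rfl

theorem formJet_offDiag (hA : ∀ i j, DifferentiableWithinAt ℝ (A i j) T y)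
    (hT : UniqueDiffWithinAt ℝ T y) (α β : Fin n) :
    formJet even_two T (fun y => wedge (A α.succ 0 y) (A 0 β.succ y)) y =
      jetOffDiag (isOddMatrix_incl fun i j => A i j y) (dConn T A y) α β := by
  refine TrivSqZeroExt.ext ?_ ?_
  · simp only [formJet, jetOffDiag, Matrix.of_apply, fst_mkJet]
    exact Subtype.ext (incl_wedge _ _ _)
  · simp only [formJet, jetOffDiag, Matrix.of_apply, snd_mkJet]
    rw [incl_extDerivWithin_wedge_odd odd_one _ hT (hA _ _) (hA _ _)]
    rfl

theorem incl_extDerivWithin_Phi0 (hA : ∀ i j, ContDiffOn ℝ ∞ (A i j) T)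
    (hT : UniqueDiffOn ℝ T) (hy : y ∈ T) (hy' : y ∈ closure (interior T)) (k : ℕ) :
    incl (2 * n + 2)
      (extDerivWithin (fun y => Phi0 (fun i j => A i j y) (curvatureForm T A y) k) T y) =
      oddLeibniz (incl 1 (A 0 0 y)) (dConn T A y 0 0 : Forms E)
        (polarDet (jetBlock (isOddMatrix_incl fun i j => A i j y) (dConn T A y))
          (jetOffDiag (isOddMatrix_incl fun i j => A i j y) (dConn T A y)) k) := by
  have hAd : ∀ i j, DifferentiableWithinAt ℝ (A i j) T y := fun i j =>
    ((hA i j).differentiableOn (by simp)) y hy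
  have hBd : ∀ i j, DifferentiableWithinAt ℝ (fun y => curvatureForm T A y i j) T y := fun i j =>
    ((contDiffOn_curvatureForm hA hT i j).differentiableOn (by simp)) y hy
  have hTy := hT y hy
  have hF : ∀ σ τ : Equiv.Perm (Fin n), ∀ i : Fin n, DifferentiableWithinAt ℝ (fun y =>
      if (i : ℕ) < k then curvatureForm T A y (σ i).succ (τ i).succ
        else wedge (A (σ i).succ 0 y) (A 0 (τ i).succ y)) T y := by
    intro σ τ i
    split_ifs
    · exact hBd _ _
    · exact differentiableWithinAt_wedge _ (hAd _ _) (hAd _ _)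
  have hG : ∀ σ τ : Equiv.Perm (Fin n), DifferentiableWithinAt ℝ (fun y =>
      wedge (m := 2 * n + 1) (A 0 0 y) (wedgeProd n fun i =>
        if (i : ℕ) < k then curvatureForm T A y (σ i).succ (τ i).succ
        else wedge (A (σ i).succ 0 y) (A 0 (τ i).succ y))) T y := fun σ τ =>
    differentiableWithinAt_wedge _ (hAd _ _) (differentiableWithinAt_wedgeProd _ (hF σ τ))
  simp only [Phi0]
  rw [extDerivWithin_sum _ hTy fun σ _ => DifferentiableWithinAt.fun_sum fun τ _ =>
    (hG σ τ).fun_const_smul _, map_sum, polarDet, map_sum]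
  refine Finset.sum_congr rfl fun σ _ => ?_
  rw [extDerivWithin_sum _ hTy fun τ _ => (hG σ τ).fun_const_smul _, map_sum, map_sum]
  refine Finset.sum_congr rfl fun τ _ => ?_
  rw [extDerivWithin_const_smul_complex _ _ hTy (hG σ τ), map_smul, map_smul,
    incl_extDerivWithin_wedge_oddLeibniz odd_one (even_two_mul n) _ hTy (hAd _ _)
      (differentiableWithinAt_wedgeProd _ (hF σ τ)), formJet_wedgeProd _ hTy (hF σ τ)]
  congr 1
  refine congrArg _ (Finset.prod_congr rfl fun i _ => ?_)
  split_ifs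
  · exact formJet_curvatureForm hA hT hy hy' _ _
  · exact formJet_offDiag hAd hTy _ _

theorem incl_sum_extDerivWithin_Phi1 (hA : ∀ i j, ContDiffOn ℝ ∞ (A i j) T)
    (hT : UniqueDiffOn ℝ T) (hy : y ∈ T) (hy' : y ∈ closure (interior T)) :
    ∑ k ∈ Finset.range (n + 1), (n.choose k : ℂ) • incl (2 * n + 2)
      (extDerivWithin (fun y => Phi1 (fun i j => A i j y) (curvatureForm T A y) k) T y) =
      (n.factorial : ℂ) • ∑ α : Fin n, ∑ β : Fin n,
        oddLeibniz (incl 3 (wedge (curvatureForm T A y α.succ 0) (A 0 β.succ y)))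
          (incl 4 (extDerivWithin
            (fun y => wedge (m := 3) (curvatureForm T A y α.succ 0) (A 0 β.succ y)) T y))
          (integ ((pencil (jetBlock (isOddMatrix_incl fun i j => A i j y) (dConn T A y))
            (jetOffDiag (isOddMatrix_incl fun i j => A i j y) (dConn T A y))).adjugate β α)) := by
  have hAd : ∀ i j, DifferentiableWithinAt ℝ (A i j) T y := fun i j =>
    ((hA i j).differentiableOn (by simp)) y hy
  have hBd : ∀ i j, DifferentiableWithinAt ℝ (fun y => curvatureForm T A y i j) T y := fun i j =>
    ((contDiffOn_curvatureForm hA hT i j).differentiableOn (by simp)) y hy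
  have hTy := hT y hy
  have h0 : ∀ k, extDerivWithin (fun _ : E => (0 : CForm E k)) T y = 0 := by
    intro k
    simp only [extDerivWithin]
    rw [fderivWithin_fun_const]
    exact map_zero (ContinuousAlternatingMap.alternatizeUncurryFinCLM ℝ E ℂ)
  cases n with
  | zero => simp [Phi1, h0]
  | succ m =>
    have hF : ∀ k : ℕ, ∀ σ τ : Equiv.Perm (Fin (m + 1)), ∀ i : Fin m,
        DifferentiableWithinAt ℝ (fun y => if (i : ℕ) < k then
          curvatureForm T A y (σ i.succ).succ (τ i.succ).succ
          else wedge (A (σ i.succ).succ 0 y) (A 0 (τ i.succ).succ y)) T y := by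
      intro k σ τ i
      split_ifs
      · exact hBd _ _
      · exact differentiableWithinAt_wedge _ (hAd _ _) (hAd _ _)
    have hc : ∀ α β : Fin (m + 1), DifferentiableWithinAt ℝ
        (fun y => wedge (m := 3) (curvatureForm T A y α.succ 0) (A 0 β.succ y)) T y := fun α β =>
      differentiableWithinAt_wedge _ (hBd _ _) (hAd _ _)
    have hG : ∀ k : ℕ, ∀ σ τ : Equiv.Perm (Fin (m + 1)), DifferentiableWithinAt ℝ (fun y =>
        wedge (m := 2 * (m + 1) + 1)
          (wedge (m := 3) (curvatureForm T A y (σ 0).succ 0) (A 0 (τ 0).succ y))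
          (wedgeProd m fun i => if (i : ℕ) < k then
            curvatureForm T A y (σ i.succ).succ (τ i.succ).succ
            else wedge (A (σ i.succ).succ 0 y) (A 0 (τ i.succ).succ y))) T y := fun k σ τ =>
      differentiableWithinAt_wedge _ (hc _ _) (differentiableWithinAt_wedgeProd _ (hF k σ τ))
    rw [← sum_choose_polar_cofactor]
    refine Finset.sum_congr rfl fun k _ => ?_
    congr 1
    simp only [Phi1]
    split_ifs with hk
    · rw [extDerivWithin_sum _ hTy fun σ _ => DifferentiableWithinAt.fun_sum fun τ _ =>
        (hG k σ τ).fun_const_smul _, map_sum]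
      refine Finset.sum_congr rfl fun σ _ => ?_
      rw [extDerivWithin_sum _ hTy fun τ _ => (hG k σ τ).fun_const_smul _, map_sum]
      refine Finset.sum_congr rfl fun τ _ => ?_
      rw [extDerivWithin_const_smul_complex _ _ hTy (hG k σ τ), map_smul,
        incl_extDerivWithin_wedge_oddLeibniz (by decide) (even_two_mul m) _ hTy (hc _ _)
          (differentiableWithinAt_wedgeProd _ (hF k σ τ)), formJet_wedgeProd _ hTy (hF k σ τ)]
      congr 1
      refine congrArg _ (Finset.prod_congr rfl fun i _ => ?_)
      split_ifs
      · exact formJet_curvatureForm hA hT hy hy' _ _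
      · exact formJet_offDiag hAd hTy _ _
    · rw [h0, map_zero]

theorem sum_oddLeibniz_integ (hA : ∀ i j, ContDiffOn ℝ ∞ (A i j) T)
    (hT : UniqueDiffOn ℝ T) (hy : y ∈ T) (hy' : y ∈ closure (interior T)) :
    ∑ α : Fin n, ∑ β : Fin n,
        oddLeibniz (incl 3 (wedge (curvatureForm T A y α.succ 0) (A 0 β.succ y)))
          (incl 4 (extDerivWithin
            (fun y => wedge (m := 3) (curvatureForm T A y α.succ 0) (A 0 β.succ y)) T y))
          (integ ((pencil (jetBlock (isOddMatrix_incl fun i j => A i j y) (dConn T A y))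
            (jetOffDiag (isOddMatrix_incl fun i j => A i j y) (dConn T A y))).adjugate β α)) =
      ∑ β : Fin n, ((dConn T A y 0 β.succ : Forms E) *
          ((integ (cofactorPoly (isOddMatrix_incl fun i j => A i j y) (dConn T A y) β)).fst :
            Forms E) - incl 1 (A 0 β.succ y) *
          (integ (cofactorPoly (isOddMatrix_incl fun i j => A i j y) (dConn T A y) β)).snd) := by
  have hAd : ∀ i j, DifferentiableWithinAt ℝ (A i j) T y := fun i j =>
    ((hA i j).differentiableOn (by simp)) y hy
  have hBd : ∀ i j, DifferentiableWithinAt ℝ (fun y => curvatureForm T A y i j) T y := fun i j =>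
    ((contDiffOn_curvatureForm hA hT i j).differentiableOn (by simp)) y hy
  have hTy := hT y hy
  rw [Finset.sum_comm]
  refine Finset.sum_congr rfl fun β _ => ?_
  rw [cofactorPoly, map_sum, TrivSqZeroExt.fst_sum, TrivSqZeroExt.snd_sum,
    AddSubmonoidClass.coe_finsetSum, Finset.mul_sum, Finset.mul_sum, ← Finset.sum_sub_distrib]
  refine Finset.sum_congr rfl fun α _ => ?_
  rw [integ_C_mul, TrivSqZeroExt.fst_mul, snd_mul_jet, oddLeibniz_apply, incl_wedge,
    incl_extDerivWithin_wedge_even even_two _ hTy (hBd _ _) (hAd _ _),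
    ← formJet_curvatureForm hA hT hy hy']
  set x := integ ((pencil (jetBlock (isOddMatrix_incl fun i j => A i j y) (dConn T A y))
            (jetOffDiag (isOddMatrix_incl fun i j => A i j y) (dConn T A y))).adjugate β α)
  simp only [formJet, fst_mkJet, snd_mkJet, coe_inclCenter]
  have e1 := incl_anticommute (E := E) (k := 3) (l := 1) (by decide) odd_one
    (extDerivWithin (fun y => curvatureForm T A y α.succ 0) T y) (A 0 β.succ y)
  rw [e1]
  have e2 := incl_commute (E := E) even_two (curvatureForm T A y α.succ 0)
  rw [e2, e2 (incl 1 (A 0 β.succ y))]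
  have e3 : ∀ z : Forms E, (x.fst : Forms E) * z = z * (x.fst : Forms E) := fun z =>
    (center_comm _ z).symm
  have e4 : ((inclCenter even_two (curvatureForm T A y α.succ 0) * x.fst :
      Subalgebra.center ℂ (Forms E)) : Forms E) =
      incl 2 (curvatureForm T A y α.succ 0) * (x.fst : Forms E) := rfl
  have e5 : (dConn T A y 0 β.succ : Forms E) = incl 2 (extDerivWithin (A 0 β.succ) T y) := rfl
  rw [e3, e4, e5]
  simp only [Nat.reduceAdd]
  noncomm_ring

/-- The transgression formula for forms: the exterior derivative of the transgression form is the
top Chern form. -/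
theorem extDerivWithin_transgressionForm (hA : ∀ i j, ContDiffOn ℝ ∞ (A i j) T)
    (hT : UniqueDiffOn ℝ T) (hy : y ∈ T) (hy' : y ∈ closure (interior T)) :
    extDerivWithin (fun y => transgressionForm (fun i j => A i j y) (curvatureForm T A y)) T y =
      topChern (curvatureForm T A y) := by
  have hTy := hT y hy
  have hB := contDiffOn_curvatureForm hA hT
  have hP0 : ∀ k, DifferentiableWithinAt ℝ
      (fun y => Phi0 (fun i j => A i j y) (curvatureForm T A y) k) T y := fun k =>
    (contDiffOn_Phi0 hA hB k).differentiableOn (by simp) y hy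
  have hP1 : ∀ k, DifferentiableWithinAt ℝ
      (fun y => Phi1 (fun i j => A i j y) (curvatureForm T A y) k) T y := fun k =>
    (contDiffOn_Phi1 hA hB k).differentiableOn (by simp) y hy
  refine incl_injective _ ?_
  simp only [transgressionForm]
  rw [extDerivWithin_const_smul_complex _ _ hTy (DifferentiableWithinAt.fun_sum fun k _ =>
      ((hP0 k).fun_sub (hP1 k)).fun_const_smul _),
    extDerivWithin_sum _ hTy fun k _ => ((hP0 k).fun_sub (hP1 k)).fun_const_smul _]
  have h1 : ∀ k, extDerivWithin (fun y => (n.choose k : ℂ) •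
      (Phi0 (fun i j => A i j y) (curvatureForm T A y) k -
        Phi1 (fun i j => A i j y) (curvatureForm T A y) k)) T y =
      (n.choose k : ℂ) • extDerivWithin
        (fun y => Phi0 (fun i j => A i j y) (curvatureForm T A y) k) T y -
      (n.choose k : ℂ) • extDerivWithin
        (fun y => Phi1 (fun i j => A i j y) (curvatureForm T A y) k) T y := by
    intro k
    rw [extDerivWithin_const_smul_complex _ _ hTy ((hP0 k).fun_sub (hP1 k)),
      extDerivWithin_sub hTy (hP0 k) (hP1 k), smul_sub]
  have h2 := congrArg (oddLeibniz (incl 1 (A 0 0 y)) (dConn T A y 0 0 : Forms E))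
    (sum_choose_polarDet (jetBlock (isOddMatrix_incl fun i j => A i j y) (dConn T A y))
      (jetOffDiag (isOddMatrix_incl fun i j => A i j y) (dConn T A y)))
  simp only [map_sum, map_smul] at h2
  rw [Finset.sum_congr rfl fun k _ => h1 k, Finset.sum_sub_distrib, map_smul, map_sub, map_sum,
    map_sum]
  simp only [map_smul, incl_extDerivWithin_Phi0 hA hT hy hy']
  rw [h2, incl_sum_extDerivWithin_Phi1 hA hT hy hy', sum_oddLeibniz_integ hA hT hy hy',
    ← smul_sub, oddLeibniz_apply, snd_det_jetBlock_add, mul_zero, sub_zero,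
    ← det_curv_eq, smul_smul]
  have hc : (1 / (n.factorial : ℂ) * (Complex.I / (2 * Real.pi)) ^ (n + 1)) * n.factorial =
      (Complex.I / (2 * Real.pi)) ^ (n + 1) := by
    have := factorial_ne_zero' n
    field_simp
  have h3 : curv (isOddMatrix_incl fun i j => A i j y) (dConn T A y) =
      evenMatrix (curvatureForm T A y) := by
    refine Matrix.ext fun i j => Subtype.ext ?_
    rw [coe_curv, evenMatrix, Matrix.of_apply, coe_inclCenter, curvatureForm, map_sub, map_sum]
    simp only [incl_wedge]
    rfl
  rw [hc, h3]
  exact (congrArg Subtype.val (incl_topChern (curvatureForm T A y))).symm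

end DTransgression


/-! ### Change of charts -/

section Charts

variable {E : Type*} [NormedAddCommGroup E]
variable {Z : Type*} [TopologicalSpace Z] [ChartedSpace E Z]

/-- The coordinate change from the preferred chart at `x` to the one at `x'`. -/
def trans (x x' : Z) : E → E := fun y => chartAt E x' ((chartAt E x).symm y)

/-- The domain of the coordinate change from the preferred chart at `x` to the one at `x'`. -/
def transDomain (x x' : Z) : Set E := chartSet (chartAt E x').source x

theorem isOpen_transDomain (x x' : Z) : IsOpen (transDomain (E := E) x x') :=
  (chartAt E x).symm.isOpen_inter_preimage (chartAt E x').open_source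

theorem mem_transDomain_self {x : Z} {y : E} (hy : y ∈ (chartAt E x).target) :
    y ∈ transDomain x ((chartAt E x).symm y) := ⟨hy, mem_chart_source E _⟩

theorem symm_trans {x x' : Z} {y : E} (hy : y ∈ transDomain x x') :
    (chartAt E x').symm (trans x x' y) = (chartAt E x).symm y :=
  (chartAt E x').left_inv hy.2

theorem trans_mem {x x' : Z} {y : E} (hy : y ∈ transDomain x x') :
    trans x x' y ∈ transDomain x' x := by
  refine ⟨(chartAt E x').map_source hy.2, ?_⟩
  rw [mem_preimage, symm_trans hy]
  exact (chartAt E x).map_target hy.1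

theorem trans_trans {x x' : Z} {y : E} (hy : y ∈ transDomain x x') :
    trans x' x (trans x x' y) = y := by
  change chartAt E x ((chartAt E x').symm (trans x x' y)) = y
  rw [symm_trans hy]
  exact (chartAt E x).right_inv hy.1

theorem trans_self {x : Z} {y : E} (hy : y ∈ (chartAt E x).target) : trans x x y = y :=
  (chartAt E x).right_inv hy

variable [NormedSpace ℂ E]

theorem wedge_formInChart {k l m : ℕ} (h : k + l = m) (x : Z) (φ : Z → CForm E k)
    (η : Z → CForm E l) (y : E) :
    formInChart x (fun x' => wedge (φ x') (η x') h) y =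
      wedge (formInChart x φ y) (formInChart x η y) h := wedge_comp _ _ _ _

variable [IsManifold 𝓘(ℂ, E) ω Z]

theorem contDiffOn_trans (x x' : Z) : ContDiffOn ℂ ω (trans (E := E) x x') (transDomain x x') := by
  have h := contDiffOn_ext_coord_change (I := 𝓘(ℂ, E)) (n := ω) x' x
  refine (h.mono fun y hy => ?_).congr fun y hy => ?_
  · simpa [transDomain, chartSet, mfld_simps] using hy
  · simp [trans, mfld_simps]

theorem contDiffOn_real_trans (x x' : Z) :
    ContDiffOn ℝ ∞ (trans (E := E) x x') (transDomain x x') :=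
  ((contDiffOn_trans x x').restrict_scalars ℝ).of_le le_top

theorem differentiableAt_trans {x x' : Z} {y : E} (hy : y ∈ transDomain x x') :
    DifferentiableAt ℂ (trans x x') y :=
  ((contDiffOn_trans x x').differentiableOn (by simp)).differentiableAt
    ((isOpen_transDomain x x').mem_nhds hy)

theorem chartDiff_eq {x : Z} {y : E} (hy : y ∈ (chartAt E x).target) :
    chartDiff x y = fderiv ℂ (trans x ((chartAt E x).symm y)) y := by
  have h : MDifferentiableAt 𝓘(ℂ, E) 𝓘(ℂ, E) (chartAt E x).symm y :=
    mdifferentiableAt_atlas_symm (chart_mem_atlas E x) hy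
  rw [chartDiff, h.mfderiv]
  simp only [writtenInExtChartAt, mfld_simps, fderivWithin_univ]
  rfl

theorem chartDiff_center (x : Z) :
    chartDiff x (chartAt E x x) = ContinuousLinearMap.id ℂ E := by
  have hx : chartAt E x x ∈ (chartAt E x).target := mem_chart_target E x
  rw [chartDiff_eq hx, (chartAt E x).left_inv (mem_chart_source E x)]
  have : trans x x =ᶠ[𝓝 (chartAt E x x)] id :=
    eventually_of_mem ((chartAt E x).open_target.mem_nhds hx) fun y hy => trans_self hy
  rw [this.fderiv_eq, fderiv_id]

theorem chartDiff_comp {x x' : Z} {y : E} (hy : y ∈ transDomain x x') :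
    chartDiff x y = (chartDiff x' (trans x x' y)).comp (fderiv ℂ (trans x x') y) := by
  rw [chartDiff_eq hy.1, chartDiff_eq (trans_mem hy).1, symm_trans hy, ← fderiv_comp]
  · refine Filter.EventuallyEq.fderiv_eq ?_
    filter_upwards [(isOpen_transDomain x x').mem_nhds hy] with z hz
    change _ = chartAt E _ ((chartAt E x').symm (trans x x' z))
    rw [symm_trans hz]
    rfl
  · have := differentiableAt_trans (mem_transDomain_self (trans_mem hy).1)
    rwa [symm_trans hy] at this
  · exact differentiableAt_trans hy

theorem fderiv_trans_comp {x x' : Z} {y : E} (hy : y ∈ transDomain x x') :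
    (fderiv ℂ (trans x' x) (trans x x' y)).comp (fderiv ℂ (trans x x') y) =
      ContinuousLinearMap.id ℂ E := by
  rw [← fderiv_comp _ (differentiableAt_trans (trans_mem hy)) (differentiableAt_trans hy)]
  have : trans x' x ∘ trans x x' =ᶠ[𝓝 y] id :=
    eventually_of_mem ((isOpen_transDomain x x').mem_nhds hy) fun z hz => trans_trans hz
  rw [this.fderiv_eq, fderiv_id]

/-- The differential of the inverse chart is invertible. -/
def chartDiffEquiv (x : Z) {y : E} (hy : y ∈ (chartAt E x).target) : E ≃L[ℂ] E :=
  ContinuousLinearEquiv.equivOfInverse (chartDiff x y)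
    (fderiv ℂ (trans ((chartAt E x).symm y) x) (trans x ((chartAt E x).symm y) y))
    (fun v => by
      rw [chartDiff_eq hy]
      exact DFunLike.congr_fun (fderiv_trans_comp (mem_transDomain_self hy)) v)
    (fun v => by
      rw [chartDiff_eq hy]
      have h := fderiv_trans_comp (trans_mem (mem_transDomain_self hy))
      rw [trans_trans (mem_transDomain_self hy)] at h
      exact DFunLike.congr_fun h v)

theorem coe_chartDiffEquiv (x : Z) {y : E} (hy : y ∈ (chartAt E x).target) :
    (chartDiffEquiv x hy : E →L[ℂ] E) = chartDiff x y := rfl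

theorem chartDiff_vecInChart {x : Z} {y : E} (hy : y ∈ (chartAt E x).target) (V : Z → E) :
    chartDiff x y (vecInChart x V y) = V ((chartAt E x).symm y) := by
  have h : vecInChart x V y = (chartDiff x y).inverse (V ((chartAt E x).symm y)) := rfl
  rw [h, ← coe_chartDiffEquiv x hy, ContinuousLinearMap.inverse_equiv]
  exact (chartDiffEquiv x hy).apply_symm_apply _

theorem chartDiff_injective {x : Z} {y : E} (hy : y ∈ (chartAt E x).target) :
    Function.Injective (chartDiff x y) := (chartDiffEquiv x hy).injective

theorem vecInChart_trans {x x' : Z} {y : E} (hy : y ∈ transDomain x x') (V : Z → E) :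
    vecInChart x' V (trans x x' y) = fderiv ℂ (trans x x') y (vecInChart x V y) := by
  refine chartDiff_injective (trans_mem hy).1 ?_
  rw [chartDiff_vecInChart (trans_mem hy).1, symm_trans hy, ← ContinuousLinearMap.comp_apply,
    ← chartDiff_comp hy, chartDiff_vecInChart hy.1]

theorem formInChart_trans {k : ℕ} {x x' : Z} {y : E} (hy : y ∈ transDomain x x')
    (φ : Z → CForm E k) :
    formInChart x φ y = (formInChart x' φ (trans x x' y)).compContinuousLinearMap
      ((fderiv ℂ (trans x x') y).restrictScalars ℝ) := by
  unfold formInChart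
  rw [symm_trans hy, chartDiff_comp hy]
  rfl

theorem formInChart_center {k : ℕ} (x : Z) (φ : Z → CForm E k) :
    formInChart x φ (chartAt E x x) = φ x := by
  unfold formInChart
  rw [chartDiff_center, (chartAt E x).left_inv (mem_chart_source E x)]
  rfl

end Charts


/-! ### Smooth domains in a chart -/

section Domain

variable {E : Type*} [NormedAddCommGroup E] [NormedSpace ℝ E] {O : Set E} {h : E → ℝ} {y : E}

theorem eventually_add_smul_mem (hO : IsOpen O) (hy : y ∈ O) (hd : DifferentiableAt ℝ h y)
    (h0 : h y = 0) {v : E} (hv : fderiv ℝ h y v < 0) :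
    ∀ᶠ t : ℝ in 𝓝[>] 0, y + t • v ∈ O ∩ {z | h z < 0} := by
  have h1 : HasDerivAt (fun t : ℝ => h (y + t • v)) (fderiv ℝ h y v) 0 := by
    have hl : HasDerivAt (fun t : ℝ => y + t • v) v 0 := by
      simpa using ((hasDerivAt_id (0 : ℝ)).smul_const v).const_add y
    have hd' : HasFDerivAt h (fderiv ℝ h y) (y + (0 : ℝ) • v) := by simpa using hd.hasFDerivAt
    exact hd'.comp_hasDerivAt (0 : ℝ) hl
  have h2 : ∀ᶠ t : ℝ in 𝓝[>] 0, h (y + t • v) < 0 := by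
    have h3 := (hasDerivAt_iff_tendsto_slope.mp h1).eventually_lt_const hv
    have h4 : ∀ᶠ t : ℝ in 𝓝[>] 0, slope (fun t : ℝ => h (y + t • v)) 0 t < 0 :=
      h3.filter_mono (nhdsWithin_mono _ fun t ht => ne_of_gt ht)
    filter_upwards [h4, self_mem_nhdsWithin] with t ht ht0
    rw [slope_def_field] at ht
    simp only [zero_smul, add_zero, h0, sub_zero] at ht
    have ht0' : (0 : ℝ) < t := ht0
    have := mul_neg_of_neg_of_pos ht ht0'
    rwa [div_mul_cancel₀ _ ht0'.ne'] at this
  have h5 : Tendsto (fun t : ℝ => y + t • v) (𝓝[>] 0) (𝓝 y) := by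
    have : Continuous fun t : ℝ => y + t • v := by fun_prop
    have h6 := this.tendsto 0
    rw [zero_smul, add_zero] at h6
    exact h6.mono_left nhdsWithin_le_nhds
  exact (h5.eventually (hO.mem_nhds hy)).and h2

theorem exists_fderiv_neg (hne : fderiv ℝ h y ≠ 0) : ∃ v, fderiv ℝ h y v < 0 := by
  obtain ⟨v, hv⟩ : ∃ v, fderiv ℝ h y v ≠ 0 := by
    by_contra! hc
    exact hne (ContinuousLinearMap.ext hc)
  rcases lt_or_gt_of_ne hv with hv | hv
  · exact ⟨v, hv⟩
  · exact ⟨-v, by rw [map_neg]; linarith⟩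

theorem mem_closure_neg (hO : IsOpen O) (hd : DifferentiableOn ℝ h O)
    (hne : ∀ y ∈ O, h y = 0 → fderiv ℝ h y ≠ 0) (hy : y ∈ O) (hy0 : h y ≤ 0) :
    y ∈ closure (O ∩ {z | h z < 0}) := by
  rcases hy0.lt_or_eq with hlt | heq
  · exact subset_closure ⟨hy, hlt⟩
  · obtain ⟨v, hv⟩ := exists_fderiv_neg (hne y hy heq)
    have h1 := eventually_add_smul_mem hO hy (hd.differentiableAt (hO.mem_nhds hy)) heq hv
    have h5 : Tendsto (fun t : ℝ => y + t • v) (𝓝[>] 0) (𝓝 y) := by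
      have : Continuous fun t : ℝ => y + t • v := by fun_prop
      have h6 := this.tendsto 0
      rw [zero_smul, add_zero] at h6
      exact h6.mono_left nhdsWithin_le_nhds
    exact mem_closure_of_tendsto h5 h1

theorem isOpen_inter_neg (hO : IsOpen O) (hd : DifferentiableOn ℝ h O) :
    IsOpen (O ∩ {z | h z < 0}) :=
  hd.continuousOn.isOpen_inter_preimage hO isOpen_Iio

theorem mem_closure_interior (hO : IsOpen O) (hd : DifferentiableOn ℝ h O)
    (hne : ∀ y ∈ O, h y = 0 → fderiv ℝ h y ≠ 0) (hy : y ∈ O ∩ {z | h z ≤ 0}) :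
    y ∈ closure (interior (O ∩ {z | h z ≤ 0})) := by
  refine closure_mono ?_ (mem_closure_neg hO hd hne hy.1 hy.2)
  exact interior_maximal (inter_subset_inter_right _ fun z (hz : h z < 0) => hz.le)
    (isOpen_inter_neg hO hd)

theorem uniqueDiffOn_domain (hO : IsOpen O) (hd : DifferentiableOn ℝ h O)
    (hne : ∀ y ∈ O, h y = 0 → fderiv ℝ h y ≠ 0) : UniqueDiffOn ℝ (O ∩ {z | h z ≤ 0}) := by
  intro y hy
  rcases (show h y ≤ 0 from hy.2).lt_or_eq with hlt | heq
  · refine UniqueDiffWithinAt.mono ((isOpen_inter_neg hO hd).uniqueDiffWithinAt ⟨hy.1, hlt⟩) ?_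
    exact inter_subset_inter_right _ fun z (hz : h z < 0) => hz.le
  · refine ⟨?_, subset_closure hy⟩
    obtain ⟨v, hv⟩ := exists_fderiv_neg (hne y hy.1 heq)
    have h1 : {w | fderiv ℝ h y w < 0} ⊆ tangentConeAt ℝ (O ∩ {z | h z ≤ 0}) y := by
      intro w hw
      have h2 := eventually_add_smul_mem hO hy.1 (hd.differentiableAt (hO.mem_nhds hy.1)) heq hw
      have h3 : Tendsto (fun t : ℝ => t • w) (𝓝[>] 0) (𝓝 0) := by
        have : Continuous fun t : ℝ => t • w := by fun_prop
        have h6 := this.tendsto 0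
        rw [zero_smul] at h6
        exact h6.mono_left nhdsWithin_le_nhds
      refine mem_tangentConeAt_of_seq (𝓝[>] (0 : ℝ)) (fun t => t⁻¹) (fun t => t • w) h3 ?_ ?_
      · filter_upwards [h2] with t ht using ⟨ht.1, (show h (y + t • w) < 0 from ht.2).le⟩
      · refine tendsto_const_nhds.congr' ?_
        filter_upwards [self_mem_nhdsWithin] with t ht
        rw [smul_smul, inv_mul_cancel₀ (ne_of_gt ht), one_smul]
    have h4 : IsOpen {w | fderiv ℝ h y w < 0} := isOpen_lt (by fun_prop) continuous_const
    have h5 : Submodule.span ℝ (tangentConeAt ℝ (O ∩ {z | h z ≤ 0}) y) = ⊤ := by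
      refine Submodule.eq_top_of_nonempty_interior' _ ⟨v, ?_⟩
      exact interior_maximal (h1.trans Submodule.subset_span) h4 hv
    rw [h5]
    exact dense_univ

end Domain

/-! ### Smoothness of forms and pullbacks -/

section FormSmooth

variable {E : Type*} [NormedAddCommGroup E] [NormedSpace ℂ E] [FiniteDimensional ℂ E]
  {F : Type*} [NormedAddCommGroup F] [NormedSpace ℝ F] {s : Set F} {y : F} {r : WithTop ℕ∞} {k : ℕ}

omit [FiniteDimensional ℂ E] in
theorem finiteDimensional_cform [FiniteDimensional ℝ E] : FiniteDimensional ℝ (CForm E k) := by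
  let L : CForm E k →ₗ[ℝ] MultilinearMap ℝ (fun _ : Fin k => E) ℂ :=
    { toFun := fun φ => φ.toMultilinearMap
      map_add' := fun _ _ => rfl
      map_smul' := fun _ _ => rfl }
  refine FiniteDimensional.of_injective L fun φ η h => ?_
  ext v
  exact congrArg (fun m : MultilinearMap ℝ (fun _ : Fin k => E) ℂ => m v) h

/-- Smoothness of a form-valued function can be tested on constant arguments. -/
theorem contDiffWithinAt_form {φ : F → CForm E k}
    (h : ∀ v : Fin k → E, ContDiffWithinAt ℝ r (fun z => φ z v) s y) :
    ContDiffWithinAt ℝ r φ s y := by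
  let := FiniteDimensional.complexToReal E
  have := finiteDimensional_cform (E := E) (k := k)
  let b := Module.finBasis ℝ E
  let L : CForm E k →ₗ[ℝ] ((Fin k → Fin (Module.finrank ℝ E)) → ℂ) :=
    { toFun := fun φ i => φ fun j => b (i j)
      map_add' := fun _ _ => rfl
      map_smul' := fun _ _ => rfl }
  have hL : Function.Injective L := by
    intro φ η h
    ext v
    have : φ.toAlternatingMap = η.toAlternatingMap := by
      refine Module.Basis.ext_alternating b fun i _ => ?_
      exact congrFun h i
    exact congrArg (fun m : E [⋀^Fin k]→ₗ[ℝ] ℂ => m v) this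
  obtain ⟨G, hG⟩ := L.exists_leftInverse_of_injective (LinearMap.ker_eq_bot.mpr hL)
  have h1 : ContDiffWithinAt ℝ r (fun z => L (φ z)) s y := contDiffWithinAt_pi.mpr fun i => h _
  have h2 : φ = fun z => LinearMap.toContinuousLinearMap G (L (φ z)) := by
    ext1 z
    exact (LinearMap.congr_fun hG (φ z)).symm
  rw [h2]
  exact (LinearMap.toContinuousLinearMap G).contDiff.comp_contDiffWithinAt h1

theorem contDiffWithinAt_pullback {φ : F → CForm E k} {A : F → E →L[ℝ] E}
    (hφ : ContDiffWithinAt ℝ r φ s y) (hA : ContDiffWithinAt ℝ r A s y) :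
    ContDiffWithinAt ℝ r (fun z => (φ z).compContinuousLinearMap (A z)) s y := by
  refine contDiffWithinAt_form fun v => ?_
  have h1 : ContDiffWithinAt ℝ r (fun z =>
      ContinuousMultilinearMap.compContinuousLinearMapContinuousMultilinear ℝ (fun _ : Fin k => E)
        (fun _ : Fin k => E) ℂ (fun _ : Fin k => A z)) s y := by
    refine (ContinuousMultilinearMap.contDiff _).comp_contDiffWithinAt (x := y) ?_
    exact contDiffWithinAt_pi.mpr fun _ => hA
  have h2 : ContDiffWithinAt ℝ r (fun z => (φ z).toContinuousMultilinearMap) s y :=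
    (ContinuousAlternatingMap.toContinuousMultilinearMapLI (𝕜 := ℝ) (E := E) (F := ℂ)
      (ι := Fin k)).contDiff.comp_contDiffWithinAt hφ
  have h3 := h1.clm_apply h2
  exact (ContinuousMultilinearMap.apply ℝ (fun _ : Fin k => E) ℂ v).contDiff.comp_contDiffWithinAt
    h3

end FormSmooth

/-! ### Forms in different charts -/

section FormCharts

variable {E : Type*} [NormedAddCommGroup E] [NormedSpace ℂ E] [FiniteDimensional ℂ E]
variable {Z : Type*} [TopologicalSpace Z] [ChartedSpace E Z] [IsManifold 𝓘(ℂ, E) ω Z] {k : ℕ}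

omit [FiniteDimensional ℂ E] in
theorem contDiffOn_fderiv_trans (x x' : Z) :
    ContDiffOn ℝ ∞ (fun y => (fderiv ℂ (trans (E := E) x x') y).restrictScalars ℝ)
      (transDomain x x') := by
  have h1 : ContDiffOn ℝ ∞ (fderiv ℝ (trans (E := E) x x')) (transDomain x x') :=
    (contDiffOn_real_trans x x').fderiv_of_isOpen (isOpen_transDomain x x') (by simp)
  exact h1.congr fun y hy => ((differentiableAt_trans hy).fderiv_restrictScalars ℝ).symm

theorem contDiffWithinAt_formInChart {x x' : Z} {y : E} (hy : y ∈ transDomain x x')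
    {φ : Z → CForm E k} {r : WithTop ℕ∞} (hr : r ≤ ∞) {s t : Set E}
    (hst : MapsTo (trans x x') (s ∩ transDomain x x') t)
    (h : ContDiffWithinAt ℝ r (formInChart x' φ) t (trans x x' y)) :
    ContDiffWithinAt ℝ r (formInChart x φ) s y := by
  have hn := (isOpen_transDomain x x').mem_nhds hy
  have h1 : ContDiffWithinAt ℝ r (fun z => (formInChart x' φ (trans x x' z)).compContinuousLinearMap
      ((fderiv ℂ (trans x x') z).restrictScalars ℝ)) (s ∩ transDomain x x') y := by
    refine contDiffWithinAt_pullback ?_ ?_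
    · refine h.comp y ?_ hst
      exact (((contDiffOn_real_trans x x').contDiffAt hn).of_le hr).contDiffWithinAt
    · exact (((contDiffOn_fderiv_trans x x').contDiffAt hn).of_le hr).contDiffWithinAt
  have h2 := (contDiffWithinAt_inter hn).mp h1
  refine h2.congr_of_eventuallyEq ?_ (formInChart_trans hy φ)
  filter_upwards [mem_nhdsWithin_of_mem_nhds hn] with z hz using formInChart_trans hz φ

omit [FiniteDimensional ℂ E] [NormedSpace ℂ E] [IsManifold 𝓘(ℂ, E) ω Z] in
theorem mapsTo_trans (S : Set Z) (x x' : Z) :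
    MapsTo (trans x x') (chartSet S x ∩ transDomain (E := E) x x') (chartSet S x') := by
  intro y hy
  refine ⟨(trans_mem hy.2).1, ?_⟩
  rw [mem_preimage, symm_trans hy.2]
  exact hy.1.2

/-- Smoothness of a form can be tested in the charts at the individual points. -/
theorem smoothForm_of_center {S : Set Z} {φ : Z → CForm E k}
    (h : ∀ x ∈ S, ContDiffWithinAt ℝ ∞ (formInChart x φ) (chartSet S x) (chartAt E x x)) :
    SmoothForm S φ := by
  intro x y hy
  exact contDiffWithinAt_formInChart (mem_transDomain_self hy.1) le_rfl (mapsTo_trans S x _)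
    (h _ hy.2)

omit [FiniteDimensional ℂ E] in
/-- The exterior derivative does not depend on the chart. -/
theorem formInChart_extD {S : Set Z} {φ : Z → CForm E k} {x : Z} {y : E}
    (hy : y ∈ chartSet S x) {s : Set E} (hs : UniqueDiffOn ℝ s)
    (hsS : s ⊆ chartSet S x) (hys : y ∈ s) (hys' : y ∈ closure (interior s))
    (hφ : ContDiffWithinAt ℝ ∞ (formInChart ((chartAt E x).symm y) φ)
      (chartSet S ((chartAt E x).symm y)) (trans x ((chartAt E x).symm y) y)) :
    formInChart x (extD S φ) y = extDerivWithin (formInChart x φ) s y := by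
  set x' := (chartAt E x).symm y with hx'
  have hyt : y ∈ transDomain x x' := mem_transDomain_self hy.1
  have ho := isOpen_transDomain (E := E) x x'
  set s' := s ∩ transDomain x x' with hs'
  have hsd : UniqueDiffOn ℝ s' := hs.inter ho
  have hcl : y ∈ closure (interior s') := by
    rw [hs', interior_inter, ho.interior_eq]
    rw [inter_comm]
    exact ho.inter_closure ⟨hyt, hys'⟩
  have hfd : ∀ z ∈ s', fderivWithin ℝ (trans x x') s' z =
      (fderiv ℂ (trans x x') z).restrictScalars ℝ := by
    intro z hz
    rw [((differentiableAt_trans hz.2).restrictScalars ℝ).fderivWithin (hsd z hz),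
      (differentiableAt_trans hz.2).fderiv_restrictScalars ℝ]
  have h1 := extDerivWithin_pullback (𝕜 := ℝ) (r := ∞) (s := s') (t := chartSet S x')
    (f := trans x x') (hφ.differentiableWithinAt (by simp))
    (((contDiffOn_real_trans x x').contDiffAt (ho.mem_nhds hyt)).contDiffWithinAt)
    (by rw [minSmoothness_of_isRCLikeNormedField]; exact WithTop.coe_le_coe.mpr le_top) hsd hcl
    ⟨hys, hyt⟩ (fun z hz => mapsTo_trans S x x' ⟨hsS hz.1, hz.2⟩)
  have h2 : extDerivWithin (formInChart x φ) s y = extDerivWithin (formInChart x φ) s' y := by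
    simp only [extDerivWithin]
    rw [fderivWithin_inter (ho.mem_nhds hyt)]
  have h3 : extDerivWithin (formInChart x φ) s' y = extDerivWithin (fun z =>
      (formInChart x' φ (trans x x' z)).compContinuousLinearMap
        (fderivWithin ℝ (trans x x') s' z)) s' y := by
    refine extDerivWithin_congr' (fun z hz => ?_) ⟨hys, hyt⟩
    rw [hfd z hz, formInChart_trans hz.2]
  rw [h2, h3, h1, hfd y ⟨hys, hyt⟩]
  rw [formInChart, chartDiff_eq hy.1]
  rfl

/-- If a form on `{ρ < 0}` has a continuous extension to `{ρ ≤ 0}` in the chart at `x`, then this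
is its extension by continuity, at all points near `x`. -/
theorem formInChart_extendForm {ρ : Z → ℝ} {φ : Z → CForm E k} {x : Z} {O : Set E}
    (hO : IsOpen O) (hOt : O ⊆ (chartAt E x).target) {η : E → CForm E k}
    (hη : ContDiffOn ℝ 0 η (O ∩ {y | ρ ((chartAt E x).symm y) ≤ 0}))
    (hφ : ∀ y ∈ O, ρ ((chartAt E x).symm y) < 0 → formInChart x φ y = η y)
    (hcl : ∀ y ∈ O ∩ {y | ρ ((chartAt E x).symm y) ≤ 0},
      y ∈ closure (O ∩ {y | ρ ((chartAt E x).symm y) < 0})) {y : E}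
    (hy : y ∈ O ∩ {y | ρ ((chartAt E x).symm y) ≤ 0}) :
    formInChart x (extendForm {x | ρ x < 0} φ) y = η y := by
  set x' := (chartAt E x).symm y with hx'
  have hyt : y ∈ transDomain x x' := mem_transDomain_self (hOt hy.1)
  set y' := trans x x' y with hy'
  have hyt' : y' ∈ transDomain x' x := trans_mem hyt
  have hback : trans x' x y' = y := trans_trans hyt
  have hnO : trans x' x ⁻¹' O ∩ transDomain x' x ∈ 𝓝 y' := by
    refine inter_mem ?_ ((isOpen_transDomain x' x).mem_nhds hyt')
    refine ((contDiffOn_real_trans x' x).continuousOn.continuousAt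
      ((isOpen_transDomain x' x).mem_nhds hyt')).preimage_mem_nhds ?_
    rw [hback]
    exact hO.mem_nhds hy.1
  have h1 : ContDiffWithinAt ℝ 0 (fun z => (η (trans x' x z)).compContinuousLinearMap
      ((fderiv ℂ (trans x' x) z).restrictScalars ℝ))
      (chartSet {x | ρ x < 0} x' ∩ (trans x' x ⁻¹' O ∩ transDomain x' x)) y' := by
    have hn := (isOpen_transDomain x' x).mem_nhds hyt'
    refine contDiffWithinAt_pullback ?_ ?_
    · refine ContDiffWithinAt.comp y' (t := O ∩ {y | ρ ((chartAt E x).symm y) ≤ 0}) ?_ ?_ ?_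
      · rw [hback]; exact hη y hy
      · exact (((contDiffOn_real_trans x' x).contDiffAt hn).of_le (by simp)).contDiffWithinAt
      · intro z hz
        refine ⟨hz.2.1, ?_⟩
        rw [mem_ofPred_eq, symm_trans hz.2.2]
        exact le_of_lt (show ρ ((chartAt E x').symm z) < 0 from hz.1.2)
    · exact (((contDiffOn_fderiv_trans x' x).contDiffAt hn).of_le (by simp)).contDiffWithinAt
  have h2 := ((contDiffWithinAt_inter hnO).mp h1).continuousWithinAt
  have h3 : Tendsto (formInChart x' φ) (𝓝[chartSet {x | ρ x < 0} x'] y')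
      (𝓝 ((η y).compContinuousLinearMap
        ((fderiv ℂ (trans x' x) y').restrictScalars ℝ))) := by
    have h4 := h2.tendsto
    rw [hback] at h4
    refine h4.congr' ?_
    filter_upwards [self_mem_nhdsWithin, mem_nhdsWithin_of_mem_nhds hnO] with z hz hz'
    rw [formInChart_trans hz'.2, hφ _ hz'.1]
    rw [symm_trans hz'.2]
    exact hz.2
  have hcl' : y' ∈ closure (chartSet {x | ρ x < 0} x') := by
    have h4 := hcl y hy
    have h5 : y ∈ closure ((O ∩ {y | ρ ((chartAt E x).symm y) < 0}) ∩ transDomain x x') := by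
      rw [inter_comm]
      exact (isOpen_transDomain x x').inter_closure ⟨hyt, h4⟩
    have h6 : ContinuousWithinAt (trans x x')
        ((O ∩ {y | ρ ((chartAt E x).symm y) < 0}) ∩ transDomain x x') y :=
      ((contDiffOn_real_trans x x').continuousOn.continuousAt
        ((isOpen_transDomain x x').mem_nhds hyt)).continuousWithinAt
    refine h6.mem_closure h5 fun z hz => ?_
    exact mapsTo_trans {x | ρ x < 0} x x' ⟨⟨hOt hz.1.1, hz.1.2⟩, hz.2⟩
  have h7 : extendForm {x | ρ x < 0} φ x' = (η y).compContinuousLinearMap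
      ((fderiv ℂ (trans x' x) y').restrictScalars ℝ) := extendFrom_eq hcl' h3
  rw [formInChart, ← hx', h7, chartDiff_eq (hOt hy.1)]
  ext v
  simp only [ContinuousAlternatingMap.compContinuousLinearMap_apply]
  congr 1
  ext1 i
  exact DFunLike.congr_fun (fderiv_trans_comp hyt) (v i)

end FormCharts


/-! ### The operators `∂` and `∂̄` -/

section Del

variable {E : Type*} [NormedAddCommGroup E] [NormedSpace ℂ E] {F G : E → ℂ} {y v : E}

theorem del_apply (F : E → ℂ) (y v : E) :
    del F y v = (1 / 2) * (fderiv ℝ F y v - Complex.I * fderiv ℝ F y (Complex.I • v)) := rfl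

theorem del_congr (h : F =ᶠ[𝓝 y] G) : del F y = del G y := by
  ext v; rw [del_apply, del_apply, h.fderiv_eq]

theorem delbar_congr (h : F =ᶠ[𝓝 y] G) (v : E) : delbar F y v = delbar G y v := by
  rw [delbar, delbar, h.fderiv_eq]

theorem del_mul (hF : DifferentiableAt ℝ F y) (hG : DifferentiableAt ℝ G y) :
    del (fun z => F z * G z) y v = F y * del G y v + del F y v * G y := by
  have h := (hF.hasFDerivAt.mul' hG.hasFDerivAt).fderiv
  have h' : fderiv ℝ (fun z => F z * G z) y = _ := h
  simp only [del_apply, h', add_apply, smul_apply, smul_eq_mul, MulOpposite.smul_eq_mul_unop,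
    MulOpposite.unop_op]
  ring

theorem del_sum {ι : Type*} (s : Finset ι) {F : ι → E → ℂ}
    (hF : ∀ i ∈ s, DifferentiableAt ℝ (F i) y) :
    del (fun z => ∑ i ∈ s, F i z) y v = ∑ i ∈ s, del (F i) y v := by
  simp only [del_apply, fderiv_fun_sum hF, sum_apply, Finset.mul_sum, ← Finset.sum_sub_distrib]

theorem del_add (hF : DifferentiableAt ℝ F y) (hG : DifferentiableAt ℝ G y) :
    del (fun z => F z + G z) y v = del F y v + del G y v := by
  simp only [del_apply, fderiv_fun_add hF hG, add_apply]
  ring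

theorem del_holomorphic (hF : DifferentiableAt ℂ F y) : del F y v = fderiv ℂ F y v := by
  rw [del_apply, hF.fderiv_restrictScalars ℝ]
  simp only [ContinuousLinearMap.coe_restrictScalars', map_smul, smul_eq_mul]
  linear_combination (-(1 / 2) * fderiv ℂ F y v) * Complex.I_mul_I

theorem del_conj_holomorphic (hF : DifferentiableAt ℂ F y) :
    del (fun z => conj (F z)) y v = 0 := by
  have h : fderiv ℝ (fun z => conj (F z)) y =
      (Complex.conjCLE : ℂ →L[ℝ] ℂ).comp (fderiv ℝ F y) :=
    ((Complex.conjCLE : ℂ →L[ℝ] ℂ).hasFDerivAt.comp y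
      (hF.restrictScalars ℝ).hasFDerivAt).fderiv
  rw [del_apply, h, hF.fderiv_restrictScalars ℝ]
  simp only [ContinuousLinearMap.comp_apply, ContinuousLinearMap.coe_restrictScalars', map_smul,
    smul_eq_mul, ContinuousLinearEquiv.coe_coe, Complex.conjCLE_apply, map_mul, Complex.conj_I]
  linear_combination ((1 / 2) * conj (fderiv ℂ F y v)) * Complex.I_mul_I

theorem del_comp {f : E → E} (hF : DifferentiableAt ℝ F (f y)) (hf : DifferentiableAt ℂ f y) :
    del (fun z => F (f z)) y v = del F (f y) (fderiv ℂ f y v) := by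
  have h : fderiv ℝ (fun z => F (f z)) y = (fderiv ℝ F (f y)).comp (fderiv ℝ f y) :=
    fderiv_comp y hF (hf.restrictScalars ℝ)
  rw [del_apply, del_apply, h, hf.fderiv_restrictScalars ℝ]
  simp

theorem delbar_comp {f : E → E} (hF : DifferentiableAt ℝ F (f y)) (hf : DifferentiableAt ℂ f y) :
    delbar (fun z => F (f z)) y v = delbar F (f y) (fderiv ℂ f y v) := by
  have h : fderiv ℝ (fun z => F (f z)) y = (fderiv ℝ F (f y)).comp (fderiv ℝ f y) :=
    fderiv_comp y hF (hf.restrictScalars ℝ)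
  rw [delbar, delbar, h, hf.fderiv_restrictScalars ℝ]
  simp

theorem delbar_add_right (F : E → ℂ) (y v w : E) :
    delbar F y (v + w) = delbar F y v + delbar F y w := by
  simp only [delbar, smul_add, map_add]; ring

theorem delbar_smul_right (F : E → ℂ) (y : E) (c : ℂ) (v : E) :
    delbar F y (c • v) = conj c * delbar F y v := by
  have key : ∀ w : E, fderiv ℝ F y (c • w)
      = c.re * fderiv ℝ F y w + c.im * fderiv ℝ F y (Complex.I • w) := by
    intro w
    have : c • w = c.re • w + c.im • (Complex.I • w) := by
      conv_lhs => rw [← Complex.re_add_im c]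
      rw [add_smul, mul_smul]; rfl
    rw [this, map_add, map_smul, map_smul]; simp
  have h3 : Complex.I • (Complex.I • v) = -v := by rw [smul_smul, Complex.I_mul_I]; simp
  have h4 : conj c = c.re - c.im * Complex.I := by
    apply Complex.ext <;> simp
  rw [delbar, delbar, smul_comm, key v, key (Complex.I • v), h3, map_neg, h4]
  linear_combination ((1 / 2 : ℂ) * c.im * fderiv ℝ F y (Complex.I • v)) * Complex.I_mul_I

theorem delbar_sum_right {ι : Type*} (s : Finset ι) (F : E → ℂ) (y : E) (v : ι → E) :
    delbar F y (∑ i ∈ s, v i) = ∑ i ∈ s, delbar F y (v i) := by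
  classical
  induction s using Finset.induction_on with
  | empty => simp [delbar]
  | insert i s hi ih => rw [Finset.sum_insert hi, Finset.sum_insert hi, delbar_add_right, ih]

theorem contDiffAt_delbar (hF : ContDiffAt ℝ ∞ F y) (v : E) :
    ContDiffAt ℝ ∞ (fun z => delbar F z v) y := by
  have h : ContDiffAt ℝ ∞ (fderiv ℝ F) y := hF.fderiv_right (by simp)
  unfold delbar
  exact contDiffAt_const.mul ((h.clm_apply contDiffAt_const).add
    (contDiffAt_const.mul (h.clm_apply contDiffAt_const)))

theorem contDiffAt_del_apply (hF : ContDiffAt ℝ ∞ F y) (v : E) :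
    ContDiffAt ℝ ∞ (fun z => del F z v) y := by
  have h : ContDiffAt ℝ ∞ (fderiv ℝ F) y := hF.fderiv_right (by simp)
  simp only [del_apply]
  exact contDiffAt_const.mul ((h.clm_apply contDiffAt_const).sub
    (contDiffAt_const.mul (h.clm_apply contDiffAt_const)))

end Del

/-! ### The Chern connection in a chart -/

section Chern

variable {E : Type*} [NormedAddCommGroup E] [NormedSpace ℂ E] [FiniteDimensional ℂ E]
variable {Z : Type*} [TopologicalSpace Z] [ChartedSpace E Z]
  {g : Z → E →L[ℂ] E →L⋆[ℂ] ℂ} {S : Set Z} {x : Z} {y : E}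

/-- The metric `g` in the chart at `x`. -/
def metricInChart (g : Z → E →L[ℂ] E →L⋆[ℂ] ℂ) (x : Z) (y u w : E) : ℂ :=
  g ((chartAt E x).symm y) (chartDiff x y u) (chartDiff x y w)

/-- The connection forms of the Chern connection in the coordinate frame of the chart at `x`, at
the point with coordinates `y`. -/
def chernAt (g : Z → E →L[ℂ] E →L⋆[ℂ] ℂ) (x : Z) (y : E) (i j : Fin (Module.finrank ℂ E)) :
    E →L[ℂ] ℂ :=
  ∑ l, (metricMatrix g x y)⁻¹ l j • del (fun z => metricMatrix g x z i l) y

/-- The value `Γ(v, u)` of the Christoffel symbols of the Chern connection in the chart at `x`. -/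
def christoffel (g : Z → E →L[ℂ] E →L⋆[ℂ] ℂ) (x : Z) (y v u : E) : E :=
  ∑ i, ∑ j, ((Module.finBasis ℂ E).coord i u * chernAt g x y i j v) • Module.finBasis ℂ E j

omit [FiniteDimensional ℂ E] in
theorem metricInChart_sum {ι κ : Type*} (s : Finset ι) (t : Finset κ) (a : ι → ℂ) (u : ι → E)
    (c : κ → ℂ) (w : κ → E) :
    metricInChart g x y (∑ i ∈ s, a i • u i) (∑ j ∈ t, c j • w j) =
      ∑ i ∈ s, ∑ j ∈ t, a i * conj (c j) * metricInChart g x y (u i) (w j) := by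
  unfold metricInChart
  rw [map_sum, map_sum, map_sum]
  simp only [map_smul, sum_apply, smul_apply, map_sum, map_smulₛₗ, smul_eq_mul, Finset.mul_sum]
  rw [Finset.sum_comm]
  exact Finset.sum_congr rfl fun i _ => Finset.sum_congr rfl fun j _ => by ring

theorem metricInChart_eq (u w : E) : metricInChart g x y u w =
    ∑ i, ∑ j, (Module.finBasis ℂ E).coord i u * conj ((Module.finBasis ℂ E).coord j w) *
      metricMatrix g x y i j := by
  conv_lhs => rw [← (Module.finBasis ℂ E).sum_repr u, ← (Module.finBasis ℂ E).sum_repr w]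
  rw [metricInChart_sum]
  rfl

variable [IsManifold 𝓘(ℂ, E) ω Z]

omit [FiniteDimensional ℂ E] in
theorem metricInChart_injective (hg : IsHermitianMetric S g) (hy : y ∈ chartSet S x) {u u' : E}
    (h : ∀ w, metricInChart g x y u w = metricInChart g x y u' w) : u = u' := by
  by_contra hne
  have h1 : chartDiff x y (u - u') ≠ 0 := by
    rw [map_sub]
    exact sub_ne_zero.mpr fun h => hne (chartDiff_injective hy.1 h)
  have h2 := hg.pos _ hy.2 _ h1
  have h3 : metricInChart g x y (u - u') (u - u') = 0 := by
    have : metricInChart g x y (u - u') (u - u') =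
        metricInChart g x y u (u - u') - metricInChart g x y u' (u - u') := by
      simp [metricInChart]
    rw [this, h, sub_self]
  rw [metricInChart] at h3
  rw [h3] at h2
  simp at h2

theorem isUnit_det_metricMatrix (hg : IsHermitianMetric S g) (hy : y ∈ chartSet S x) :
    IsUnit (metricMatrix g x y).det := by
  rw [isUnit_iff_ne_zero]
  intro h0
  obtain ⟨c, hc, h⟩ := Matrix.exists_vecMul_eq_zero_iff.mpr h0
  refine hc ?_
  have h1 : (∑ i, c i • Module.finBasis ℂ E i) = 0 := by
    refine metricInChart_injective hg hy fun w => ?_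
    conv_lhs => rw [← (Module.finBasis ℂ E).sum_repr w]
    rw [metricInChart_sum, Finset.sum_comm]
    have h2 : metricInChart g x y 0 w = 0 := by simp [metricInChart]
    rw [h2]
    refine Finset.sum_eq_zero fun j _ => ?_
    have h3 : ∑ i, c i * metricMatrix g x y i j = 0 := congrFun h j
    calc _ = conj ((Module.finBasis ℂ E).repr w j) * ∑ i, c i * metricMatrix g x y i j := by
          rw [Finset.mul_sum]
          refine Finset.sum_congr rfl fun i _ => ?_
          simp only [metricMatrix, Matrix.of_apply, metricInChart]
          ring
      _ = 0 := by rw [h3, mul_zero]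
  funext i
  exact Fintype.linearIndependent_iff.mp (Module.finBasis ℂ E).linearIndependent c h1 i

omit [IsManifold 𝓘(ℂ, E) ω Z] in
theorem contDiffAt_metricMatrix (hS : IsOpen S) (hg : IsHermitianMetric S g)
    (hy : y ∈ chartSet S x) (i j : Fin (Module.finrank ℂ E)) :
    ContDiffAt ℝ ∞ (fun z => metricMatrix g x z i j) y :=
  (hg.smooth x _ _).contDiffAt (((chartAt E x).isOpen_inter_preimage_symm hS).mem_nhds hy)

/-- The Chern connection is characterised by `g(Γ(v, u), w) = ∂_v (g(u, w))` for constant `u`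
and `w`. -/
theorem metricInChart_christoffel (hS : IsOpen S) (hg : IsHermitianMetric S g)
    (hy : y ∈ chartSet S x) (v u w : E) :
    metricInChart g x y (christoffel g x y v u) w =
      del (fun z => metricInChart g x z u w) y v := by
  set b := Module.finBasis ℂ E
  have hd : ∀ i j, DifferentiableAt ℝ (fun z => metricMatrix g x z i j) y := fun i j =>
    (contDiffAt_metricMatrix hS hg hy i j).differentiableAt (by simp)
  have h1 : ∀ i l, ∑ j, chernAt g x y i j v * metricMatrix g x y j l =
      del (fun z => metricMatrix g x z i l) y v := by
    intro i l
    have h2 := Matrix.nonsing_inv_mul _ (isUnit_det_metricMatrix hg hy)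
    simp only [chernAt, sum_apply, smul_apply, smul_eq_mul, Finset.sum_mul]
    rw [Finset.sum_comm]
    calc _ = ∑ m, del (fun z => metricMatrix g x z i m) y v *
          ((metricMatrix g x y)⁻¹ * metricMatrix g x y) m l := by
          refine Finset.sum_congr rfl fun m _ => ?_
          rw [Matrix.mul_apply, Finset.mul_sum]
          exact Finset.sum_congr rfl fun j _ => by ring
      _ = _ := by simp [h2, Matrix.one_apply]
  have h3 : (fun z => metricInChart g x z u w) = fun z => ∑ i, ∑ l,
      (b.coord i u * conj (b.coord l w)) * metricMatrix g x z i l := by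
    funext z; exact metricInChart_eq u w
  have hm : ∀ i l, del (fun z => (b.coord i u * conj (b.coord l w)) * metricMatrix g x z i l) y v =
      (b.coord i u * conj (b.coord l w)) * del (fun z => metricMatrix g x z i l) y v := by
    intro i l
    rw [del_mul (differentiableAt_const _) (hd i l)]
    simp [del_apply]
  have hd' : ∀ i l, DifferentiableAt ℝ
      (fun z => (b.coord i u * conj (b.coord l w)) * metricMatrix g x z i l) y := fun i l =>
    (differentiableAt_const _).mul (hd i l)
  rw [h3, del_sum _ fun i _ => DifferentiableAt.fun_sum fun l _ => hd' i l]
  simp only [del_sum _ fun l _ => hd' _ l, hm, ← h1]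
  have h4 : christoffel g x y v u = ∑ j, (∑ i, b.coord i u * chernAt g x y i j v) • b j := by
    rw [christoffel, Finset.sum_comm]
    exact Finset.sum_congr rfl fun j _ => (Finset.sum_smul).symm
  rw [h4]
  conv_lhs => rw [← b.sum_repr w]
  rw [metricInChart_sum]
  simp only [Finset.sum_mul, Finset.mul_sum]
  rw [Finset.sum_congr rfl fun j _ => Finset.sum_comm, Finset.sum_comm]
  refine Finset.sum_congr rfl fun i _ => ?_
  rw [Finset.sum_comm]
  refine Finset.sum_congr rfl fun l _ => Finset.sum_congr rfl fun j _ => ?_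
  simp only [metricMatrix, Matrix.of_apply, metricInChart, Module.Basis.coord_apply]
  ring

omit [FiniteDimensional ℂ E] in
theorem metricInChart_trans {x' : Z} (hy : y ∈ transDomain x x') (u w : E) :
    metricInChart g x y u w = metricInChart g x' (trans x x' y) (fderiv ℂ (trans x x') y u)
      (fderiv ℂ (trans x x') y w) := by
  rw [metricInChart, metricInChart, symm_trans hy, chartDiff_comp hy]
  rfl

omit [FiniteDimensional ℂ E] in
theorem fderiv_trans_comp' {x' : Z} (hy : y ∈ transDomain x x') (v : E) :
    fderiv ℂ (trans x x') y (fderiv ℂ (trans x' x) (trans x x' y) v) = v := by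
  have h := fderiv_trans_comp (trans_mem hy)
  rw [trans_trans hy] at h
  exact DFunLike.congr_fun h v

omit [FiniteDimensional ℂ E] in
theorem differentiableAt_fderiv_trans {x' : Z} (hy : y ∈ transDomain x x') :
    DifferentiableAt ℂ (fderiv ℂ (trans x x')) y := by
  have h : ContDiffOn ℂ ω (fderiv ℂ (trans (E := E) x x')) (transDomain x x') :=
    (contDiffOn_trans x x').fderiv_of_isOpen (isOpen_transDomain x x') (by simp)
  exact (h.differentiableOn (by simp)).differentiableAt ((isOpen_transDomain x x').mem_nhds hy)

omit [NormedSpace ℂ E] [FiniteDimensional ℂ E] [IsManifold 𝓘(ℂ, E) ω Z] in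
theorem mapsTo_trans_mem {x' : Z} (hy : y ∈ transDomain x x') (hyS : y ∈ chartSet S x) :
    trans x x' y ∈ chartSet S x' := mapsTo_trans S x x' ⟨hyS, hy⟩

/-- The transformation of the Christoffel symbols under a change of charts. -/
theorem christoffel_trans (hS : IsOpen S) (hg : IsHermitianMetric S g) (hyS : y ∈ chartSet S x)
    {x' : Z} (hy : y ∈ transDomain x x') (v u : E) :
    fderiv ℂ (trans x x') y (christoffel g x y v u) =
      fderiv ℂ (fderiv ℂ (trans x x')) y v u + christoffel g x' (trans x x' y)
        (fderiv ℂ (trans x x') y v) (fderiv ℂ (trans x x') y u) := by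
  set f := trans (E := E) x x' with hf
  set b := Module.finBasis ℂ E
  have hyS' : f y ∈ chartSet S x' := mapsTo_trans_mem hy hyS
  have hfd : DifferentiableAt ℂ f y := differentiableAt_trans hy
  have hf2 := differentiableAt_fderiv_trans hy
  refine metricInChart_injective hg hyS' fun w' => ?_
  obtain ⟨w, rfl⟩ : ∃ w, fderiv ℂ f y w = w' := ⟨_, fderiv_trans_comp' hy w'⟩
  have hU : ∀ (i) (u : E), DifferentiableAt ℂ
      (fun z => LinearMap.toContinuousLinearMap (b.coord i) (fderiv ℂ f z u)) y := fun i u =>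
    (LinearMap.toContinuousLinearMap (b.coord i)).differentiableAt.comp y
      (hf2.clm_apply (differentiableAt_const u))
  have hU' : ∀ (i) (u v : E), fderiv ℂ
      (fun z => LinearMap.toContinuousLinearMap (b.coord i) (fderiv ℂ f z u)) y v =
      b.coord i (fderiv ℂ (fderiv ℂ f) y v u) := by
    intro i u v
    have h1 := ((LinearMap.toContinuousLinearMap (b.coord i)).hasFDerivAt.comp y
      (hf2.hasFDerivAt.clm_apply (hasFDerivAt_const u y))).fderiv
    have h2 : fderiv ℂ
      (fun z => LinearMap.toContinuousLinearMap (b.coord i) (fderiv ℂ f z u)) y = _ := h1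
    rw [h2]
    simp
    rfl
  have hG : ∀ i j, DifferentiableAt ℝ (fun z => metricMatrix g x' (f z) i j) y := fun i j =>
    ((contDiffAt_metricMatrix hS hg hyS' i j).differentiableAt (by simp)).comp y
      (hfd.restrictScalars ℝ)
  have hC : ∀ j, DifferentiableAt ℝ (fun z => conj (b.coord j (fderiv ℂ f z w))) y := fun j =>
    (Complex.conjCLE : ℂ →L[ℝ] ℂ).differentiableAt.comp y ((hU j w).restrictScalars ℝ)
  have hUR : ∀ i, DifferentiableAt ℝ (fun z => b.coord i (fderiv ℂ f z u)) y := fun i =>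
    (hU i u).restrictScalars ℝ
  have h1 : del (fun z => metricInChart g x z u w) y = del (fun z => ∑ i, ∑ j,
      b.coord i (fderiv ℂ f z u) * conj (b.coord j (fderiv ℂ f z w)) *
        metricMatrix g x' (f z) i j) y := by
    refine del_congr ?_
    filter_upwards [(isOpen_transDomain x x').mem_nhds hy] with z hz
    rw [metricInChart_trans hz, metricInChart_eq]
  have h2 : ∀ i j, del (fun z => b.coord i (fderiv ℂ f z u) *
      conj (b.coord j (fderiv ℂ f z w)) * metricMatrix g x' (f z) i j) y v =
      b.coord i (fderiv ℂ f y u) * conj (b.coord j (fderiv ℂ f y w)) *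
        del (fun z => metricMatrix g x' z i j) (f y) (fderiv ℂ f y v) +
      b.coord i (fderiv ℂ (fderiv ℂ f) y v u) * conj (b.coord j (fderiv ℂ f y w)) *
        metricMatrix g x' (f y) i j := by
    intro i j
    have hUC : DifferentiableAt ℝ (fun z => b.coord i (fderiv ℂ f z u) *
      conj (b.coord j (fderiv ℂ f z w))) y := (hUR i).mul (hC j)
    rw [del_mul hUC (hG i j), del_mul (hUR i) (hC j)]
    have e1 : del (fun z => b.coord i (fderiv ℂ f z u)) y v =
        b.coord i (fderiv ℂ (fderiv ℂ f) y v u) := (del_holomorphic (hU i u)).trans (hU' i u v)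
    have e2 : del (fun z => conj (b.coord j (fderiv ℂ f z w))) y v = 0 :=
      del_conj_holomorphic (hU j w)
    have e3 : del (fun z => metricMatrix g x' (f z) i j) y v =
        del (fun z => metricMatrix g x' z i j) (f y) (fderiv ℂ f y v) :=
      del_comp (F := fun z => metricMatrix g x' z i j)
        ((contDiffAt_metricMatrix hS hg hyS' i j).differentiableAt (by simp)) hfd
    rw [e1, e2, e3]
    ring
  have hd : ∀ i j, DifferentiableAt ℝ (fun z => b.coord i (fderiv ℂ f z u) *
      conj (b.coord j (fderiv ℂ f z w)) * metricMatrix g x' (f z) i j) y := fun i j =>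
    ((hUR i).mul (hC j)).mul (hG i j)
  have h3 : ∀ U W : E, del (fun z => metricInChart g x' z U W) (f y) (fderiv ℂ f y v) =
      ∑ i, ∑ j, b.coord i U * conj (b.coord j W) *
        del (fun z => metricMatrix g x' z i j) (f y) (fderiv ℂ f y v) := by
    intro U W
    have hd' : ∀ i j, DifferentiableAt ℝ (fun z => metricMatrix g x' z i j) (f y) := fun i j =>
      (contDiffAt_metricMatrix hS hg hyS' i j).differentiableAt (by simp)
    have e : (fun z => metricInChart g x' z U W) = fun z => ∑ i, ∑ j,
        (b.coord i U * conj (b.coord j W)) * metricMatrix g x' z i j := by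
      funext z; exact metricInChart_eq U W
    have hd2 : ∀ i j, DifferentiableAt ℝ
        (fun z => (b.coord i U * conj (b.coord j W)) * metricMatrix g x' z i j) (f y) :=
      fun i j => (differentiableAt_const _).mul (hd' i j)
    rw [e, del_sum _ fun i _ => DifferentiableAt.fun_sum fun j _ => hd2 i j]
    refine Finset.sum_congr rfl fun i _ => ?_
    rw [del_sum _ fun j _ => hd2 i j]
    refine Finset.sum_congr rfl fun j _ => ?_
    rw [del_mul (differentiableAt_const _) (hd' i j)]
    simp [del_apply]
  have hadd : ∀ a c W : E, metricInChart g x' (f y) (a + c) W =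
      metricInChart g x' (f y) a W + metricInChart g x' (f y) c W := by
    intro a c W; simp [metricInChart]
  rw [← metricInChart_trans hy, metricInChart_christoffel hS hg hyS, h1,
    del_sum _ fun i _ => DifferentiableAt.fun_sum fun j _ => hd i j, hadd,
    metricInChart_christoffel hS hg hyS', h3, metricInChart_eq (fderiv ℂ (fderiv ℂ f) y v u)]
  rw [add_comm, ← Finset.sum_add_distrib]
  refine Finset.sum_congr rfl fun i _ => ?_
  rw [del_sum _ fun j _ => hd i j, ← Finset.sum_add_distrib]
  exact Finset.sum_congr rfl fun j _ => h2 i j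

/-- The covariant derivative in the coordinates of an arbitrary chart. -/
theorem chernCov_chartDiff (hS : IsOpen S) (hg : IsHermitianMetric S g) (hyS : y ∈ chartSet S x)
    {V : Z → E} (hV : DifferentiableAt ℝ (vecInChart x V) y) (v : E) :
    chernCov g V ((chartAt E x).symm y) (chartDiff x y v) =
      chartDiff x y (fderiv ℝ (vecInChart x V) y v + christoffel g x y v (vecInChart x V y)) := by
  set x' := (chartAt E x).symm y with hx'
  have hy : y ∈ transDomain x x' := mem_transDomain_self hyS.1
  set f := trans (E := E) x x' with hf
  have hfy : chartAt E x' x' = f y := rfl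
  have hD : chartDiff x y = fderiv ℂ f y := chartDiff_eq hyS.1
  have h1 : chernCov g V x' (fderiv ℂ f y v) = fderiv ℝ (vecInChart x' V) (f y) (fderiv ℂ f y v) +
      christoffel g x' (f y) (fderiv ℂ f y v) (V x') := by
    simp [chernCov, christoffel, chernCoord, chernAt, hfy, smul_smul]
  have hback : DifferentiableAt ℝ (vecInChart x' V) (f y) := by
    have hy' := trans_mem hy
    have e : vecInChart x' V =ᶠ[𝓝 (f y)] fun z =>
        fderiv ℂ f (trans x' x z) (vecInChart x V (trans x' x z)) := by
      filter_upwards [(isOpen_transDomain x' x).mem_nhds hy'] with z hz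
      have h := vecInChart_trans (trans_mem hz) V
      rwa [trans_trans hz] at h
    refine DifferentiableAt.congr_of_eventuallyEq ?_ e
    have ht : DifferentiableAt ℝ (trans x' x) (f y) :=
      (differentiableAt_trans hy').restrictScalars ℝ
    have hyy : trans x' x (f y) = y := trans_trans hy
    have hA : DifferentiableAt ℝ (fun z => (fderiv ℂ f (trans x' x z)).restrictScalars ℝ) (f y) := by
      have h := (((contDiffOn_fderiv_trans x x').contDiffAt
        ((isOpen_transDomain x x').mem_nhds hy)).differentiableAt (by simp))
      rw [← hyy] at h
      exact h.comp (f y) ht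
    have hB : DifferentiableAt ℝ (fun z => vecInChart x V (trans x' x z)) (f y) := by
      rw [← hyy] at hV
      exact hV.comp (f y) ht
    exact hA.clm_apply hB
  have h2 : fderiv ℝ (vecInChart x' V) (f y) (fderiv ℂ f y v) =
      fderiv ℂ (fderiv ℂ f) y v (vecInChart x V y) +
        fderiv ℂ f y (fderiv ℝ (vecInChart x V) y v) := by
    have e1 : fderiv ℝ (fun z => vecInChart x' V (f z)) y v =
        fderiv ℝ (vecInChart x' V) (f y) (fderiv ℂ f y v) := by
      have h := fderiv_comp y hback ((differentiableAt_trans hy).restrictScalars ℝ)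
      have h' : fderiv ℝ (fun z => vecInChart x' V (f z)) y = _ := h
      rw [h', (differentiableAt_trans hy).fderiv_restrictScalars ℝ]
      rfl
    have e2 : (fun z => vecInChart x' V (f z)) =ᶠ[𝓝 y] fun z =>
        fderiv ℂ f z (vecInChart x V z) := by
      filter_upwards [(isOpen_transDomain x x').mem_nhds hy] with z hz
      exact vecInChart_trans hz V
    have hA : HasFDerivAt (fun z => (fderiv ℂ f z).restrictScalars ℝ)
        ((ContinuousLinearMap.restrictScalarsL ℂ E E ℝ ℝ).comp
          ((fderiv ℂ (fderiv ℂ f) y).restrictScalars ℝ)) y :=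
      (ContinuousLinearMap.restrictScalarsL ℂ E E ℝ ℝ).hasFDerivAt.comp y
        ((differentiableAt_fderiv_trans hy).hasFDerivAt.restrictScalars ℝ)
    have e3 := (hA.clm_apply hV.hasFDerivAt).fderiv
    have e3' : fderiv ℝ (fun z => fderiv ℂ f z (vecInChart x V z)) y = _ := e3
    rw [← e1, e2.fderiv_eq, e3']
    simp [add_comm]
  have h3 : V x' = fderiv ℂ f y (vecInChart x V y) := by
    rw [← hD, chartDiff_vecInChart hyS.1]
  rw [hD, h1, h2, h3, map_add, christoffel_trans hS hg hyS hy]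
  abel

end Chern


/-! ### The complex Hessian in a chart -/

section Hessian

variable {E : Type*} [NormedAddCommGroup E] [NormedSpace ℂ E]

/-- The coefficients `∂_v ∂̄_w F`. -/
def hessAt (F : E → ℂ) (y v w : E) : ℂ := del (fun z => delbar F z w) y v

variable {F : E → ℂ} {y : E}

theorem del_const_mul (c : ℂ) (hF : DifferentiableAt ℝ F y) (v : E) :
    del (fun z => c * F z) y v = c * del F y v := by
  rw [del_mul (differentiableAt_const _) hF]
  simp [del_apply]

theorem hessAt_sum_right {ι : Type*} (s : Finset ι) (hF : ContDiffAt ℝ ∞ F y) (v : E)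
    (c : ι → ℂ) (w : ι → E) :
    hessAt F y v (∑ i ∈ s, c i • w i) = ∑ i ∈ s, conj (c i) * hessAt F y v (w i) := by
  have hd : ∀ w, DifferentiableAt ℝ (fun z => delbar F z w) y := fun w =>
    (contDiffAt_delbar hF w).differentiableAt (by simp)
  unfold hessAt
  simp only [delbar_sum_right, delbar_smul_right]
  rw [del_sum _ fun i _ => (hd (w i)).const_mul _]
  exact Finset.sum_congr rfl fun i _ => del_const_mul _ (hd _) _

theorem delbar_ofReal (h : E → ℝ) (y v : E) (hh : DifferentiableAt ℝ h y) :
    delbar (fun z => (h z : ℂ)) y v = conj (del (fun z => (h z : ℂ)) y v) := by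
  have h1 : fderiv ℝ (fun z => (h z : ℂ)) y = Complex.ofRealCLM.comp (fderiv ℝ h y) :=
    (Complex.ofRealCLM.hasFDerivAt.comp y hh.hasFDerivAt).fderiv
  have h2 : conj (2 : ℂ) = 2 := map_ofNat _ 2
  rw [delbar, del_apply, h1]
  simp [h2]

variable [FiniteDimensional ℂ E]

/-- The complex Hessian is natural under holomorphic maps: the terms with derivatives of the
antiholomorphic factor `conj (∂f)` vanish. -/
theorem hessAt_comp {f : E → E} {O : Set E} (hO : IsOpen O) (hy : y ∈ O)
    (hf : DifferentiableOn ℂ f O) (hf2 : DifferentiableAt ℂ (fderiv ℂ f) y)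
    (hF : ∀ z ∈ O, ContDiffAt ℝ ∞ F (f z)) (v w : E) :
    hessAt (fun z => F (f z)) y v w = hessAt F (f y) (fderiv ℂ f y v) (fderiv ℂ f y w) := by
  set b := Module.finBasis ℂ E
  have hfy : DifferentiableAt ℂ f y := hf.differentiableAt (hO.mem_nhds hy)
  have hU : ∀ j, DifferentiableAt ℂ
      (fun z => LinearMap.toContinuousLinearMap (b.coord j) (fderiv ℂ f z w)) y := fun j =>
    (LinearMap.toContinuousLinearMap (b.coord j)).differentiableAt.comp y
      (hf2.clm_apply (differentiableAt_const w))
  have hC : ∀ j, DifferentiableAt ℝ (fun z => conj (b.coord j (fderiv ℂ f z w))) y := fun j =>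
    (Complex.conjCLE : ℂ →L[ℝ] ℂ).differentiableAt.comp y ((hU j).restrictScalars ℝ)
  have hB : ∀ j, DifferentiableAt ℝ (fun z => delbar F (f z) (b j)) y := fun j =>
    DifferentiableAt.comp (g := fun z => delbar F z (b j)) y
      ((contDiffAt_delbar (hF y hy) (b j)).differentiableAt (by simp)) (hfy.restrictScalars ℝ)
  have h1 : del (fun z => delbar (fun z => F (f z)) z w) y = del (fun z => ∑ j,
      conj (b.coord j (fderiv ℂ f z w)) * delbar F (f z) (b j)) y := by
    refine del_congr ?_
    filter_upwards [hO.mem_nhds hy] with z hz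
    rw [delbar_comp ((hF z hz).differentiableAt (by simp)) (hf.differentiableAt (hO.mem_nhds hz))]
    conv_lhs => rw [← b.sum_repr (fderiv ℂ f z w)]
    rw [delbar_sum_right]
    simp only [delbar_smul_right]
    rfl
  have hCB : ∀ j, DifferentiableAt ℝ
      (fun z => conj (b.coord j (fderiv ℂ f z w)) * delbar F (f z) (b j)) y := fun j =>
    (hC j).mul (hB j)
  rw [hessAt, h1, del_sum _ fun j _ => hCB j]
  conv_rhs => rw [← b.sum_repr (fderiv ℂ f y w)]
  rw [hessAt_sum_right _ (hF y hy)]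
  refine Finset.sum_congr rfl fun j _ => ?_
  have e1 : del (fun z => conj (b.coord j (fderiv ℂ f z w))) y v = 0 :=
    del_conj_holomorphic (hU j)
  have e2 : del (fun z => delbar F (f z) (b j)) y v =
      hessAt F (f y) (fderiv ℂ f y v) (b j) :=
    del_comp (F := fun z => delbar F z (b j))
      ((contDiffAt_delbar (hF y hy) (b j)).differentiableAt (by simp)) hfy
  rw [del_mul (hC j) (hB j), e1, e2, zero_mul, add_zero]
  rfl

variable {Z : Type*} [TopologicalSpace Z] [ChartedSpace E Z]

/-- A real function in the chart at `x`, as a complex-valued function. -/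
def funInChart (h : Z → ℝ) (x : Z) (y : E) : ℂ := (h ((chartAt E x).symm y) : ℂ)

omit [FiniteDimensional ℂ E] [NormedSpace ℂ E] in
theorem funInChart_trans (h : Z → ℝ) {x x' : Z} {y : E} (hy : y ∈ transDomain x x') :
    funInChart h x y = funInChart h x' (trans x x' y) := by
  rw [funInChart, funInChart, symm_trans hy]

variable [IsManifold 𝓘(ℂ, E) ω Z]

omit [FiniteDimensional ℂ E] in
theorem delM_chartDiff {h : Z → ℝ} {x : Z} {y : E} (hy : y ∈ (chartAt E x).target)
    (hh : DifferentiableAt ℝ (funInChart h ((chartAt E x).symm y))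
      (trans x ((chartAt E x).symm y) y)) (v : E) :
    delM h ((chartAt E x).symm y) (chartDiff x y v) = del (funInChart h x) y v := by
  have hy' := mem_transDomain_self hy
  have h1 : del (funInChart h x) y = del (fun z => funInChart h ((chartAt E x).symm y)
      (trans x ((chartAt E x).symm y) z)) y := by
    refine del_congr ?_
    filter_upwards [(isOpen_transDomain _ _).mem_nhds hy'] with z hz
    exact funInChart_trans h hz
  rw [h1, del_comp hh (differentiableAt_trans hy'), chartDiff_eq hy]
  rfl

theorem complexHessian_chartDiff {h : Z → ℝ} {S : Set Z} {x : Z} {y : E} (hS : IsOpen S)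
    (hh : ∀ (x : Z), ∀ y ∈ chartSet S x, ContDiffAt ℝ ∞ (funInChart (E := E) h x) y)
    (hy : y ∈ chartSet S x) (v w : E) :
    complexHessian h ((chartAt E x).symm y) (chartDiff x y v) (chartDiff x y w) =
      hessAt (funInChart h x) y v w := by
  set x' := (chartAt E x).symm y with hx'
  have hy' : y ∈ transDomain x x' := mem_transDomain_self hy.1
  have hO : IsOpen (transDomain x x' ∩ chartSet S x) :=
    (isOpen_transDomain _ _).inter ((chartAt E x).isOpen_inter_preimage_symm hS)
  have h1 := hessAt_comp (F := funInChart h x') (f := trans x x') hO ⟨hy', hy⟩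
    (fun z hz => (differentiableAt_trans hz.1).differentiableWithinAt)
    (differentiableAt_fderiv_trans hy')
    (fun z hz => hh x' _ (mapsTo_trans_mem hz.1 hz.2)) v w
  have h2 : hessAt (funInChart h x) y v w =
      hessAt (fun z => funInChart h x' (trans x x' z)) y v w := by
    have e : (fun z => delbar (funInChart h x) z w) =ᶠ[𝓝 y]
        fun z => delbar (fun z => funInChart h x' (trans x x' z)) z w := by
      filter_upwards [(isOpen_transDomain x x').mem_nhds hy'] with z hz
      refine delbar_congr ?_ w
      filter_upwards [(isOpen_transDomain x x').mem_nhds hz] with z' hz'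
      exact funInChart_trans h hz'
    rw [hessAt, del_congr e]
    rfl
  rw [h2, h1, chartDiff_eq hy.1]
  rfl

omit [FiniteDimensional ℂ E] in
theorem contDiffAt_funInChart {ρ : Z → ℝ} (hρ : ContMDiff 𝓘(ℝ, E) 𝓘(ℝ, ℝ) ∞ ρ) {x : Z} {y : E}
    (hy : y ∈ (chartAt E x).target) :
    ContDiffAt ℝ ∞ (fun z => ρ ((chartAt E x).symm z)) y := by
  set x' := (chartAt E x).symm y with hx'
  have hy' : y ∈ transDomain x x' := mem_transDomain_self hy
  have h1 : ContDiffAt ℝ ∞ (fun z => ρ ((chartAt E x').symm z)) (trans x x' y) := by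
    have h := (contMDiffAt_iff.mp (hρ x')).2
    simpa [mfld_simps, contDiffWithinAt_univ, Function.comp_def, trans, ← hx',
      chartAt_self_eq] using h
  have h2 : ContDiffAt ℝ ∞ (fun z => ρ ((chartAt E x').symm (trans x x' z))) y :=
    h1.comp y ((contDiffOn_real_trans x x').contDiffAt ((isOpen_transDomain x x').mem_nhds hy'))
  refine h2.congr_of_eventuallyEq ?_
  filter_upwards [(isOpen_transDomain x x').mem_nhds hy'] with z hz
  rw [symm_trans hz]

end Hessian

/-! ### The renormalized connection near the boundary -/

section Boundary

variable {E : Type*} [NormedAddCommGroup E] [NormedSpace ℂ E]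

theorem contDiffWithinAt_inv_matrix {F ι : Type*} [NormedAddCommGroup F] [NormedSpace ℝ F]
    [Fintype ι] [DecidableEq ι] {A : F → Matrix ι ι ℂ} {s : Set F} {y : F}
    (hA : ∀ i j, ContDiffWithinAt ℝ ∞ (fun z => A z i j) s y) (hdet : (A y).det ≠ 0) (i j : ι) :
    ContDiffWithinAt ℝ ∞ (fun z => (A z)⁻¹ i j) s y := by
  have hd : ∀ B : F → Matrix ι ι ℂ, (∀ i j, ContDiffWithinAt ℝ ∞ (fun z => B z i j) s y) →
      ContDiffWithinAt ℝ ∞ (fun z => (B z).det) s y := by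
    intro B hB
    simp only [Matrix.det_apply']
    exact ContDiffWithinAt.sum fun σ _ =>
      contDiffWithinAt_const.mul (contDiffWithinAt_prod fun i _ => hB _ _)
  have h1 : (fun z => (A z)⁻¹ i j) = fun z => ((A z).det)⁻¹ * (A z).adjugate i j := by
    funext z
    rw [Matrix.inv_def, Ring.inverse_eq_inv', Matrix.smul_apply, smul_eq_mul]
  rw [h1]
  refine ((hd A hA).inv hdet).mul ?_
  simp only [Matrix.adjugate_apply]
  refine hd _ fun k l => ?_
  by_cases hk : k = j
  · subst hk
    simp only [Matrix.updateRow_self]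
    exact contDiffWithinAt_const
  · simp only [Matrix.updateRow_ne hk]
    exact hA k l

theorem contDiffAt_inv_matrix {F ι : Type*} [NormedAddCommGroup F] [NormedSpace ℝ F] [Fintype ι]
    [DecidableEq ι] {A : F → Matrix ι ι ℂ} {y : F}
    (hA : ∀ i j, ContDiffAt ℝ ∞ (fun z => A z i j) y) (hdet : (A y).det ≠ 0) (i j : ι) :
    ContDiffAt ℝ ∞ (fun z => (A z)⁻¹ i j) y :=
  contDiffWithinAt_univ.mp (contDiffWithinAt_inv_matrix
    (fun i j => contDiffWithinAt_univ.mpr (hA i j)) hdet i j)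

theorem hasFDerivAt_log_inv {h : E → ℝ} {y : E} (hd : DifferentiableAt ℝ h y) (h0 : h y ≠ 0) :
    HasFDerivAt (fun z => (Real.log (-1 / h z) : ℂ))
      ((-(h y : ℂ))⁻¹ • fderiv ℝ (fun z => (h z : ℂ)) y) y := by
  have e : (fun z => (Real.log (-1 / h z) : ℂ)) = fun z => ((-Real.log (h z) : ℝ) : ℂ) := by
    funext z
    rw [neg_div, Real.log_neg_eq_log, one_div, Real.log_inv]
  rw [e]
  have h1 := Complex.ofRealCLM.hasFDerivAt.comp y ((hd.hasFDerivAt.log h0).neg)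
  have h2 : fderiv ℝ (fun z => (h z : ℂ)) y = Complex.ofRealCLM.comp (fderiv ℝ h y) :=
    (Complex.ofRealCLM.hasFDerivAt.comp y hd.hasFDerivAt).fderiv
  rw [h2]
  have h3 : (-(h y : ℂ))⁻¹ • Complex.ofRealCLM.comp (fderiv ℝ h y) =
      Complex.ofRealCLM.comp (-((h y)⁻¹ • fderiv ℝ h y)) := by
    ext v
    simp [inv_neg]
  rw [h3]
  exact h1

theorem del_neg_inv {F : E → ℂ} {y : E} (hd : DifferentiableAt ℝ F y) (hne : -F y ≠ 0) (v : E) :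
    del (fun z => (-F z)⁻¹) y v = del F y v * (-F y)⁻¹ ^ 2 := by
  have hn : DifferentiableAt ℝ (fun z => -F z) y := hd.neg
  have hi : DifferentiableAt ℝ (fun z => (-F z)⁻¹) y := hn.inv hne
  have h2 : del (fun z => -F z) y v = -del F y v := by
    have := del_const_mul (-1) hd v
    simpa using this
  -- differentiate `(-F)⁻¹ * (-F) = 1`
  have h3 : del (fun z => (-F z)⁻¹ * -F z) y v = 0 := by
    have e : (fun z => (-F z)⁻¹ * -F z) =ᶠ[𝓝 y] fun _ => 1 := by
      filter_upwards [hn.continuousAt.eventually_ne hne] with z hz using inv_mul_cancel₀ hz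
    rw [del_congr e]
    simp [del_apply]
  rw [del_mul hi hn, h2] at h3
  have hk := inv_mul_cancel₀ hne
  linear_combination (-F y)⁻¹ * h3 - del (fun z => (-F z)⁻¹) y v * hk

/-- `∂∂̄ log(-1/h) = (-h)⁻¹ ∂∂̄h + (-h)⁻² ∂h ∂̄h` -/
theorem hessAt_log {h : E → ℝ} {O : Set E} (hO : IsOpen O) (hh : ContDiffOn ℝ ∞ h O)
    (h0 : ∀ z ∈ O, h z < 0) {y : E} (hy : y ∈ O) (v w : E) :
    hessAt (fun z => (Real.log (-1 / h z) : ℂ)) y v w =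
      hessAt (fun z => (h z : ℂ)) y v w * (-(h y : ℂ))⁻¹ +
        del (fun z => (h z : ℂ)) y v * delbar (fun z => (h z : ℂ)) y w * (-(h y : ℂ))⁻¹ ^ 2 := by
  have hr : ∀ z ∈ O, ContDiffAt ℝ ∞ h z := fun z hz => hh.contDiffAt (hO.mem_nhds hz)
  have hc : ∀ z ∈ O, ContDiffAt ℝ ∞ (fun z => (h z : ℂ)) z := fun z hz =>
    Complex.ofRealCLM.contDiff.contDiffAt.comp z (hr z hz)
  have hne : -(h y : ℂ) ≠ 0 := neg_ne_zero.mpr (Complex.ofReal_ne_zero.mpr (h0 y hy).ne)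
  have h1 : (fun z => delbar (fun z => (Real.log (-1 / h z) : ℂ)) z w) =ᶠ[𝓝 y]
      fun z => delbar (fun z => (h z : ℂ)) z w * (-(h z : ℂ))⁻¹ := by
    filter_upwards [hO.mem_nhds hy] with z hz
    rw [delbar, delbar, (hasFDerivAt_log_inv ((hr z hz).differentiableAt (by simp))
      (h0 z hz).ne).fderiv]
    simp only [smul_apply, smul_eq_mul]
    ring
  have hd : DifferentiableAt ℝ (fun z => (h z : ℂ)) y := (hc y hy).differentiableAt (by simp)
  have hi : DifferentiableAt ℝ (fun z => (-(h z : ℂ))⁻¹) y := hd.neg.inv hne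
  have hb : DifferentiableAt ℝ (fun z => delbar (fun z => (h z : ℂ)) z w) y :=
    (contDiffAt_delbar (hc y hy) w).differentiableAt (by simp)
  rw [hessAt, del_congr h1, del_mul hb hi, del_neg_inv hd hne]
  unfold hessAt
  ring

end Boundary


section RenormalizedConnection

variable {E : Type*} [NormedAddCommGroup E] [NormedSpace ℂ E] [FiniteDimensional ℂ E]

/-- The complex Hessian of `F` bordered by `∂F`, `∂̄F` and `F`. It stays invertible
at strictly pseudoconvex boundary points `F = 0`. -/
def borderedHessian (F : E → ℂ) (y : E) :
    Matrix (Fin (Module.finrank ℂ E) ⊕ Unit) (Fin (Module.finrank ℂ E) ⊕ Unit) ℂ :=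
  Matrix.fromBlocks
    (Matrix.of fun j l => hessAt F y (Module.finBasis ℂ E j) (Module.finBasis ℂ E l))
    (Matrix.of fun j _ => del F y (Module.finBasis ℂ E j))
    (Matrix.of fun _ l => delbar F y (Module.finBasis ℂ E l))
    (Matrix.of fun _ _ => F y)

omit [FiniteDimensional ℂ E] in
theorem contDiffAt_hessAt {F : E → ℂ} {y : E} (hF : ContDiffAt ℝ ∞ F y) (v w : E) :
    ContDiffAt ℝ ∞ (fun z => hessAt F z v w) y :=
  contDiffAt_del_apply (contDiffAt_delbar hF w) v

theorem contDiffAt_borderedHessian {F : E → ℂ} {y : E} (hF : ContDiffAt ℝ ∞ F y)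
    (i j : Fin (Module.finrank ℂ E) ⊕ Unit) :
    ContDiffAt ℝ ∞ (fun z => borderedHessian F z i j) y := by
  rcases i with i | i <;> rcases j with j | j
  · exact contDiffAt_hessAt hF _ _
  · exact contDiffAt_del_apply hF _
  · exact contDiffAt_delbar hF _
  · exact hF

/-- At a boundary point the bordered Hessian is invertible. -/
theorem det_borderedHessian_ne_zero {h : E → ℝ} {y : E} (hh : ContDiffAt ℝ ∞ h y)
    (h0 : h y = 0) (hd : fderiv ℝ h y ≠ 0)
    (hpos : ∀ v : E, v ≠ 0 → del (fun z => (h z : ℂ)) y v = 0 →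
      0 < (hessAt (fun z => (h z : ℂ)) y v v).re) :
    (borderedHessian (fun z => (h z : ℂ)) y).det ≠ 0 := by
  set b := Module.finBasis ℂ E with hb
  set F : E → ℂ := fun z => (h z : ℂ) with hF
  have hFs : ContDiffAt ℝ ∞ F y := Complex.ofRealCLM.contDiff.contDiffAt.comp y hh
  have hdb : ∀ v, delbar F y v = conj (del F y v) := fun v =>
    delbar_ofReal h y v (hh.differentiableAt (by simp))
  intro hdet
  obtain ⟨c, hc, hc0⟩ := Matrix.exists_vecMul_eq_zero_iff.mpr hdet
  have e1 : ∀ l, ∑ j, c (.inl j) * hessAt F y (b j) (b l) + c (.inr ()) * delbar F y (b l) = 0 := by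
    intro l
    have := congrFun hc0 (.inl l)
    simpa [Matrix.vecMul, dotProduct, borderedHessian, Fintype.sum_sum_type] using this
  have e2 : ∑ j, c (.inl j) * del F y (b j) = 0 := by
    have := congrFun hc0 (.inr ())
    simpa [Matrix.vecMul, dotProduct, borderedHessian, Fintype.sum_sum_type, hF, h0] using this
  -- A row vector in the kernel consists of `z` with `∂ρ(z) = 0` and of a number `s` such that
  -- `L(z, ·) = -s ∂̄ρ`; then `L(z, z) = 0`, and `z` vanishes by strict pseudoconvexity.
  set z : E := ∑ j, c (.inl j) • b j with hz
  have hz1 : del F y z = 0 := by rw [hz, map_sum]; simpa using e2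
  have hz2 : hessAt F y z z = 0 := by
    have h1 : ∀ l, hessAt F y z (b l) = -c (.inr ()) * delbar F y (b l) := by
      intro l
      have : hessAt F y z (b l) = ∑ j, c (.inl j) * hessAt F y (b j) (b l) := by
        unfold hessAt
        rw [hz, map_sum]
        simp
      rw [this]
      linear_combination e1 l
    have h2 : hessAt F y z z = ∑ l, conj (c (.inl l)) * hessAt F y z (b l) := by
      conv_lhs => rw [hz]
      rw [← hz, hessAt_sum_right _ hFs]
    rw [h2]
    simp only [h1, hdb]
    have h3 := congrArg conj e2
    rw [map_sum, map_zero] at h3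
    simp only [map_mul] at h3
    calc _ = -c (.inr ()) * ∑ l, conj (c (.inl l)) * conj (del F y (b l)) := by
          rw [Finset.mul_sum]; exact Finset.sum_congr rfl fun l _ => by ring
      _ = 0 := by rw [h3, mul_zero]
  have hz0 : z = 0 := by
    by_contra hne
    have := hpos z hne hz1
    rw [hz2] at this
    simp at this
  have hcl : ∀ j, c (.inl j) = 0 := by
    have := Fintype.linearIndependent_iff.mp b.linearIndependent (fun j => c (.inl j)) hz0
    exact this
  have hs : c (.inr ()) ≠ 0 := by
    intro hs
    refine hc (funext fun i => ?_)
    rcases i with j | j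
    · exact hcl j
    · exact hs
  have hq : del F y = 0 := by
    have h1 : ∀ l, del F y (b l) = 0 := by
      intro l
      have := e1 l
      simp only [hcl, zero_mul, Finset.sum_const_zero, zero_add, hdb] at this
      simpa using (mul_eq_zero.mp this).resolve_left hs
    refine ContinuousLinearMap.coe_injective (b.ext fun l => ?_)
    exact h1 l
  refine hd (ContinuousLinearMap.ext fun v => ?_)
  have h1 : fderiv ℝ F y = Complex.ofRealCLM.comp (fderiv ℝ h y) :=
    (Complex.ofRealCLM.hasFDerivAt.comp y (hh.differentiableAt (by simp)).hasFDerivAt).fderiv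
  have h2 : del F y v = 0 := by rw [hq]; rfl
  rw [del_apply, h1] at h2
  have h3 := congrArg Complex.re h2
  simpa using h3

/-- The connection forms of the renormalized connection in the coordinate frame, where it is
smooth up to the boundary: they solve a linear system with matrix the bordered Hessian. -/
def boundaryConn (F : E → ℂ) (i k : Fin (Module.finrank ℂ E)) (y : E) : E →L[ℂ] ℂ :=
  ∑ l, (borderedHessian F y)⁻¹ (.inl l) (.inl k) •
      del (fun z => hessAt F z (Module.finBasis ℂ E i) (Module.finBasis ℂ E l)) y +
    (borderedHessian F y)⁻¹ (.inr ()) (.inl k) • del (fun z => del F z (Module.finBasis ℂ E i)) y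

theorem contDiffAt_boundaryConn {F : E → ℂ} {y : E} (hF : ContDiffAt ℝ ∞ F y)
    (hdet : (borderedHessian F y).det ≠ 0) (i k : Fin (Module.finrank ℂ E)) (v : E) :
    ContDiffAt ℝ ∞ (fun z => boundaryConn F i k z v) y := by
  have hB := contDiffAt_inv_matrix (contDiffAt_borderedHessian hF) hdet
  simp only [boundaryConn, add_apply, sum_apply, smul_apply, smul_eq_mul]
  exact (ContDiffAt.sum fun l _ => (hB _ _).mul
    (contDiffAt_del_apply (contDiffAt_hessAt hF _ _) v)).add
    ((hB _ _).mul (contDiffAt_del_apply (contDiffAt_del_apply hF _) v))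

/-- The linear system solved by `boundaryConn`. -/
theorem boundaryConn_spec {F : E → ℂ} {y : E} (hdet : (borderedHessian F y).det ≠ 0)
    (i : Fin (Module.finrank ℂ E)) (v : E) : ∃ s : ℂ,
    (∀ l, ∑ k, boundaryConn F i k y v * hessAt F y (Module.finBasis ℂ E k) (Module.finBasis ℂ E l) +
        s * delbar F y (Module.finBasis ℂ E l) =
      del (fun z => hessAt F z (Module.finBasis ℂ E i) (Module.finBasis ℂ E l)) y v) ∧
    ∑ k, boundaryConn F i k y v * del F y (Module.finBasis ℂ E k) + s * F y =
      del (fun z => del F z (Module.finBasis ℂ E i)) y v := by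
  set b := Module.finBasis ℂ E
  set B := borderedHessian F y with hB
  let c : Fin (Module.finrank ℂ E) ⊕ Unit → ℂ :=
    Sum.elim (fun l => del (fun z => hessAt F z (b i) (b l)) y v)
      (fun _ => del (fun z => del F z (b i)) y v)
  have h1 : Matrix.vecMul (Matrix.vecMul c B⁻¹) B = c := by
    rw [Matrix.vecMul_vecMul, Matrix.nonsing_inv_mul _ (isUnit_iff_ne_zero.mpr hdet),
      Matrix.vecMul_one]
  have h2 : ∀ k, Matrix.vecMul c B⁻¹ (.inl k) = boundaryConn F i k y v := by
    intro k
    simp [Matrix.vecMul, dotProduct, boundaryConn, c, Fintype.sum_sum_type, mul_comm, hB, b]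
  refine ⟨Matrix.vecMul c B⁻¹ (.inr ()), fun l => ?_, ?_⟩
  · have := congrFun h1 (.inl l)
    rw [Matrix.vecMul, dotProduct, Fintype.sum_sum_type] at this
    simp only [h2] at this
    simpa [hB, borderedHessian, c] using this
  · have := congrFun h1 (.inr ())
    rw [Matrix.vecMul, dotProduct, Fintype.sum_sum_type] at this
    simp only [h2] at this
    simpa [hB, borderedHessian, c] using this

variable {Z : Type*} [TopologicalSpace Z] [ChartedSpace E Z]

/-- The connection forms of the Chern connection minus
`(-ρ)⁻¹ (δ_i^k ∂ρ + ρ_i dz^k)`, in the coordinate frame of the chart at `x`. -/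
def renormConn (ρ : Z → ℝ) (g : Z → E →L[ℂ] E →L⋆[ℂ] ℂ) (x : Z)
    (i k : Fin (Module.finrank ℂ E)) (y : E) : E →L[ℂ] ℂ :=
  chernAt g x y i k - (-funInChart ρ x y)⁻¹ •
    ((if i = k then del (funInChart ρ x) y else 0) +
      del (funInChart ρ x) y (Module.finBasis ℂ E i) •
        LinearMap.toContinuousLinearMap ((Module.finBasis ℂ E).coord k))

theorem coord_christoffel (g : Z → E →L[ℂ] E →L⋆[ℂ] ℂ) (x : Z) (y v : E)
    (i k : Fin (Module.finrank ℂ E)) :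
    (Module.finBasis ℂ E).coord k (christoffel g x y v (Module.finBasis ℂ E i)) =
      chernAt g x y i k v := by
  simp [christoffel, Finsupp.single_apply]

variable [IsManifold 𝓘(ℂ, E) ω Z]

omit [IsManifold 𝓘(ℂ, E) ω Z] in
theorem metricInChart_sum_right (g : Z → E →L[ℂ] E →L⋆[ℂ] ℂ) (x : Z) (y u w : E) :
    metricInChart g x y u w = ∑ l, conj ((Module.finBasis ℂ E).repr w l) *
      metricInChart g x y u (Module.finBasis ℂ E l) := by
  have h : ∀ c : Fin (Module.finrank ℂ E) → ℂ,
      metricInChart g x y u (∑ l, c l • Module.finBasis ℂ E l) =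
        ∑ l, conj (c l) * metricInChart g x y u (Module.finBasis ℂ E l) := fun c => by
    simp only [metricInChart, map_sum, map_smul, map_smulₛₗ, smul_eq_mul]
  rw [← h, Module.Basis.sum_repr]

theorem metricInChart_injective_basis {g : Z → E →L[ℂ] E →L⋆[ℂ] ℂ} {S : Set Z}
    (hg : IsHermitianMetric S g) {x : Z} {y : E} (hy : y ∈ chartSet S x) {u u' : E}
    (h : ∀ l, metricInChart g x y u (Module.finBasis ℂ E l) =
      metricInChart g x y u' (Module.finBasis ℂ E l)) : u = u' := by
  refine metricInChart_injective hg hy fun w => ?_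
  rw [metricInChart_sum_right, metricInChart_sum_right g x y u']
  simp only [h]

/-- If `g = ∂∂̄ log(-1/ρ)` near `y`, then the renormalized connection forms solve the linear system
of the bordered Hessian of `ρ`. -/
theorem renormConn_eq_boundaryConn {ρ : Z → ℝ} {g : Z → E →L[ℂ] E →L⋆[ℂ] ℂ} {S : Set Z}
    (hS : IsOpen S) (hg : IsHermitianMetric S g) {x : Z} {y : E} (hy : y ∈ chartSet S x)
    {O : Set E} (hO : IsOpen O) (hyO : y ∈ O)
    (hr : ContDiffOn ℝ ∞ (fun z => ρ ((chartAt E x).symm z)) O)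
    (hneg : ∀ z ∈ O, ρ ((chartAt E x).symm z) < 0)
    (hlog : ∀ z ∈ O, ∀ v w, metricInChart g x z v w =
      hessAt (fun z => (Real.log (-1 / ρ ((chartAt E x).symm z)) : ℂ)) z v w)
    (hdet : (borderedHessian (funInChart ρ x) y).det ≠ 0) (i k : Fin (Module.finrank ℂ E)) :
    renormConn ρ g x i k y = boundaryConn (funInChart ρ x) i k y := by
  set b := Module.finBasis ℂ E with hb
  set F : E → ℂ := funInChart ρ x with hF
  set R : E → ℂ := fun z => (-F z)⁻¹ with hR
  have hFs : ∀ z ∈ O, ContDiffAt ℝ ∞ F z := fun z hz =>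
    Complex.ofRealCLM.contDiff.contDiffAt.comp z (hr.contDiffAt (hO.mem_nhds hz))
  have hFne : ∀ z ∈ O, -F z ≠ 0 := fun z hz =>
    neg_ne_zero.mpr (Complex.ofReal_ne_zero.mpr (hneg z hz).ne)
  have hG : ∀ z ∈ O, ∀ v w, metricInChart g x z v w =
      hessAt F z v w * R z + del F z v * delbar F z w * R z ^ 2 := fun z hz v w => by
    rw [hlog z hz]
    exact hessAt_log hO hr hneg hz v w
  ext v
  obtain ⟨s, hs1, hs2⟩ := boundaryConn_spec hdet i v
  set c := boundaryConn F i
  -- The right-hand side is tested against the characterization of the Chern connection; the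
  -- multiplier `s` drops out because of the corner entry `F` of the bordered Hessian.
  have key : christoffel g x y v (b i) =
      ∑ k, c k y v • b k + R y • (del F y v • b i + del F y (b i) • v) := by
    refine metricInChart_injective_basis hg hy fun l => ?_
    rw [metricInChart_christoffel hS hg hy]
    have hH : DifferentiableAt ℝ (fun z => hessAt F z (b i) (b l)) y :=
      (contDiffAt_hessAt (hFs y hyO) _ _).differentiableAt (by simp)
    have hp : DifferentiableAt ℝ (fun z => del F z (b i)) y :=
      (contDiffAt_del_apply (hFs y hyO) _).differentiableAt (by simp)
    have hq : DifferentiableAt ℝ (fun z => delbar F z (b l)) y :=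
      (contDiffAt_delbar (hFs y hyO) _).differentiableAt (by simp)
    have hFd : DifferentiableAt ℝ F y := (hFs y hyO).differentiableAt (by simp)
    have hRd : DifferentiableAt ℝ R y := hFd.neg.inv (hFne y hyO)
    have hRR : DifferentiableAt ℝ (fun z => R z * R z) y := hRd.mul hRd
    have hpq : DifferentiableAt ℝ (fun z => del F z (b i) * delbar F z (b l)) y := hp.mul hq
    have hHR : DifferentiableAt ℝ (fun z => hessAt F z (b i) (b l) * R z) y := hH.mul hRd
    have hpqR : DifferentiableAt ℝ
      (fun z => (del F z (b i) * delbar F z (b l)) * (R z * R z)) y := hpq.mul hRR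
    have e1 : (fun z => metricInChart g x z (b i) (b l)) =ᶠ[𝓝 y] fun z =>
        hessAt F z (b i) (b l) * R z + (del F z (b i) * delbar F z (b l)) * (R z * R z) := by
      filter_upwards [hO.mem_nhds hyO] with z hz
      rw [hG z hz]
      ring
    have e2 : del R y v = del F y v * R y ^ 2 := del_neg_inv hFd (hFne y hyO) v
    have e3 : del (fun z => delbar F z (b l)) y v = hessAt F y v (b l) := rfl
    have e4 : R y * F y = -1 := by
      have := inv_mul_cancel₀ (hFne y hyO)
      linear_combination -this
    rw [del_congr e1, del_add hHR hpqR, del_mul hH hRd, del_mul hpq hRR, del_mul hp hq,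
      del_mul hRd hRd, e2, e3, ← hs1 l, ← hs2, hG y hyO]
    have e5 : ∀ w, hessAt F y (∑ k, c k y v • b k + R y • (del F y v • b i + del F y (b i) • v)) w =
        ∑ k, c k y v * hessAt F y (b k) w +
          R y * (del F y v * hessAt F y (b i) w + del F y (b i) * hessAt F y v w) := by
      intro w
      simp only [hessAt, map_add, map_sum, map_smul, smul_eq_mul]
    have e6 : del F y (∑ k, c k y v • b k + R y • (del F y v • b i + del F y (b i) • v)) =
        ∑ k, c k y v * del F y (b k) +
          R y * (del F y v * del F y (b i) + del F y (b i) * del F y v) := by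
      simp only [map_add, map_sum, map_smul, smul_eq_mul]
    rw [e5, e6]
    simp only [← hb]
    linear_combination (s * delbar F y (b l) * R y) * e4
  have h1 := congrArg (b.coord k) key
  rw [coord_christoffel] at h1
  simp only [renormConn, sub_apply, smul_apply, h1, smul_eq_mul, ← hb, ← hF]
  have h2 : b.coord k (∑ k, c k y v • b k) = c k y v := by
    rw [map_sum]; simp [Finsupp.single_apply]
  rw [map_add, h2]
  by_cases hik : i = k
  · subst hik
    simp [hR]
    ring
  · simp [hik, hR]

omit [IsManifold 𝓘(ℂ, E) ω Z] [FiniteDimensional ℂ E] in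
theorem isOpen_neg {ρ : Z → ℝ} (hρ : IsDefiningFunction (E := E) ρ) : IsOpen {x | ρ x < 0} :=
  isOpen_lt hρ.smooth.continuous continuous_const

omit [IsManifold 𝓘(ℂ, E) ω Z] [FiniteDimensional ℂ E] in
theorem fderiv_ne_zero_center {ρ : Z → ℝ} (hρ : IsDefiningFunction (E := E) ρ) {x : Z}
    (hx : ρ x = 0) : fderiv ℝ (fun z => ρ ((chartAt E x).symm z)) (chartAt E x x) ≠ 0 := by
  have hd : MDifferentiableAt 𝓘(ℝ, E) 𝓘(ℝ, ℝ) ρ x := hρ.smooth.mdifferentiableAt (by simp)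
  have h1 := hd.mfderiv
  intro h0
  refine hρ.d_ne_zero x hx (h1.trans ?_)
  refine Eq.trans ?_ h0
  simp [mfld_simps, fderivWithin_univ, Function.comp_def, writtenInExtChartAt,
    chartAt_self_eq]
  rfl

/-- Near each point of `X̄` the renormalized connection extends smoothly across the boundary. -/
theorem exists_local_connection {ρ : Z → ℝ} {g : Z → E →L[ℂ] E →L⋆[ℂ] ℂ}
    (hρ : IsDefiningFunction (E := E) ρ) (hg : IsHermitianMetric {x | ρ x < 0} g)
    (hgρ : IsLogMetricNearBoundary ρ g) {x : Z} (hx : ρ x ≤ 0) :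
    ∃ O : Set E, IsOpen O ∧ chartAt E x x ∈ O ∧ O ⊆ (chartAt E x).target ∧
      (∀ y ∈ O, ρ ((chartAt E x).symm y) = 0 →
        fderiv ℝ (fun z => ρ ((chartAt E x).symm z)) y ≠ 0) ∧
      ∃ Γ : Fin (Module.finrank ℂ E) → Fin (Module.finrank ℂ E) → E → E →L[ℂ] ℂ,
        (∀ i k v, ContDiffOn ℝ ∞ (fun y => Γ i k y v) O) ∧
        ∀ y ∈ O, ρ ((chartAt E x).symm y) < 0 → ∀ i k, Γ i k y = renormConn ρ g x i k y := by
  have hS : IsOpen {x | ρ x < 0} := isOpen_neg hρ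
  have hcS : IsOpen (chartSet {x | ρ x < 0} x) := (chartAt E x).isOpen_inter_preimage_symm hS
  have hx0 : (chartAt E x).symm (chartAt E x x) = x := (chartAt E x).left_inv (mem_chart_source E x)
  have hr : ∀ x : Z, ∀ y ∈ (chartAt E x).target,
      ContDiffAt ℝ ∞ (fun z => ρ ((chartAt E x).symm z)) y := fun x y hy =>
    contDiffAt_funInChart hρ.smooth hy
  have hF : ∀ x : Z, ∀ y ∈ (chartAt E x).target, ContDiffAt ℝ ∞ (funInChart (E := E) ρ x) y :=
    fun x y hy => Complex.ofRealCLM.contDiff.contDiffAt.comp y (hr x y hy)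
  rcases hx.lt_or_eq with hx | hx
  · refine ⟨chartSet {x | ρ x < 0} x, hcS, ⟨mem_chart_target E x, ?_⟩, fun y hy => hy.1,
      fun y hy h0 => absurd h0 hy.2.ne, renormConn ρ g x, fun i k v y hy => ?_,
      fun y _ _ i k => rfl⟩
    · rwa [mem_preimage, hx0]
    · refine ContDiffAt.contDiffWithinAt ?_
      have hFy := hF x y hy.1
      have hne : -funInChart (E := E) ρ x y ≠ 0 :=
        neg_ne_zero.mpr (Complex.ofReal_ne_zero.mpr (ne_of_lt hy.2))
      have h1 : ContDiffAt ℝ ∞ (fun z => chernAt g x z i k v) y := by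
        simp only [chernAt, sum_apply, smul_apply, smul_eq_mul]
        exact ContDiffAt.sum fun l _ => (contDiffAt_inv_matrix (contDiffAt_metricMatrix hS hg hy)
          (isUnit_det_metricMatrix hg hy).ne_zero _ _).mul
          (contDiffAt_del_apply (contDiffAt_metricMatrix hS hg hy _ _) v)
      have h2 : ContDiffAt ℝ ∞ (fun z => (if i = k then del (funInChart ρ x) z else 0) v +
          del (funInChart ρ x) z (Module.finBasis ℂ E i) * (Module.finBasis ℂ E).coord k v) y := by
        refine ContDiffAt.add ?_ ((contDiffAt_del_apply hFy _).mul contDiffAt_const)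
        split_ifs
        · exact contDiffAt_del_apply hFy _
        · exact contDiffAt_const
      exact h1.sub ((hFy.neg.inv hne).mul h2)
  · set y₀ := chartAt E x x with hy₀
    set h : E → ℝ := fun z => ρ ((chartAt E x).symm z) with hh
    have hy₀t : y₀ ∈ (chartAt E x).target := mem_chart_target E x
    have hdet : (borderedHessian (funInChart ρ x) y₀).det ≠ 0 := by
      refine det_borderedHessian_ne_zero (hr x y₀ hy₀t) ?_ (fderiv_ne_zero_center hρ hx)
        (hρ.pseudoconvex x hx)
      rw [hx0, hx]
    have hdet' : ∀ᶠ y in 𝓝 y₀, (borderedHessian (funInChart ρ x) y).det ≠ 0 := by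
      have : ContinuousAt (fun y => (borderedHessian (funInChart ρ x) y).det) y₀ :=
        Continuous.continuousAt (f := fun M : Matrix _ _ ℂ => M.det)
          (Continuous.matrix_det continuous_id) |>.comp
          (continuousAt_pi.mpr fun i => continuousAt_pi.mpr fun j =>
            (contDiffAt_borderedHessian (hF x y₀ hy₀t) i j).continuousAt)
      exact this.eventually_ne hdet
    have hfd : ∀ᶠ y in 𝓝 y₀, fderiv ℝ h y ≠ 0 :=
      ((hr x y₀ hy₀t).fderiv_right (m := 0) (by simp)).continuousAt.eventually_ne
        (fderiv_ne_zero_center hρ hx)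
    have hlog : ∀ᶠ y in 𝓝 y₀, ρ ((chartAt E x).symm y) < 0 → ∀ v w : E,
        g ((chartAt E x).symm y) v w =
          complexHessian (fun x' => Real.log (-1 / ρ x')) ((chartAt E x).symm y) v w := by
      have h1 : ∀ᶠ z in 𝓝 x, ρ z < 0 → ∀ v w : E,
          g z v w = complexHessian (fun x' => Real.log (-1 / ρ x')) z v w :=
        (nhds_le_nhdsSet (show x ∈ {x | ρ x = 0} from hx)) hgρ
      have h2 : Tendsto (chartAt E x).symm (𝓝 y₀) (𝓝 x) := by
        have := (chartAt E x).continuousAt_symm hy₀t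
        rwa [ContinuousAt, hx0] at this
      exact h2.eventually h1
    obtain ⟨O, hO, hOo, hyO⟩ := eventually_nhds_iff.mp
      ((hdet'.and hfd).and (hlog.and ((chartAt E x).open_target.mem_nhds hy₀t)))
    refine ⟨O, hOo, hyO, fun y hy => (hO y hy).2.2, fun y hy _ => (hO y hy).1.2,
      boundaryConn (funInChart ρ x), fun i k v y hy =>
        (contDiffAt_boundaryConn (hF x y (hO y hy).2.2) (hO y hy).1.1 i k v).contDiffWithinAt,
      fun y hy hyneg i k => ?_⟩
    have hmem : y ∈ O ∩ chartSet {x | ρ x < 0} x := ⟨hy, (hO y hy).2.2, hyneg⟩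
    refine (renormConn_eq_boundaryConn hS hg hmem.2 (hOo.inter hcS) hmem
      (fun z hz => (hr x z hz.2.1).contDiffWithinAt) (fun z hz => hz.2.2) ?_
      (hO y hy).1.1 i k).symm
    intro z hz v w
    rw [metricInChart, (hO z hz.1).2.1 hz.2.2]
    refine complexHessian_chartDiff (h := fun x' => Real.log (-1 / ρ x')) hS ?_ hz.2 v w
    intro x' y' hy'
    refine Complex.ofRealCLM.contDiff.contDiffAt.comp y' ?_
    have hne : ρ ((chartAt E x').symm y') ≠ 0 := ne_of_lt hy'.2
    exact (contDiffAt_const.div (hr x' y' hy'.1) hne).log (div_ne_zero (by norm_num) hne)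

end RenormalizedConnection


/-! ### Change of frame for the connection and curvature forms -/

section Gauge

variable {E : Type*} [NormedAddCommGroup E] [NormedSpace ℂ E] {ι : Type*} [Fintype ι]
  [DecidableEq ι] {T : Set E} {y : E}

theorem wedge_one_one_apply (φ η : CForm E 1) (v : Fin 2 → E) :
    wedge φ η (one_add_one_eq_two) v =
      φ (fun _ => v 0) * η (fun _ => v 1) - φ (fun _ => v 1) * η (fun _ => v 0) := by
  have hu : (Finset.univ : Finset (Equiv.Perm (Fin 2))) = {1, Equiv.swap 0 1} := by decide
  have h0 : ∀ (w : Fin 2 → E), (fun i : Fin 1 => w (Fin.cast one_add_one_eq_two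
      (Fin.castAdd 1 i))) = fun _ => w 0 := fun w => by
    funext i; congr 1; ext; simp
  have h1 : ∀ (w : Fin 2 → E), (fun i : Fin 1 => w (Fin.cast one_add_one_eq_two
      (Fin.natAdd 1 i))) = fun _ => w 1 := fun w => by
    funext i; congr 1; ext; simp
  rw [wedge_apply, altSum]
  simp only [h0, h1, hu]
  rw [Finset.sum_pair (by decide)]
  simp
  ring

/-- The entrywise derivative of a matrix-valued function on `T`. -/
def matDeriv (T : Set E) (p : E → Matrix ι ι ℂ) (y v : E) : Matrix ι ι ℂ :=
  Matrix.of fun i j => fderivWithin ℝ (fun z => p z i j) T y v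

/-- The matrix of the values on `v` of a matrix of one-forms. -/
def matApply (A : ι → ι → E → CForm E 1) (y v : E) : Matrix ι ι ℂ :=
  Matrix.of fun i j => A i j y fun _ => v

omit [DecidableEq ι] in
theorem matDeriv_mul (hT : UniqueDiffWithinAt ℝ T y) {p q : E → Matrix ι ι ℂ}
    (hp : ∀ i j, DifferentiableWithinAt ℝ (fun z => p z i j) T y)
    (hq : ∀ i j, DifferentiableWithinAt ℝ (fun z => q z i j) T y) (v : E) :
    matDeriv T (fun z => p z * q z) y v = matDeriv T p y v * q y + p y * matDeriv T q y v := by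
  ext i j
  have h : ∀ k, DifferentiableWithinAt ℝ (fun z => p z i k * q z k j) T y := fun k =>
    (hp i k).mul (hq k j)
  simp only [matDeriv, Matrix.mul_apply, Matrix.of_apply, Matrix.add_apply]
  rw [fderivWithin_fun_sum hT fun k _ => h k, sum_apply, ← Finset.sum_add_distrib]
  refine Finset.sum_congr rfl fun k _ => ?_
  rw [fderivWithin_fun_mul hT (hp i k) (hq k j)]
  simp only [add_apply, smul_apply, smul_eq_mul]
  ring

omit [Fintype ι] [DecidableEq ι] in
theorem matDeriv_add (hT : UniqueDiffWithinAt ℝ T y) {p q : E → Matrix ι ι ℂ}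
    (hp : ∀ i j, DifferentiableWithinAt ℝ (fun z => p z i j) T y)
    (hq : ∀ i j, DifferentiableWithinAt ℝ (fun z => q z i j) T y) (v : E) :
    matDeriv T (fun z => p z + q z) y v = matDeriv T p y v + matDeriv T q y v := by
  ext i j
  simp only [matDeriv, Matrix.of_apply, Matrix.add_apply]
  rw [fderivWithin_fun_add hT (hp i j) (hq i j)]
  rfl

omit [Fintype ι] [DecidableEq ι] in
theorem matDeriv_congr {p q : E → Matrix ι ι ℂ} (h : ∀ z ∈ T, p z = q z) (hy : y ∈ T) (v : E) :
    matDeriv T p y v = matDeriv T q y v := by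
  ext i j
  simp only [matDeriv, Matrix.of_apply]
  rw [fderivWithin_congr' (fun z hz => by rw [h z hz]) hy]

omit [DecidableEq ι] in
theorem curvatureForm_apply (hT : UniqueDiffWithinAt ℝ T y) {A : ι → ι → E → CForm E 1}
    (hA : ∀ i j, DifferentiableWithinAt ℝ (A i j) T y) (i j : ι) (v : Fin 2 → E) :
    curvatureForm T A y i j v =
      (matDeriv T (fun z => matApply A z (v 1)) y (v 0) -
        matDeriv T (fun z => matApply A z (v 0)) y (v 1) -
        (matApply A y (v 0) * matApply A y (v 1) -
          matApply A y (v 1) * matApply A y (v 0))) i j := by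
  have h0 : (0 : Fin 2).removeNth v = fun _ => v 1 := by
    funext i; fin_cases i; rfl
  have h1 : (1 : Fin 2).removeNth v = fun _ => v 0 := by
    funext i; fin_cases i; rfl
  rw [curvatureForm, ContinuousAlternatingMap.sub_apply,
    ContinuousAlternatingMap.sum_apply, extDerivWithin_apply (hA i j) hT, Fin.sum_univ_two,
    h0, h1]
  refine (congrArg (fun c => _ - c)
    (Finset.sum_congr rfl fun k _ => wedge_one_one_apply (A i k y) (A k j y) v)).trans ?_
  simp only [Matrix.sub_apply, Matrix.mul_apply, matDeriv, matApply,
    Matrix.of_apply, Finset.sum_sub_distrib]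
  simp [sub_eq_add_neg]

/-- A change of frame `p` acts on the curvature forms by conjugation. -/
theorem curvatureForm_gauge (hT : UniqueDiffOn ℝ T) (hy : y ∈ T) (hy' : y ∈ closure (interior T))
    {A A' : ι → ι → E → CForm E 1} {p q : E → Matrix ι ι ℂ}
    (hA : ∀ i j, ContDiffOn ℝ ∞ (A i j) T) (hA' : ∀ i j, ContDiffOn ℝ ∞ (A' i j) T)
    (hp : ∀ i j, ContDiffOn ℝ ∞ (fun z => p z i j) T)
    (hq : ∀ i j, ContDiffOn ℝ ∞ (fun z => q z i j) T) (hpq : ∀ z ∈ T, p z * q z = 1)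
    (h : ∀ z ∈ T, ∀ v, matApply A' z v = matDeriv T p z v * q z + p z * matApply A z v * q z)
    (i j : ι) :
    curvatureForm T A' y i j = ∑ k, ∑ l, (p y i k * q y l j) • curvatureForm T A y k l := by
  have hTy := hT y hy
  have dA : ∀ i j, DifferentiableWithinAt ℝ (A i j) T y := fun i j =>
    (hA i j).differentiableOn (by simp) y hy
  have dA' : ∀ i j, DifferentiableWithinAt ℝ (A' i j) T y := fun i j =>
    (hA' i j).differentiableOn (by simp) y hy
  have dp : ∀ i j, DifferentiableWithinAt ℝ (fun z => p z i j) T y := fun i j =>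
    (hp i j).differentiableOn (by simp) y hy
  have dq : ∀ i j, DifferentiableWithinAt ℝ (fun z => q z i j) T y := fun i j =>
    (hq i j).differentiableOn (by simp) y hy
  have dAm : ∀ w i j, DifferentiableWithinAt ℝ (fun z => matApply A z w i j) T y := fun w i j => by
    exact (dA i j).continuousAlternatingMap_apply_const _
  have dpw : ∀ w i j, DifferentiableWithinAt ℝ (fun z => matDeriv T p z w i j) T y :=
    fun w i j => by
    have := ((hp i j).fderivWithin hT (m := ∞) (by simp)).clm_apply (contDiffOn_const (c := w))
    exact this.differentiableOn (by simp) y hy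
  have hsymm : ∀ v w, matDeriv T (fun z => matDeriv T p z w) y v =
      matDeriv T (fun z => matDeriv T p z v) y w := by
    intro v w
    ext i j
    have hs : IsSymmSndFDerivWithinAt ℝ (fun z => p z i j) T y :=
      ((hp i j) y hy).isSymmSndFDerivWithinAt
        (by rw [minSmoothness_of_isRCLikeNormedField]; exact WithTop.coe_le_coe.mpr le_top)
        hT hy' hy
    have hd : DifferentiableWithinAt ℝ (fderivWithin ℝ (fun z => p z i j) T) T y :=
      ((hp i j).fderivWithin hT (m := ∞) (by simp)).differentiableOn (by simp) y hy
    have e : ∀ v w, fderivWithin ℝ (fun z => fderivWithin ℝ (fun z => p z i j) T z w) T y v =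
        fderivWithin ℝ (fderivWithin ℝ (fun z => p z i j) T) T y v w := by
      intro v w
      rw [fderivWithin_clm_apply hTy hd (differentiableWithinAt_const w)]
      simp
    simp only [matDeriv, Matrix.of_apply, e]
    exact hs v w
  have hqp : q y * p y = 1 := mul_eq_one_comm.mp (hpq y hy)
  -- the derivative of the inverse matrix
  have hdq : ∀ v, matDeriv T q y v = -(q y * matDeriv T p y v * q y) := by
    intro v
    have h1 := matDeriv_congr hpq hy v
    rw [matDeriv_mul hTy dp dq] at h1
    have h2 : matDeriv T (fun _ => (1 : Matrix ι ι ℂ)) y v = 0 := by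
      ext i j; simp [matDeriv]
    rw [h2] at h1
    have h3 := congrArg (fun M => q y * M) h1
    simp only [mul_add, mul_zero, ← mul_assoc, hqp, one_mul] at h3
    exact eq_neg_of_add_eq_zero_right h3
  have hD : ∀ v w, matDeriv T (fun z => matApply A' z w) y v =
      matDeriv T (fun z => matDeriv T p z w) y v * q y + matDeriv T p y w * matDeriv T q y v +
      ((matDeriv T p y v * matApply A y w + p y * matDeriv T (fun z => matApply A z w) y v) * q y +
        p y * matApply A y w * matDeriv T q y v) := by
    intro v w
    have d1 : ∀ i j, DifferentiableWithinAt ℝ (fun z => (p z * matApply A z w) i j) T y :=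
      fun i j => by
      simp only [Matrix.mul_apply]
      exact DifferentiableWithinAt.fun_sum fun k _ => (dp i k).mul (dAm w k j)
    have d2 : ∀ i j, DifferentiableWithinAt ℝ (fun z => (p z * matApply A z w * q z) i j) T y :=
      fun i j => by
      simp only [Matrix.mul_apply (N := q _)]
      exact DifferentiableWithinAt.fun_sum fun k _ => (d1 i k).mul (dq k j)
    have d3 : ∀ i j, DifferentiableWithinAt ℝ (fun z => (matDeriv T p z w * q z) i j) T y :=
      fun i j => by
      simp only [Matrix.mul_apply (N := q _)]
      exact DifferentiableWithinAt.fun_sum fun k _ => (dpw w i k).mul (dq k j)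
    rw [matDeriv_congr (fun z hz => h z hz w) hy, matDeriv_add hTy d3 d2,
      matDeriv_mul hTy (dpw w) dq, matDeriv_mul hTy d1 dq, matDeriv_mul hTy dp (dAm w)]
  ext v
  have hR : (∑ k, ∑ l, (p y i k * q y l j) • curvatureForm T A y k l) v =
      (p y * (matDeriv T (fun z => matApply A z (v 1)) y (v 0) -
        matDeriv T (fun z => matApply A z (v 0)) y (v 1) -
        (matApply A y (v 0) * matApply A y (v 1) -
          matApply A y (v 1) * matApply A y (v 0))) * q y) i j := by
    rw [Matrix.mul_apply]
    simp only [Matrix.mul_apply (M := p y), Finset.sum_mul]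
    rw [Finset.sum_comm]
    simp only [ContinuousAlternatingMap.sum_apply, ContinuousAlternatingMap.smul_apply, curvatureForm_apply hTy dA,
      smul_eq_mul]
    exact Finset.sum_congr rfl fun l _ => Finset.sum_congr rfl fun k _ => by ring
  rw [hR, curvatureForm_apply hTy dA', hD, hD, h y hy, h y hy, hdq, hdq, hsymm (v 1) (v 0)]
  refine congrFun (congrFun (?_ : (_ : Matrix ι ι ℂ) = _) i) j
  have hc : ∀ M : Matrix ι ι ℂ, q y * (p y * M) = M := fun M => by
    rw [← mul_assoc, hqp, one_mul]
  simp only [mul_add, add_mul, mul_sub, sub_mul, mul_assoc, hc, mul_neg]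
  abel

end Gauge


/-! ### The renormalized connection forms of a frame -/

section Frame

variable {E : Type*} [NormedAddCommGroup E] [NormedSpace ℂ E] [FiniteDimensional ℂ E]
variable {Z : Type*} [TopologicalSpace Z] [ChartedSpace E Z] {n : ℕ} {x : Z} {y : E}

/-- The vector fields of the frame `W` in the chart at `x`. -/
def frameVec (x : Z) (W : Z → Module.Basis (Fin (n + 1)) ℂ E) (i : Fin (n + 1)) : E → E :=
  vecInChart x fun z => W z i

/-- The dual coframe of the frame `W` in the chart at `x`. -/
def frameCov (x : Z) (W : Z → Module.Basis (Fin (n + 1)) ℂ E) (j : Fin (n + 1)) (y : E) :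
    E →L[ℂ] ℂ :=
  (coframe W j ((chartAt E x).symm y)).comp (chartDiff x y)

/-- The connection with connection forms `Γ` in the coordinate frame, applied to a constant
vector field `u`. -/
def connOp (Γ : Fin (Module.finrank ℂ E) → Fin (Module.finrank ℂ E) → E → E →L[ℂ] ℂ) (y u : E) :
    E →L[ℝ] E :=
  ∑ i, ∑ k, (Module.finBasis ℂ E).coord i u •
    ((Γ i k y).restrictScalars ℝ).smulRight (Module.finBasis ℂ E k)

/-- In the chart at `x`, the connection forms in the frame `W` of the connection that has connection
forms `Γ` in the coordinate frame. -/
def localTheta (K : Set E)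
    (Γ : Fin (Module.finrank ℂ E) → Fin (Module.finrank ℂ E) → E → E →L[ℂ] ℂ) (x : Z)
    (W : Z → Module.Basis (Fin (n + 1)) ℂ E) (i j : Fin (n + 1)) (y : E) : CForm E 1 :=
  oneForm (((frameCov x W j y).restrictScalars ℝ).comp
    (fderivWithin ℝ (frameVec x W i) K y + connOp Γ y (frameVec x W i y)))

theorem connOp_apply (Γ : Fin (Module.finrank ℂ E) → Fin (Module.finrank ℂ E) → E → E →L[ℂ] ℂ)
    (y u v : E) : connOp Γ y u v =
      ∑ i, ∑ k, ((Module.finBasis ℂ E).coord i u * Γ i k y v) • Module.finBasis ℂ E k := by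
  simp [connOp, smul_smul]

theorem connOp_sum_smul (Γ : Fin (Module.finrank ℂ E) → Fin (Module.finrank ℂ E) → E → E →L[ℂ] ℂ)
    (y v : E) {κ : Type*} (s : Finset κ) (c : κ → ℂ) (u : κ → E) :
    connOp Γ y (∑ k ∈ s, c k • u k) v = ∑ k ∈ s, c k • connOp Γ y (u k) v := by
  let L : E →ₗ[ℂ] E :=
    { toFun := fun u => connOp Γ y u v
      map_add' := fun u w => by
        simp only [connOp_apply, map_add, add_mul, add_smul, Finset.sum_add_distrib]
      map_smul' := fun c u => by
        simp only [connOp_apply, map_smul, smul_eq_mul, mul_assoc, Finset.smul_sum, smul_smul,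
          RingHom.id_apply] }
  have h := map_sum L (fun k => c k • u k) s
  simp only [map_smul] at h
  exact h

theorem localTheta_apply (K : Set E)
    (Γ : Fin (Module.finrank ℂ E) → Fin (Module.finrank ℂ E) → E → E →L[ℂ] ℂ) (x : Z)
    (W : Z → Module.Basis (Fin (n + 1)) ℂ E) (i j : Fin (n + 1)) (y : E) (v : Fin 1 → E) :
    localTheta K Γ x W i j y v = frameCov x W j y
      (fderivWithin ℝ (frameVec x W i) K y (v 0) + connOp Γ y (frameVec x W i y) (v 0)) := rfl

variable [IsManifold 𝓘(ℂ, E) ω Z]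

theorem frameCov_frameVec (hy : y ∈ (chartAt E x).target)
    (W : Z → Module.Basis (Fin (n + 1)) ℂ E) (i j : Fin (n + 1)) :
    frameCov x W j y (frameVec x W i y) = if i = j then 1 else 0 := by
  rw [frameCov, ContinuousLinearMap.comp_apply, frameVec, chartDiff_vecInChart hy]
  simp [coframe, Finsupp.single_apply]

theorem sum_frameCov (hy : y ∈ (chartAt E x).target)
    (W : Z → Module.Basis (Fin (n + 1)) ℂ E) (u : E) :
    ∑ j, frameCov x W j y u • frameVec x W j y = u := by
  refine chartDiff_injective hy ?_
  simp only [map_sum, map_smul, frameVec, chartDiff_vecInChart hy]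
  exact (W ((chartAt E x).symm y)).sum_repr (chartDiff x y u)

/-- The dual coframe is smooth, since its coefficients form the inverse matrix of those of the
frame. -/
theorem contDiffOn_frameCov (hE : Module.finrank ℂ E = n + 1) {K : Set E}
    (hK : K ⊆ (chartAt E x).target) {W : Z → Module.Basis (Fin (n + 1)) ℂ E}
    (hW : ∀ i, ContDiffOn ℝ ∞ (frameVec x W i) K) (j : Fin (n + 1)) (v : E) :
    ContDiffOn ℝ ∞ (fun y => frameCov x W j y v) K := by
  let b := (Module.finBasis ℂ E).reindex (finCongr hE)
  let p : E → Matrix (Fin (n + 1)) (Fin (n + 1)) ℂ := fun y =>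
    Matrix.of fun i k => b.coord k (frameVec x W i y)
  let q : E → Matrix (Fin (n + 1)) (Fin (n + 1)) ℂ := fun y =>
    Matrix.of fun k j => frameCov x W j y (b k)
  have hpq : ∀ y ∈ K, p y * q y = 1 := by
    intro y hy
    ext i j
    have h := frameCov_frameVec (hK hy) W i j
    rw [← b.sum_repr (frameVec x W i y), map_sum] at h
    simpa [p, q, Matrix.mul_apply, Matrix.one_apply] using h
  have hps : ∀ i k, ContDiffOn ℝ ∞ (fun z => p z i k) K := fun i k => by
    have h : ContDiff ℝ ∞ (LinearMap.toContinuousLinearMap (b.coord k)) :=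
      ((LinearMap.toContinuousLinearMap (b.coord k)).restrictScalars ℝ).contDiff
    exact h.comp_contDiffOn (hW i)
  have hqs : ∀ k j, ContDiffOn ℝ ∞ (fun z => q z k j) K := fun k j y hy => by
    refine (contDiffWithinAt_inv_matrix (fun i k => hps i k y hy) ?_ k j).congr (fun z hz => ?_) ?_
    · exact (Matrix.isUnit_det_of_right_inverse (hpq y hy)).ne_zero
    · rw [Matrix.inv_eq_right_inv (hpq z hz)]
    · rw [Matrix.inv_eq_right_inv (hpq y hy)]
  have h : (fun y => frameCov x W j y v) = fun y => ∑ k, b.repr v k * q y k j := by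
    funext y
    conv_lhs => rw [← b.sum_repr v, map_sum]
    simp [q]
  rw [h]
  exact ContDiffOn.sum fun k _ => contDiffOn_const.mul (hqs k j)

theorem contDiffOn_connOp {K : Set E}
    {Γ : Fin (Module.finrank ℂ E) → Fin (Module.finrank ℂ E) → E → E →L[ℂ] ℂ}
    (hΓ : ∀ i k v, ContDiffOn ℝ ∞ (fun y => Γ i k y v) K) {u : E → E} (hu : ContDiffOn ℝ ∞ u K)
    (v : E) : ContDiffOn ℝ ∞ (fun y => connOp Γ y (u y) v) K := by
  simp only [connOp_apply]
  refine ContDiffOn.sum fun i _ => ContDiffOn.sum fun k _ => ContDiffOn.smul ?_ contDiffOn_const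
  have h : ContDiff ℝ ∞ (LinearMap.toContinuousLinearMap ((Module.finBasis ℂ E).coord i)) :=
    ((LinearMap.toContinuousLinearMap ((Module.finBasis ℂ E).coord i)).restrictScalars ℝ).contDiff
  exact (h.comp_contDiffOn hu).mul (hΓ i k v)

theorem contDiffOn_frameCov_apply (hE : Module.finrank ℂ E = n + 1) {K : Set E}
    (hK : K ⊆ (chartAt E x).target) {W : Z → Module.Basis (Fin (n + 1)) ℂ E}
    (hW : ∀ i, ContDiffOn ℝ ∞ (frameVec x W i) K) (j : Fin (n + 1)) {u : E → E}
    (hu : ContDiffOn ℝ ∞ u K) : ContDiffOn ℝ ∞ (fun y => frameCov x W j y (u y)) K := by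
  let b := Module.finBasis ℂ E
  have h : (fun y => frameCov x W j y (u y)) =
      fun y => ∑ k, b.coord k (u y) * frameCov x W j y (b k) := by
    funext y
    conv_lhs => rw [← b.sum_repr (u y), map_sum]
    simp
  rw [h]
  refine ContDiffOn.sum fun k _ => ContDiffOn.mul ?_ (contDiffOn_frameCov hE hK hW j _)
  have h : ContDiff ℝ ∞ (LinearMap.toContinuousLinearMap (b.coord k)) :=
    ((LinearMap.toContinuousLinearMap (b.coord k)).restrictScalars ℝ).contDiff
  exact h.comp_contDiffOn hu

theorem contDiffOn_localTheta (hE : Module.finrank ℂ E = n + 1) {K : Set E}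
    (hT : UniqueDiffOn ℝ K) (hK : K ⊆ (chartAt E x).target)
    {W : Z → Module.Basis (Fin (n + 1)) ℂ E}
    (hW : ∀ i, ContDiffOn ℝ ∞ (frameVec x W i) K)
    {Γ : Fin (Module.finrank ℂ E) → Fin (Module.finrank ℂ E) → E → E →L[ℂ] ℂ}
    (hΓ : ∀ i k v, ContDiffOn ℝ ∞ (fun y => Γ i k y v) K) (i j : Fin (n + 1)) :
    ContDiffOn ℝ ∞ (localTheta K Γ x W i j) K := fun y hy => by
  refine contDiffWithinAt_form fun v => ?_
  simp only [localTheta_apply]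
  refine contDiffOn_frameCov_apply hE hK hW j (ContDiffOn.add ?_ ?_) y hy
  · exact ((hW i).fderivWithin hT (m := ∞) (by simp)).clm_apply contDiffOn_const
  · exact contDiffOn_connOp hΓ (hW i) _

/-- The matrix `p` with `W'_i = p_i^k W_k`. -/
def frameChange (x : Z) (W W' : Z → Module.Basis (Fin (n + 1)) ℂ E) (y : E) :
    Matrix (Fin (n + 1)) (Fin (n + 1)) ℂ :=
  Matrix.of fun i k => frameCov x W k y (frameVec x W' i y)

theorem frameChange_mul (hy : y ∈ (chartAt E x).target)
    (W W' : Z → Module.Basis (Fin (n + 1)) ℂ E) :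
    frameChange x W W' y * frameChange x W' W y = 1 := by
  ext i j
  rw [Matrix.one_apply, ← frameCov_frameVec hy W' i j]
  conv_rhs => rw [← sum_frameCov hy W (frameVec x W' i y), map_sum]
  simp [Matrix.mul_apply, frameChange]

/-- The transformation law `θ' = dp p⁻¹ + p θ p⁻¹` of the connection forms. -/
theorem localTheta_gauge (hE : Module.finrank ℂ E = n + 1) {K : Set E} (hT : UniqueDiffOn ℝ K)
    (hK : K ⊆ (chartAt E x).target) {W W' : Z → Module.Basis (Fin (n + 1)) ℂ E}
    (hW : ∀ i, ContDiffOn ℝ ∞ (frameVec x W i) K) (hW' : ∀ i, ContDiffOn ℝ ∞ (frameVec x W' i) K)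
    (Γ : Fin (Module.finrank ℂ E) → Fin (Module.finrank ℂ E) → E → E →L[ℂ] ℂ)
    (hy : y ∈ K) (v : E) :
    matApply (localTheta K Γ x W') y v =
      matDeriv K (frameChange x W W') y v * frameChange x W' W y +
        frameChange x W W' y * matApply (localTheta K Γ x W) y v * frameChange x W' W y := by
  ext i j
  have hp : ∀ i k, ContDiffOn ℝ ∞ (fun z => frameChange x W W' z i k) K := fun i k =>
    contDiffOn_frameCov_apply hE hK hW k (hW' i)
  have hTy := hT y hy
  have dp : ∀ k, DifferentiableWithinAt ℝ (fun z => frameChange x W W' z i k) K y := fun k =>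
    (hp i k).differentiableOn (by simp) y hy
  have dW : ∀ k, DifferentiableWithinAt ℝ (frameVec x W k) K y := fun k =>
    (hW k).differentiableOn (by simp) y hy
  have h1 : ∀ z ∈ K, frameVec x W' i z = ∑ k, frameChange x W W' z i k • frameVec x W k z :=
    fun z hz => (sum_frameCov (hK hz) W _).symm
  have h2 : fderivWithin ℝ (frameVec x W' i) K y v =
      ∑ k, (frameChange x W W' y i k • fderivWithin ℝ (frameVec x W k) K y v +
        matDeriv K (frameChange x W W') y v i k • frameVec x W k y) := by
    have ds : ∀ k, DifferentiableWithinAt ℝ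
        (fun z => frameChange x W W' z i k • frameVec x W k z) K y := fun k => (dp k).smul (dW k)
    rw [fderivWithin_congr' h1 hy, fderivWithin_fun_sum hTy fun k _ => ds k, sum_apply]
    refine Finset.sum_congr rfl fun k _ => ?_
    have := fderivWithin_fun_smul hTy (dp k) (dW k)
    rw [this]
    rfl
  have h3 : ∀ (w : E), frameCov x W' j y w =
      ∑ l, frameCov x W l y w * frameChange x W' W y l j := by
    intro w
    conv_lhs => rw [← sum_frameCov (hK hy) W w, map_sum]
    simp [frameChange]
  have h4 : ∀ k, frameCov x W' j y (frameVec x W k y) = frameChange x W' W y k j := fun k => rfl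
  have h5 : matApply (localTheta K Γ x W') y v i j =
      ∑ k, (matDeriv K (frameChange x W W') y v i k * frameChange x W' W y k j) +
      ∑ k, frameChange x W W' y i k * ∑ l, matApply (localTheta K Γ x W) y v k l *
        frameChange x W' W y l j := by
    simp only [matApply, Matrix.of_apply, localTheta_apply, ← h3]
    rw [h2]
    rw [h1 y hy]
    rw [connOp_sum_smul]
    simp only [map_add, map_sum, map_smul, h4, smul_eq_mul, Finset.sum_add_distrib, mul_add]
    ring
  rw [h5, Matrix.add_apply, mul_assoc]
  simp only [Matrix.mul_apply]

end Frame


/-! ### Smoothness up to the boundary -/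

section LocalConnection

variable {E : Type*} [NormedAddCommGroup E] [NormedSpace ℂ E] [FiniteDimensional ℂ E]
variable {Z : Type*} [TopologicalSpace Z] [ChartedSpace E Z]
  {ρ : Z → ℝ} {g : Z → E →L[ℂ] E →L⋆[ℂ] ℂ}

/-- On the open subset `O` of the chart at `x`, which is contained in the part of the chart that
corresponds to `N`, the renormalized connection extends smoothly across the boundary, with
connection forms `Γ` in the coordinate frame. -/
structure IsLocalConnection (ρ : Z → ℝ) (g : Z → E →L[ℂ] E →L⋆[ℂ] ℂ) (N : Set Z) (x : Z) (O : Set E)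
    (Γ : Fin (Module.finrank ℂ E) → Fin (Module.finrank ℂ E) → E → E →L[ℂ] ℂ) : Prop where
  isOpen : IsOpen O
  center_mem : chartAt E x x ∈ O
  subset : O ⊆ chartSet N x
  d_ne_zero : ∀ y ∈ O, ρ ((chartAt E x).symm y) = 0 →
    fderiv ℝ (fun z => ρ ((chartAt E x).symm z)) y ≠ 0
  smooth : ∀ i k v, ContDiffOn ℝ ∞ (fun y => Γ i k y v) O
  eq_renormConn : ∀ y ∈ O, ρ ((chartAt E x).symm y) < 0 → ∀ i k, Γ i k y = renormConn ρ g x i k y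

/-- The part of `O` that corresponds to `X̄`. -/
def localDomain (ρ : Z → ℝ) (x : Z) (O : Set E) : Set E :=
  O ∩ {y | ρ ((chartAt E x).symm y) ≤ 0}

theorem connOp_renormConn (ρ : Z → ℝ) (g : Z → E →L[ℂ] E →L⋆[ℂ] ℂ) (x : Z) (y u v : E) :
    connOp (renormConn ρ g x) y u v = christoffel g x y v u -
      (-funInChart ρ x y)⁻¹ • (del (funInChart ρ x) y v • u + del (funInChart ρ x) y u • v) := by
  set b := Module.finBasis ℂ E with hb
  set F : E → ℂ := funInChart ρ x
  have h1 : ∀ l, b.repr (connOp (renormConn ρ g x) y u v) l =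
      ∑ i, b.repr u i * renormConn ρ g x i l y v := fun l => by
    simp [connOp_apply, ← hb, Finsupp.single_apply]
  have h2 : ∀ l, b.repr (christoffel g x y v u) l = ∑ i, b.repr u i * chernAt g x y i l v :=
    fun l => by simp [christoffel, ← hb, Finsupp.single_apply]
  have h3 : del F y u = ∑ i, b.repr u i * del F y (b i) := by
    conv_lhs => rw [← b.sum_repr u, map_sum]
    simp
  refine b.ext_elem fun l => ?_
  have h4 : ∀ i, renormConn ρ g x i l y v = chernAt g x y i l v - (-F y)⁻¹ *
      ((if i = l then del F y v else 0) + del F y (b i) * b.repr v l) := fun i => by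
    simp only [renormConn, sub_apply, smul_apply, add_apply, smul_eq_mul]
    split_ifs <;> rfl
  rw [h1, map_sub, map_smul, map_add, map_smul, map_smul]
  simp only [Finsupp.coe_sub, Finsupp.coe_smul, Finsupp.coe_add, Pi.sub_apply, Pi.smul_apply,
    Pi.add_apply, smul_eq_mul, h2, h3, h4, mul_sub, Finset.sum_sub_distrib]
  congr 1
  have h5 : ∀ i, b.repr u i * ((-F y)⁻¹ *
      ((if i = l then del F y v else 0) + del F y (b i) * b.repr v l)) =
      (-F y)⁻¹ * (if i = l then del F y v * b.repr u l else 0) +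
        (-F y)⁻¹ * (b.repr u i * del F y (b i) * b.repr v l) := fun i => by
    split_ifs with h
    · subst h; ring
    · ring
  simp only [h5, Finset.sum_add_distrib, ← Finset.mul_sum, ← Finset.sum_mul]
  simp
  ring

namespace IsLocalConnection

variable {N : Set Z} {x : Z} {O : Set E}
  {Γ : Fin (Module.finrank ℂ E) → Fin (Module.finrank ℂ E) → E → E →L[ℂ] ℂ}
  (hL : IsLocalConnection ρ g N x O Γ) (hρ : IsDefiningFunction (E := E) ρ)

include hL

theorem subset_target : O ⊆ (chartAt E x).target := fun _ hy => (hL.subset hy).1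

theorem localDomain_subset : localDomain ρ x O ⊆ chartSet (N ∩ {x | ρ x ≤ 0}) x :=
  fun _ hy => ⟨(hL.subset hy.1).1, (hL.subset hy.1).2, hy.2⟩

theorem localDomain_mem_nhdsWithin {S : Set Z} (hS : S ⊆ {x | ρ x ≤ 0}) :
    localDomain ρ x O ∈ 𝓝[chartSet S x] (chartAt E x x) := by
  filter_upwards [mem_nhdsWithin_of_mem_nhds (hL.isOpen.mem_nhds hL.center_mem),
    self_mem_nhdsWithin] with y hy hyS
  exact ⟨hy, hS hyS.2⟩

theorem center_mem_localDomain (hx : ρ x ≤ 0) : chartAt E x x ∈ localDomain ρ x O := by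
  refine ⟨hL.center_mem, ?_⟩
  change ρ _ ≤ 0
  rwa [(chartAt E x).left_inv (mem_chart_source E x)]

variable [IsManifold 𝓘(ℂ, E) ω Z]

include hρ

theorem differentiableOn : DifferentiableOn ℝ (fun z => ρ ((chartAt E x).symm z)) O := fun y hy =>
  ((contDiffAt_funInChart hρ.smooth (hL.subset_target hy)).differentiableAt
    (by simp)).differentiableWithinAt

theorem uniqueDiffOn : UniqueDiffOn ℝ (localDomain ρ x O) :=
  uniqueDiffOn_domain hL.isOpen (hL.differentiableOn hρ) hL.d_ne_zero

theorem mem_closure_interior {y : E} (hy : y ∈ localDomain ρ x O) :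
    y ∈ closure (interior (localDomain ρ x O)) :=
  RenormChern.mem_closure_interior hL.isOpen (hL.differentiableOn hρ) hL.d_ne_zero hy

variable {n : ℕ} {W : Z → Module.Basis (Fin (n + 1)) ℂ E} {y : E}

/-- In the interior, `ψ_i^j - Y_i^j` are the connection forms of the local connection in the frame
`W`: the forms `Y_i^j` are the frame expression of the tensor that `renormConn` subtracts. -/
theorem formInChart_psi_sub_Yform (hg : IsHermitianMetric {x | ρ x < 0} g)
    (hW : ∀ i, ContDiffOn ℝ ∞ (frameVec x W i) (localDomain ρ x O)) (hyO : y ∈ O)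
    (hy : ρ ((chartAt E x).symm y) < 0) (i j : Fin (n + 1)) :
    formInChart x (fun z => psi g W i j z - Yform ρ W i j z) y =
      localTheta (localDomain ρ x O) Γ x W i j y := by
  set x' := (chartAt E x).symm y with hx'
  have hyt := hL.subset_target hyO
  have hyS : y ∈ chartSet {x | ρ x < 0} x := ⟨hyt, hy⟩
  have hK : localDomain ρ x O ∈ 𝓝 y := by
    have h := (isOpen_inter_neg hL.isOpen (hL.differentiableOn hρ)).mem_nhds ⟨hyO, hy⟩
    exact mem_of_superset h fun z hz => ⟨hz.1, (show ρ ((chartAt E x).symm z) < 0 from hz.2).le⟩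
  have hd : DifferentiableAt ℝ (vecInChart x fun z => W z i) y :=
    ((hW i).differentiableOn (by simp)).differentiableAt hK
  have hF : DifferentiableAt ℝ (funInChart (E := E) ρ x') (trans x x' y) := by
    refine Complex.ofRealCLM.differentiableAt.comp _ ?_
    exact (contDiffAt_funInChart hρ.smooth (trans_mem (mem_transDomain_self hyt)).1).differentiableAt
      (by simp)
  have hdel : ∀ u, delM ρ x' (chartDiff x y u) = del (funInChart ρ x) y u := delM_chartDiff hyt hF
  have hWi : ∀ k, W x' k = chartDiff x y (frameVec x W k y) := fun k =>
    (chartDiff_vecInChart hyt fun z => W z k).symm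
  ext v
  have h1 : formInChart x (fun z => psi g W i j z - Yform ρ W i j z) y v =
      coframe W j x' (chernCov g (fun z => W z i) x' (chartDiff x y (v 0))) -
        ((1 / -ρ x' : ℝ) : ℂ) * ∑ k, ((if i = j then delM ρ x' (W x' k) else 0) +
          (if k = j then delM ρ x' (W x' i) else 0)) * coframe W k x' (chartDiff x y (v 0)) := by
    simp [formInChart, psi, Yform, oneForm, ← hx']
  have h2 : ∑ k, ((if i = j then delM ρ x' (W x' k) else 0) +
      (if k = j then delM ρ x' (W x' i) else 0)) * coframe W k x' (chartDiff x y (v 0)) =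
      (if i = j then del (funInChart ρ x) y (v 0) else 0) +
        del (funInChart ρ x) y (frameVec x W i y) * frameCov x W j y (v 0) := by
    have e1 : ∀ k, coframe W k x' (chartDiff x y (v 0)) = frameCov x W k y (v 0) := fun k => rfl
    have e2 : del (funInChart ρ x) y (v 0) =
        ∑ k, frameCov x W k y (v 0) * del (funInChart ρ x) y (frameVec x W k y) := by
      conv_lhs => rw [← sum_frameCov hyt W (v 0), map_sum]
      simp
    simp only [hWi, hdel, e1, add_mul, Finset.sum_add_distrib]
    congr 1
    · split_ifs
      · rw [e2]; exact Finset.sum_congr rfl fun k _ => mul_comm _ _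
      · simp
    · simp [ite_mul]
  have h3 : connOp Γ y (frameVec x W i y) = connOp (renormConn ρ g x) y (frameVec x W i y) := by
    simp only [connOp, hL.eq_renormConn y hyO hy]
  have h4 : (((1 / -ρ x' : ℝ)) : ℂ) = (-funInChart ρ x y)⁻¹ := by
    rw [funInChart, ← hx']; push_cast; rw [one_div]
  have h5 : ∀ u, coframe W j x' (chartDiff x y u) = frameCov x W j y u := fun u => rfl
  rw [h1, h2, chernCov_chartDiff (isOpen_neg hρ) hg hyS hd, localTheta_apply, h3,
    connOp_renormConn, fderivWithin_of_mem_nhds hK, h4, h5]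
  change frameCov x W j y (fderiv ℝ (frameVec x W i) y (v 0) +
    christoffel g x y (v 0) (frameVec x W i y)) - _ = _
  simp only [map_add, map_sub, map_smul, smul_eq_mul, frameCov_frameVec hyt]
  split_ifs <;> ring

section Theta

variable (hE : Module.finrank ℂ E = n + 1) (hg : IsHermitianMetric {x | ρ x < 0} g)
  (hW : IsSmoothFrame (N ∩ {x | ρ x ≤ 0}) W)

include hW

omit [IsManifold 𝓘(ℂ, E) ω Z] hρ in
theorem contDiffOn_frameVec (i : Fin (n + 1)) :
    ContDiffOn ℝ ∞ (frameVec x W i) (localDomain ρ x O) :=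
  (hW i x).mono hL.localDomain_subset

include hE

theorem contDiffOn_localTheta (i j : Fin (n + 1)) :
    ContDiffOn ℝ ∞ (localTheta (localDomain ρ x O) Γ x W i j) (localDomain ρ x O) :=
  RenormChern.contDiffOn_localTheta hE (hL.uniqueDiffOn hρ)
    (inter_subset_left.trans hL.subset_target) (hL.contDiffOn_frameVec hW)
    (fun i k v => (hL.smooth i k v).mono inter_subset_left) i j

include hg

theorem formInChart_theta (hy : y ∈ localDomain ρ x O) (i j : Fin (n + 1)) :
    formInChart x (theta ρ g W i j) y = localTheta (localDomain ρ x O) Γ x W i j y :=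
  formInChart_extendForm hL.isOpen hL.subset_target
    ((hL.contDiffOn_localTheta hρ hE hW i j).of_le (by simp))
    (fun _ hz hz0 => hL.formInChart_psi_sub_Yform hρ hg (hL.contDiffOn_frameVec hW) hz hz0 i j)
    (fun _ hz => mem_closure_neg hL.isOpen (hL.differentiableOn hρ) hL.d_ne_zero hz.1 hz.2) hy

end Theta

end IsLocalConnection

variable [IsManifold 𝓘(ℂ, E) ω Z]

theorem exists_isLocalConnection (hρ : IsDefiningFunction (E := E) ρ)
    (hg : IsHermitianMetric {x | ρ x < 0} g) (hgρ : IsLogMetricNearBoundary ρ g) {N : Set Z}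
    (hN : IsOpen N) {x : Z} (hx : x ∈ N ∩ {x | ρ x ≤ 0}) :
    ∃ O Γ, IsLocalConnection ρ g N x O Γ := by
  obtain ⟨O, hO, hyO, hOt, hd, Γ, hΓ, h⟩ := exists_local_connection hρ hg hgρ hx.2
  have hN' : IsOpen (chartSet (E := E) N x) := (chartAt E x).isOpen_inter_preimage_symm hN
  refine ⟨O ∩ chartSet N x, Γ, hO.inter hN', ⟨hyO, hOt hyO, ?_⟩, inter_subset_right,
    fun y hy => hd y hy.1, fun i k v => (hΓ i k v).mono inter_subset_left, fun y hy => h y hy.1⟩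
  rw [mem_preimage, (chartAt E x).left_inv (mem_chart_source E x)]
  exact hx.1

variable {n : ℕ} {W : Z → Module.Basis (Fin (n + 1)) ℂ E} {N : Set Z}

/-- The renormalized connection forms are smooth up to the boundary. -/
theorem smoothForm_theta (hE : Module.finrank ℂ E = n + 1) (hρ : IsDefiningFunction (E := E) ρ)
    (hg : IsHermitianMetric {x | ρ x < 0} g) (hgρ : IsLogMetricNearBoundary ρ g) (hN : IsOpen N)
    (hW : IsSmoothFrame (N ∩ {x | ρ x ≤ 0}) W) (i j : Fin (n + 1)) :
    SmoothForm (N ∩ {x | ρ x ≤ 0}) (theta ρ g W i j) := by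
  refine smoothForm_of_center fun x hx => ?_
  obtain ⟨O, Γ, hL⟩ := exists_isLocalConnection hρ hg hgρ hN hx
  have hc := hL.center_mem_localDomain hx.2
  have h1 : ContDiffWithinAt ℝ ∞ (formInChart x (theta ρ g W i j)) (localDomain ρ x O)
      (chartAt E x x) :=
    (hL.contDiffOn_localTheta hρ hE hW i j _ hc).congr
      (fun z hz => hL.formInChart_theta hρ hE hg hW hz i j)
      (hL.formInChart_theta hρ hE hg hW hc i j)
  exact h1.mono_of_mem_nhdsWithin (hL.localDomain_mem_nhdsWithin inter_subset_right)

omit [FiniteDimensional ℂ E] [IsManifold 𝓘(ℂ, E) ω Z] in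
/-- Smoothness near a point does not depend on the open neighbourhood `N`. -/
theorem contDiffWithinAt_of_smoothForm {k : ℕ} {φ : Z → CForm E k} {S : Set Z} (hN : IsOpen N)
    (h : SmoothForm (N ∩ S) φ) {x : Z} (hx : x ∈ N ∩ S) :
    ContDiffWithinAt ℝ ∞ (formInChart x φ) (chartSet S x) (chartAt E x x) := by
  have hx0 : (chartAt E x).symm (chartAt E x x) = x := (chartAt E x).left_inv (mem_chart_source E x)
  have hxt := mem_chart_target E x
  refine (h x (chartAt E x x) ⟨hxt, by rwa [mem_preimage, hx0]⟩).mono_of_mem_nhdsWithin ?_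
  have hN' : IsOpen (chartSet (E := E) N x) := (chartAt E x).isOpen_inter_preimage_symm hN
  filter_upwards [mem_nhdsWithin_of_mem_nhds (hN'.mem_nhds
    (show chartAt E x x ∈ chartSet N x from ⟨hxt, by rw [mem_preimage, hx0]; exact hx.1⟩)),
    self_mem_nhdsWithin] with y hy hyS
  exact ⟨hy.1, hy.2, hyS.2⟩

/-- The curvature forms in a chart. -/
theorem formInChart_Theta (hE : Module.finrank ℂ E = n + 1) (hρ : IsDefiningFunction (E := E) ρ)
    (hg : IsHermitianMetric {x | ρ x < 0} g) (hgρ : IsLogMetricNearBoundary ρ g) (hN : IsOpen N)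
    (hW : IsSmoothFrame (N ∩ {x | ρ x ≤ 0}) W) {x : Z} {O : Set E}
    {Γ : Fin (Module.finrank ℂ E) → Fin (Module.finrank ℂ E) → E → E →L[ℂ] ℂ}
    (hL : IsLocalConnection ρ g N x O Γ) {y : E} (hy : y ∈ localDomain ρ x O)
    (i j : Fin (n + 1)) :
    formInChart x (Theta ρ g W i j) y =
      curvatureForm (localDomain ρ x O) (localTheta (localDomain ρ x O) Γ x W) y i j := by
  have hyS := hL.localDomain_subset hy
  have h1 : formInChart x (extD {x | ρ x ≤ 0} (theta ρ g W i j)) y =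
      extDerivWithin (localTheta (localDomain ρ x O) Γ x W i j) (localDomain ρ x O) y := by
    rw [formInChart_extD (S := {x | ρ x ≤ 0}) (s := localDomain ρ x O) ⟨hyS.1, hyS.2.2⟩ (hL.uniqueDiffOn hρ)
      (fun z hz => ⟨(hL.localDomain_subset hz).1, (hL.localDomain_subset hz).2.2⟩) hy
      (hL.mem_closure_interior hρ hy)
      (contDiffWithinAt_of_smoothForm hN (smoothForm_theta hE hρ hg hgρ hN hW i j) hyS.2)]
    exact extDerivWithin_congr' (fun z hz => hL.formInChart_theta hρ hE hg hW hz i j) hy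
  have h2 : formInChart x (Theta ρ g W i j) y =
      formInChart x (extD {x | ρ x ≤ 0} (theta ρ g W i j)) y -
        ∑ k, formInChart x (fun z => wedge (theta ρ g W i k z) (theta ρ g W k j z)) y := by
    ext v
    simp [formInChart, Theta]
  rw [h2, h1, curvatureForm]
  congr 1
  refine Finset.sum_congr rfl fun k _ => ?_
  rw [wedge_formInChart, hL.formInChart_theta hρ hE hg hW hy,
    hL.formInChart_theta hρ hE hg hW hy]

end LocalConnection


/-! ### Adapted frames -/

section Adapted

variable {E : Type*} [NormedAddCommGroup E] [NormedSpace ℂ E] [FiniteDimensional ℂ E]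
variable {Z : Type*} [TopologicalSpace Z] [ChartedSpace E Z]
  {ρ : Z → ℝ} {g : Z → E →L[ℂ] E →L⋆[ℂ] ℂ} {n : ℕ} {N : Set Z} {x : Z}
  {W W' : Z → Module.Basis (Fin (n + 1)) ℂ E} {ξ : Z → E} {H : Z → Submodule ℂ E}

/-- `W` is a smooth frame `ξ, W_1, …, W_n` with `W_α` in `H`, over `N ∩ X̄`, where `ξ` is
transverse to `H`. -/
structure IsAdaptedFrame (ρ : Z → ℝ) (ξ : Z → E) (H : Z → Submodule ℂ E) (N : Set Z)
    (W : Z → Module.Basis (Fin (n + 1)) ℂ E) : Prop where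
  smooth : IsSmoothFrame (N ∩ {x | ρ x ≤ 0}) W
  zero : ∀ x ∈ N ∩ {x | ρ x ≤ 0}, W x 0 = ξ x
  succ : ∀ x ∈ N ∩ {x | ρ x ≤ 0}, ∀ α : Fin n, W x α.succ ∈ H x
  notMem : ∀ x ∈ N ∩ {x | ρ x ≤ 0}, ξ x ∉ H x

omit [FiniteDimensional ℂ E] in
theorem IsAdaptedFrame.mono {N' : Set Z} (h : IsAdaptedFrame ρ ξ H N W) (hN : N' ⊆ N) :
    IsAdaptedFrame ρ ξ H N' W where
  smooth i x := (h.smooth i x).mono fun _ hy => ⟨hy.1, hN hy.2.1, hy.2.2⟩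
  zero x hx := h.zero x ⟨hN hx.1, hx.2⟩
  succ x hx := h.succ x ⟨hN hx.1, hx.2⟩
  notMem x hx := h.notMem x ⟨hN hx.1, hx.2⟩

/-- A matrix of the form `1 ⊕ a`. -/
structure IsBlockMatrix (p : Matrix (Fin (n + 1)) (Fin (n + 1)) ℂ) : Prop where
  zero_zero : p 0 0 = 1
  zero_succ : ∀ α : Fin n, p 0 α.succ = 0
  succ_zero : ∀ α : Fin n, p α.succ 0 = 0

theorem coframe_zero_eq_zero (hW : IsAdaptedFrame ρ ξ H N W) (hx : x ∈ N ∩ {x | ρ x ≤ 0}) {u : E}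
    (hu : u ∈ H x) : coframe W 0 x u = 0 := by
  by_contra hne
  have h1 := (W x).sum_repr u
  rw [Fin.sum_univ_succ, hW.zero x hx] at h1
  have h2 : (W x).repr u 0 • ξ x ∈ H x := by
    rw [← eq_sub_iff_add_eq] at h1
    rw [h1]
    exact (H x).sub_mem hu ((H x).sum_mem fun α _ => (H x).smul_mem _ (hW.succ x hx α))
  refine hW.notMem x hx (((H x).smul_mem_iff ?_).mp h2)
  exact hne

omit [FiniteDimensional ℂ E] in
theorem pullback_wedgeProd (L : E →L[ℝ] E) (m : ℕ) (F : Fin m → CForm E 2) :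
    (wedgeProd m F).compContinuousLinearMap L =
      wedgeProd m fun i => (F i).compContinuousLinearMap L := by
  induction m with
  | zero => ext v; simp [wedgeProd]
  | succ m ih => rw [wedgeProd, wedge_comp, ih]; rfl

omit [FiniteDimensional ℂ E] in
/-- The transgression form is natural under pullback. -/
theorem pullback_transgressionForm (L : E →L[ℝ] E) (A : Fin (n + 1) → Fin (n + 1) → CForm E 1)
    (B : Fin (n + 1) → Fin (n + 1) → CForm E 2) :
    (transgressionForm A B).compContinuousLinearMap L =
      transgressionForm (fun i j => (A i j).compContinuousLinearMap L)
        (fun i j => (B i j).compContinuousLinearMap L) := by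
  have hsum : ∀ {k : ℕ} {ι : Type} (s : Finset ι) (φ : ι → CForm E k),
      (∑ i ∈ s, φ i).compContinuousLinearMap L = ∑ i ∈ s, (φ i).compContinuousLinearMap L := by
    intro k ι s φ
    ext v
    simp
  have hsmul : ∀ {k : ℕ} (c : ℂ) (φ : CForm E k),
      (c • φ).compContinuousLinearMap L = c • φ.compContinuousLinearMap L := fun c φ => rfl
  have hsub : ∀ {k : ℕ} (φ η : CForm E k), (φ - η).compContinuousLinearMap L =
      φ.compContinuousLinearMap L - η.compContinuousLinearMap L := fun φ η => rfl
  have h0 : ∀ k, (Phi0 A B k).compContinuousLinearMap L =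
      Phi0 (fun i j => (A i j).compContinuousLinearMap L)
        (fun i j => (B i j).compContinuousLinearMap L) k := fun k => by
    simp only [Phi0, hsum, hsmul, wedge_comp, pullback_wedgeProd, apply_ite
      (fun φ : CForm E 2 => φ.compContinuousLinearMap L)]
  have h1 : ∀ k, (Phi1 A B k).compContinuousLinearMap L =
      Phi1 (fun i j => (A i j).compContinuousLinearMap L)
        (fun i j => (B i j).compContinuousLinearMap L) k := fun k => by
    rcases n with _ | m
    · rfl
    · by_cases hk : k ≤ m
      · simp only [Phi1, if_pos hk, hsum, hsmul, wedge_comp, pullback_wedgeProd,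
          apply_ite (fun φ : CForm E 2 => φ.compContinuousLinearMap L)]
      · simp only [Phi1, if_neg hk]
        rfl
  simp only [transgressionForm, hsmul, hsum, hsub, h0, h1]

variable [IsManifold 𝓘(ℂ, E) ω Z]

theorem isBlockMatrix_frameChange (hW : IsAdaptedFrame ρ ξ H N W)
    (hW' : IsAdaptedFrame ρ ξ H N W') {y : E} (hy : y ∈ chartSet (N ∩ {x | ρ x ≤ 0}) x) :
    IsBlockMatrix (frameChange x W W' y) := by
  have h : ∀ i k, frameChange x W W' y i k =
      coframe W k ((chartAt E x).symm y) (W' ((chartAt E x).symm y) i) := fun i k => by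
    simp only [frameChange, frameCov, Matrix.of_apply, ContinuousLinearMap.comp_apply, frameVec,
      chartDiff_vecInChart hy.1]
  have h0 : ∀ k, frameChange x W W' y 0 k = if 0 = k then 1 else 0 := fun k => by
    rw [h, hW'.zero _ hy.2, ← hW.zero _ hy.2]
    simp [coframe, Finsupp.single_apply]
  refine ⟨by rw [h0]; simp, fun α => ?_, fun α => ?_⟩
  · rw [h0, if_neg (Fin.succ_ne_zero α).symm]
  · rw [h]
    exact coframe_zero_eq_zero hW hy.2 (hW'.succ _ hy.2 α)

variable (hE : Module.finrank ℂ E = n + 1) (hρ : IsDefiningFunction (E := E) ρ)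
  (hg : IsHermitianMetric {x | ρ x < 0} g) (hgρ : IsLogMetricNearBoundary ρ g) (hN : IsOpen N)

include hE hρ

theorem curvatureForm_frameChange (hW : IsSmoothFrame (N ∩ {x | ρ x ≤ 0}) W)
    (hW' : IsSmoothFrame (N ∩ {x | ρ x ≤ 0}) W') {O : Set E}
    {Γ : Fin (Module.finrank ℂ E) → Fin (Module.finrank ℂ E) → E → E →L[ℂ] ℂ}
    (hL : IsLocalConnection ρ g N x O Γ) {y : E} (hy : y ∈ localDomain ρ x O)
    (i j : Fin (n + 1)) :
    curvatureForm (localDomain ρ x O) (localTheta (localDomain ρ x O) Γ x W') y i j =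
      ∑ k, ∑ l, (frameChange x W W' y i k * frameChange x W' W y l j) •
        curvatureForm (localDomain ρ x O) (localTheta (localDomain ρ x O) Γ x W) y k l := by
  have hK : localDomain ρ x O ⊆ (chartAt E x).target := inter_subset_left.trans hL.subset_target
  have hT := hL.uniqueDiffOn hρ
  have hV := hL.contDiffOn_frameVec hW
  have hV' := hL.contDiffOn_frameVec hW'
  exact curvatureForm_gauge hT hy (hL.mem_closure_interior hρ hy)
    (hL.contDiffOn_localTheta hρ hE hW) (hL.contDiffOn_localTheta hρ hE hW')
    (fun i k => contDiffOn_frameCov_apply hE hK hV k (hV' i))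
    (fun i k => contDiffOn_frameCov_apply hE hK hV' k (hV i))
    (fun z hz => frameChange_mul (hK hz) W W')
    (fun z hz v => localTheta_gauge hE hT hK hV hV' Γ hz v) i j

include hg hgρ hN

/-- The form `c_{n+1}(Θ)` does not depend on the frame. -/
theorem topChern_Theta_eq (hW : IsSmoothFrame (N ∩ {x | ρ x ≤ 0}) W)
    (hW' : IsSmoothFrame (N ∩ {x | ρ x ≤ 0}) W') (hx : x ∈ N ∩ {x | ρ x ≤ 0}) :
    topChern (fun i j => Theta ρ g W' i j x) = topChern (fun i j => Theta ρ g W i j x) := by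
  obtain ⟨O, Γ, hL⟩ := exists_isLocalConnection hρ hg hgρ hN hx
  have hc := hL.center_mem_localDomain hx.2
  have h : ∀ {W : Z → Module.Basis (Fin (n + 1)) ℂ E}, IsSmoothFrame (N ∩ {x | ρ x ≤ 0}) W →
      ∀ i j, Theta ρ g W i j x = curvatureForm (localDomain ρ x O)
        (localTheta (localDomain ρ x O) Γ x W) (chartAt E x x) i j := fun hW i j => by
    rw [← formInChart_Theta hE hρ hg hgρ hN hW hL hc, formInChart_center]
  simp only [h hW, h hW', curvatureForm_frameChange hE hρ hW hW' hL hc]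
  exact topChern_conj _ _ _ (frameChange_mul (mem_chart_target E x) W W')

/-- The transgression form is the same in all adapted frames. -/
theorem transgressionForm_theta_eq (hW : IsAdaptedFrame ρ ξ H N W)
    (hW' : IsAdaptedFrame ρ ξ H N W') (hx : x ∈ N ∩ {x | ρ x ≤ 0}) :
    transgressionForm (fun i j => theta ρ g W' i j x) (fun i j => Theta ρ g W' i j x) =
      transgressionForm (fun i j => theta ρ g W i j x) (fun i j => Theta ρ g W i j x) := by
  obtain ⟨O, Γ, hL⟩ := exists_isLocalConnection hρ hg hgρ hN hx
  have hc := hL.center_mem_localDomain hx.2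
  set K := localDomain ρ x O with hKd
  set y := chartAt E x x with hy
  have hyt : y ∈ (chartAt E x).target := mem_chart_target E x
  have hΘ : ∀ {W : Z → Module.Basis (Fin (n + 1)) ℂ E}, IsSmoothFrame (N ∩ {x | ρ x ≤ 0}) W →
      ∀ i j, Theta ρ g W i j x = curvatureForm K (localTheta K Γ x W) y i j := fun hW i j => by
    rw [← formInChart_Theta hE hρ hg hgρ hN hW hL hc, formInChart_center]
  have hθ : ∀ {W : Z → Module.Basis (Fin (n + 1)) ℂ E}, IsSmoothFrame (N ∩ {x | ρ x ≤ 0}) W →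
      ∀ i j, theta ρ g W i j x = localTheta K Γ x W i j y := fun hW i j => by
    rw [← hL.formInChart_theta hρ hE hg hW hc, formInChart_center]
  simp only [hΘ hW.smooth, hΘ hW'.smooth, hθ hW.smooth, hθ hW'.smooth]
  have hp : ∀ z ∈ K, IsBlockMatrix (frameChange x W W' z) := fun z hz =>
    isBlockMatrix_frameChange hW hW' (hL.localDomain_subset hz)
  have hq : ∀ z ∈ K, IsBlockMatrix (frameChange x W' W z) := fun z hz =>
    isBlockMatrix_frameChange hW' hW (hL.localDomain_subset hz)
  have hg1 : ∀ (i j : Fin (n + 1)) (v : Fin 1 → E), localTheta K Γ x W' i j y v =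
      (matDeriv K (frameChange x W W') y (v 0) * frameChange x W' W y +
        frameChange x W W' y * matApply (localTheta K Γ x W) y (v 0) * frameChange x W' W y) i j :=
    fun i j v => by
    rw [← localTheta_gauge hE (hL.uniqueDiffOn hρ)
      (inter_subset_left.trans hL.subset_target) (hL.contDiffOn_frameVec hW.smooth)
      (hL.contDiffOn_frameVec hW'.smooth) Γ hc]
    rfl
  -- the constant entries of the transition matrix have derivative zero
  have hD : ∀ v i j (c : ℂ), (∀ z ∈ K, frameChange x W W' z i j = c) →
      matDeriv K (frameChange x W W') y v i j = 0 := fun v i j c h => by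
    rw [matDeriv, Matrix.of_apply, fderivWithin_congr' h hc]
    simp
  have hD00 : ∀ v, matDeriv K (frameChange x W W') y v 0 0 = 0 := fun v =>
    hD v 0 0 1 fun z hz => (hp z hz).zero_zero
  have hD0s : ∀ v (α : Fin n), matDeriv K (frameChange x W W') y v 0 α.succ = 0 := fun v α =>
    hD v _ _ 0 fun z hz => (hp z hz).zero_succ α
  have hDs0 : ∀ v (α : Fin n), matDeriv K (frameChange x W W') y v α.succ 0 = 0 := fun v α =>
    hD v _ _ 0 fun z hz => (hp z hz).succ_zero α
  have hpy := hp y hc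
  have hqy := hq y hc
  have hz : ∀ φ : CForm E 2, (0 : ℂ) • φ = 0 := fun φ => zero_smul ℂ φ
  have hap : ∀ (i j : Fin (n + 1)) (v : Fin 1 → E),
      matApply (localTheta K Γ x W) y (v 0) i j = localTheta K Γ x W i j y v := fun i j v => rfl
  refine transgressionForm_conj _ _ _ _
    (Matrix.of fun α γ : Fin n => frameChange x W W' y α.succ γ.succ)
    (Matrix.of fun α γ : Fin n => frameChange x W' W y α.succ γ.succ) ?_ ?_ ?_ ?_ ?_ ?_
  · ext α β
    have h1 := congrFun (congrFun (frameChange_mul hyt W W') α.succ) β.succ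
    rw [Matrix.mul_apply, Fin.sum_univ_succ, hpy.succ_zero, zero_mul, zero_add] at h1
    rw [Matrix.mul_apply]
    simpa [Matrix.one_apply] using h1
  · ext v
    rw [hg1]
    simp [Matrix.mul_apply, Fin.sum_univ_succ, hD00, hD0s, hpy.zero_zero, hpy.zero_succ,
      hqy.zero_zero, hqy.succ_zero, hap]
  · intro α
    ext v
    rw [hg1]
    simp [Matrix.mul_apply, Fin.sum_univ_succ, hDs0, hpy.succ_zero,
      hqy.zero_zero, hqy.succ_zero, hap]
  · intro β
    ext v
    rw [hg1]
    simp [Matrix.mul_apply, Fin.sum_univ_succ, hD00, hD0s, hpy.zero_zero, hpy.zero_succ,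
      hqy.zero_succ, hap, mul_comm]
  · intro α
    rw [curvatureForm_frameChange hE hρ hW.smooth hW'.smooth hL hc]
    simp [Fin.sum_univ_succ, hpy.succ_zero, hqy.zero_zero, hqy.succ_zero, hz, ← hKd]
  · intro α β
    rw [curvatureForm_frameChange hE hρ hW.smooth hW'.smooth hL hc]
    simp [Fin.sum_univ_succ, hpy.succ_zero, hqy.zero_succ, hz, ← hKd]

end Adapted


/-! ### The global transgression form -/

section Global

variable {E : Type*} [NormedAddCommGroup E] [NormedSpace ℂ E]
variable {Z : Type*} [TopologicalSpace Z] [ChartedSpace E Z]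
  {ρ : Z → ℝ} {g : Z → E →L[ℂ] E →L⋆[ℂ] ℂ} {n : ℕ} {x : Z}
  {ξ : Z → E} {H : Z → Submodule ℂ E}

theorem SmoothVec.congr {S : Set Z} {V V' : Z → E} (hV : SmoothVec S V) (h : ∀ z ∈ S, V' z = V z) :
    SmoothVec S V' := by
  intro x
  refine (hV x).congr fun y hy => ?_
  have e : ∀ V : Z → E, vecInChart x V y =
      (chartDiff x y).inverse (V ((chartAt E x).symm y)) := fun _ => rfl
  rw [e, e, h _ hy.2]

variable [FiniteDimensional ℂ E]

omit [FiniteDimensional ℂ E] in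
/-- If `v` were in the complement `K` of its span, then `K` would be the whole space, which `n`
vectors do not span. -/
theorem xi_notMem (hE : Module.finrank ℂ E = n + 1) {s : Fin n → E} {K : Submodule ℂ E}
    (hK : Submodule.span ℂ (range s) = K) {v : E} (h : IsCompl (Submodule.span ℂ {v}) K) :
    v ∉ K := by
  intro hv
  have h1 : Submodule.span ℂ {v} ≤ K := by
    rw [Submodule.span_le]
    simpa using hv
  have h2 : K = ⊤ := by
    rw [← h.sup_eq_top, sup_eq_right.mpr h1]
  have h3 : Module.finrank ℂ (Submodule.span ℂ (range s)) ≤ n := by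
    have := finrank_range_le_card (R := ℂ) s
    simpa [Set.finrank] using this
  rw [hK, h2, finrank_top, hE] at h3
  omega

/-- Local frames of `H` and `ξ` form an adapted frame. -/
theorem exists_isAdaptedFrame (hE : Module.finrank ℂ E = n + 1) {P : Set Z} (hP : IsOpen Pᶜ)
    (hξ : SmoothVec ({x | ρ x ≤ 0} \ P) ξ) (hH : IsSmoothSubbundle ({x | ρ x ≤ 0} \ P) n H)
    (hs : ∀ x ∈ {x | ρ x ≤ 0} \ P, IsCompl (Submodule.span ℂ {ξ x}) (H x))
    (hx : x ∈ {x | ρ x ≤ 0} \ P) :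
    ∃ N : Set Z, IsOpen N ∧ x ∈ N ∧ N ⊆ Pᶜ ∧
      ∃ W : Z → Module.Basis (Fin (n + 1)) ℂ E, IsAdaptedFrame ρ ξ H N W := by
  classical
  obtain ⟨U, hU, hxU, s, hsm, hsp⟩ := hH x hx
  have hLI : ∀ z ∈ U ∩ ({x | ρ x ≤ 0} \ P),
      LinearIndependent ℂ (Fin.cons (ξ z) fun α => s α z : Fin (n + 1) → E) := fun z hz => by
    rw [linearIndependent_finCons]
    refine ⟨(hsp z hz).1, ?_⟩
    rw [(hsp z hz).2]
    exact xi_notMem hE (hsp z hz).2 (hs z hz.2)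
  let W : Z → Module.Basis (Fin (n + 1)) ℂ E := fun z =>
    if hz : z ∈ U ∩ ({x | ρ x ≤ 0} \ P) then
      basisOfLinearIndependentOfCardEqFinrank (hLI z hz) (by simp [hE])
    else (Module.finBasis ℂ E).reindex (finCongr hE)
  have hW : ∀ z ∈ U ∩ ({x | ρ x ≤ 0} \ P), ∀ i,
      W z i = (Fin.cons (ξ z) fun α => s α z : Fin (n + 1) → E) i := fun z hz i => by
    have h : W z = basisOfLinearIndependentOfCardEqFinrank (hLI z hz) (by simp [hE]) := dif_pos hz
    rw [h, coe_basisOfLinearIndependentOfCardEqFinrank]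
  have hsub : (U ∩ Pᶜ) ∩ {x | ρ x ≤ 0} ⊆ U ∩ ({x | ρ x ≤ 0} \ P) :=
    fun z hz => ⟨hz.1.1, hz.2, hz.1.2⟩
  refine ⟨U ∩ Pᶜ, hU.inter hP, ⟨hxU, hx.2⟩, inter_subset_right, W, ⟨?_, ?_, ?_, ?_⟩⟩
  · intro i
    have h1 : SmoothVec (U ∩ ({x | ρ x ≤ 0} \ P)) fun z => W z i := by
      refine Fin.cases ?_ (fun α => ?_) i
      · refine SmoothVec.congr (V := ξ) (fun x' => (hξ x').mono fun y hy => ⟨hy.1, hy.2.2⟩)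
          fun z hz => ?_
        rw [hW z hz, Fin.cons_zero]
      · refine SmoothVec.congr (hsm α) fun z hz => ?_
        rw [hW z hz, Fin.cons_succ]
    exact fun x' => (h1 x').mono fun y hy => ⟨hy.1, hsub hy.2⟩
  · intro z hz
    rw [hW z (hsub hz), Fin.cons_zero]
  · intro z hz α
    rw [hW z (hsub hz), Fin.cons_succ, ← (hsp z (hsub hz)).2]
    exact Submodule.subset_span (mem_range_self α)
  · intro z hz
    exact xi_notMem hE (hsp z (hsub hz)).2 (hs z (hsub hz).2)

open Classical in
/-- The transgression form, computed at each point in some adapted frame near this point. -/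
def globalForm (n : ℕ) (ρ : Z → ℝ) (g : Z → E →L[ℂ] E →L⋆[ℂ] ℂ) (ξ : Z → E)
    (H : Z → Submodule ℂ E) (x : Z) : CForm E (2 * n + 1) :=
  if h : ∃ W : Z → Module.Basis (Fin (n + 1)) ℂ E, ∃ N : Set Z,
      IsOpen N ∧ x ∈ N ∧ IsAdaptedFrame ρ ξ H N W then
    transgressionForm (fun i j => theta ρ g h.choose i j x) (fun i j => Theta ρ g h.choose i j x)
  else 0

variable [IsManifold 𝓘(ℂ, E) ω Z]
variable (hE : Module.finrank ℂ E = n + 1) (hρ : IsDefiningFunction (E := E) ρ)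
  (hg : IsHermitianMetric {x | ρ x < 0} g) (hgρ : IsLogMetricNearBoundary ρ g)
  {N : Set Z} (hN : IsOpen N) {W : Z → Module.Basis (Fin (n + 1)) ℂ E}
  (hW : IsAdaptedFrame ρ ξ H N W)

include hE hρ hg hgρ hN hW

/-- By the invariance of the transgression form, any adapted frame computes the global form. -/
theorem globalForm_eq (hx : x ∈ N ∩ {x | ρ x ≤ 0}) :
    globalForm n ρ g ξ H x =
      transgressionForm (fun i j => theta ρ g W i j x) (fun i j => Theta ρ g W i j x) := by
  have h : ∃ W : Z → Module.Basis (Fin (n + 1)) ℂ E, ∃ N : Set Z,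
      IsOpen N ∧ x ∈ N ∧ IsAdaptedFrame ρ ξ H N W := ⟨W, N, hN, hx.1, hW⟩
  rw [globalForm, dif_pos h]
  obtain ⟨N', hN', hxN', hW'⟩ := h.choose_spec
  exact transgressionForm_theta_eq hE hρ hg hgρ (hN.inter hN')
    (hW.mono inter_subset_left) (hW'.mono inter_subset_right) ⟨⟨hx.1, hxN'⟩, hx.2⟩

theorem formInChart_globalForm {O : Set E}
    {Γ : Fin (Module.finrank ℂ E) → Fin (Module.finrank ℂ E) → E → E →L[ℂ] ℂ}
    (hL : IsLocalConnection ρ g N x O Γ) {y : E} (hy : y ∈ localDomain ρ x O) :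
    formInChart x (globalForm n ρ g ξ H) y =
      transgressionForm (fun i j => localTheta (localDomain ρ x O) Γ x W i j y)
        (curvatureForm (localDomain ρ x O) (localTheta (localDomain ρ x O) Γ x W) y) := by
  rw [formInChart, globalForm_eq hE hρ hg hgρ hN hW (hL.localDomain_subset hy).2,
    pullback_transgressionForm]
  congr 1
  · funext i j
    exact hL.formInChart_theta hρ hE hg hW.smooth hy i j
  · funext i j
    exact formInChart_Theta hE hρ hg hgρ hN hW.smooth hL hy i j

theorem contDiffWithinAt_globalForm (hx : x ∈ N ∩ {x | ρ x ≤ 0}) :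
    ContDiffWithinAt ℝ ∞ (formInChart x (globalForm n ρ g ξ H)) (chartSet {x | ρ x ≤ 0} x)
      (chartAt E x x) := by
  obtain ⟨O, Γ, hL⟩ := exists_isLocalConnection hρ hg hgρ hN hx
  have hc := hL.center_mem_localDomain hx.2
  have hA := hL.contDiffOn_localTheta hρ hE hW.smooth
  have h := contDiffOn_transgressionForm hA
    (contDiffOn_curvatureForm hA (hL.uniqueDiffOn hρ)) _ hc
  exact (h.congr (fun z hz => formInChart_globalForm hE hρ hg hgρ hN hW hL hz)
    (formInChart_globalForm hE hρ hg hgρ hN hW hL hc)).mono_of_mem_nhdsWithin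
    (hL.localDomain_mem_nhdsWithin subset_rfl)

theorem extD_globalForm (hx : x ∈ N ∩ {x | ρ x ≤ 0}) :
    extD {x | ρ x ≤ 0} (globalForm n ρ g ξ H) x = topChern (fun i j => Theta ρ g W i j x) := by
  obtain ⟨O, Γ, hL⟩ := exists_isLocalConnection hρ hg hgρ hN hx
  have hc := hL.center_mem_localDomain hx.2
  have hx0 : (chartAt E x).symm (chartAt E x x) = x := (chartAt E x).left_inv (mem_chart_source E x)
  have hΘ : (fun i j => Theta ρ g W i j x) = curvatureForm (localDomain ρ x O)
      (localTheta (localDomain ρ x O) Γ x W) (chartAt E x x) := by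
    funext i j
    rw [← formInChart_Theta hE hρ hg hgρ hN hW.smooth hL hc, formInChart_center]
  have hsub : localDomain ρ x O ⊆ chartSet {x | ρ x ≤ 0} x := fun z hz =>
    ⟨(hL.localDomain_subset hz).1, (hL.localDomain_subset hz).2.2⟩
  have hs := contDiffWithinAt_globalForm hE hρ hg hgρ hN hW hx
  rw [← formInChart_center x (extD {x | ρ x ≤ 0} (globalForm n ρ g ξ H)),
    formInChart_extD (S := {x | ρ x ≤ 0}) (s := localDomain ρ x O) (hsub hc) (hL.uniqueDiffOn hρ)
      hsub hc (hL.mem_closure_interior hρ hc) (by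
        rw [hx0]
        have : trans x x (chartAt E x x) = chartAt E x x := trans_self (mem_chart_target E x)
        rw [this]
        exact hs),
    extDerivWithin_congr' (fun z hz => formInChart_globalForm hE hρ hg hgρ hN hW hL hz) hc, hΘ]
  exact extDerivWithin_transgressionForm (hL.contDiffOn_localTheta hρ hE hW.smooth)
    (hL.uniqueDiffOn hρ) hc (hL.mem_closure_interior hρ hc)

end Global

end RenormChern

end

theorem mainTheorem4 {n : ℕ}
    {E : Type*} [NormedAddCommGroup E] [NormedSpace ℂ E] [FiniteDimensional ℂ E]
    (hE : Module.finrank ℂ E = n + 1)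
    {Z : Type*} [TopologicalSpace Z] [T2Space Z] [ChartedSpace E Z] [IsManifold 𝓘(ℂ, E) ω Z]
    (ρ : Z → ℝ) (hρ : RenormChern.IsDefiningFunction (E := E) ρ)
    (g : Z → E →L[ℂ] E →L⋆[ℂ] ℂ) (hg : RenormChern.IsHermitianMetric {x | ρ x < 0} g)
    (hgρ : RenormChern.IsLogMetricNearBoundary ρ g)
    (P : Finset Z) (V ξ : Z → E) (H : Z → Submodule ℂ E)
    (hξ : RenormChern.IsAdaptedSplitting n ρ g P V ξ H) :
    ∃ Pi : Z → RenormChern.CForm E (2 * n + 1),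
      RenormChern.SmoothForm ({x | ρ x ≤ 0} \ (P : Set Z)) Pi ∧
      -- in every local (1,0)-frame, `θ_i^j` is smooth up to the boundary and `c_{n+1}(Θ) = dΠ`
      (∀ U : Set Z, IsOpen U → ∀ W : Z → Module.Basis (Fin (n + 1)) ℂ E,
        RenormChern.IsSmoothFrame (U ∩ ({x | ρ x ≤ 0} \ (P : Set Z))) W →
        (∀ i j, RenormChern.SmoothForm (U ∩ ({x | ρ x ≤ 0} \ (P : Set Z)))
          (RenormChern.theta ρ g W i j)) ∧
        ∀ x ∈ U ∩ ({x | ρ x ≤ 0} \ (P : Set Z)),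
          RenormChern.topChern (fun i j => RenormChern.Theta ρ g W i j x) =
            RenormChern.extD {x | ρ x ≤ 0} Pi x) ∧
      -- in every local frame `ξ, W_1, …, W_n` with `W_α` in `H`, `Π` is given by the formula
      (∀ U : Set Z, IsOpen U → ∀ W : Z → Module.Basis (Fin (n + 1)) ℂ E,
        RenormChern.IsSmoothFrame (U ∩ ({x | ρ x ≤ 0} \ (P : Set Z))) W →
        (∀ x ∈ U ∩ ({x | ρ x ≤ 0} \ (P : Set Z)),
          W x 0 = ξ x ∧ ∀ α : Fin n, W x α.succ ∈ H x) →
        ∀ x ∈ U ∩ ({x | ρ x ≤ 0} \ (P : Set Z)),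
          Pi x = RenormChern.transgressionForm (fun i j => RenormChern.theta ρ g W i j x)
            (fun i j => RenormChern.Theta ρ g W i j x)) := by
  classical
  have hP : IsOpen ((P : Set Z)ᶜ) := P.finite_toSet.isClosed.isOpen_compl
  have hset : ∀ U : Set Z, U ∩ ({x | ρ x ≤ 0} \ (P : Set Z)) =
      (U ∩ (P : Set Z)ᶜ) ∩ {x | ρ x ≤ 0} := fun U => by
    ext z; simp only [Set.mem_inter_iff, Set.mem_sdiff, Set.mem_compl_iff]; tauto
  have hadapted : ∀ x ∈ {x | ρ x ≤ 0} \ (P : Set Z), ∃ N : Set Z, IsOpen N ∧ x ∈ N ∧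
      N ⊆ (P : Set Z)ᶜ ∧ ∃ W : Z → Module.Basis (Fin (n + 1)) ℂ E,
        RenormChern.IsAdaptedFrame ρ ξ H N W := fun x hx =>
    RenormChern.exists_isAdaptedFrame hE hP hξ.smooth_xi hξ.subbundle_H hξ.splitting hx
  refine ⟨RenormChern.globalForm n ρ g ξ H, ?_, ?_, ?_⟩
  · refine RenormChern.smoothForm_of_center fun x hx => ?_
    obtain ⟨N, hN, hxN, -, W, hW⟩ := hadapted x hx
    exact (RenormChern.contDiffWithinAt_globalForm hE hρ hg hgρ hN hW ⟨hxN, hx.1⟩).mono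
      fun y hy => ⟨hy.1, hy.2.1⟩
  · intro U hU W hW
    rw [hset] at hW ⊢
    refine ⟨RenormChern.smoothForm_theta hE hρ hg hgρ (hU.inter hP) hW, fun x hx => ?_⟩
    obtain ⟨N, hN, hxN, -, W₀, hW₀⟩ := hadapted x ⟨hx.2, hx.1.2⟩
    rw [RenormChern.extD_globalForm hE hρ hg hgρ hN hW₀ ⟨hxN, hx.2⟩]
    exact RenormChern.topChern_Theta_eq hE hρ hg hgρ ((hU.inter hP).inter hN)
      (hW₀.mono Set.inter_subset_right).smooth
      (fun i x' => (hW i x').mono fun y hy => ⟨hy.1, hy.2.1.1, hy.2.2⟩) ⟨⟨hx.1, hxN⟩, hx.2⟩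
  · intro U hU W hW hWξ x hx
    rw [hset] at hW hWξ hx
    refine RenormChern.globalForm_eq hE hρ hg hgρ (hU.inter hP)
      ⟨hW, fun z hz => (hWξ z hz).1, fun z hz => (hWξ z hz).2, fun z hz => ?_⟩ hx
    obtain ⟨N, -, hzN, -, W₀, hW₀⟩ := hadapted z ⟨hz.2, hz.1.2⟩
    exact hW₀.notMem z ⟨hzN, hz.2⟩
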